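/- Let $K$ be a field of characteristic $0$ containing $i$ with $i^2=-1$, let $q^{1/2}\in K^\times$ not be a root of unity, $q=(q^{1/2})^2$, and $[m]=\frac{q^m-q^{-m}}{q-q^{-1}}$, $[m]!=[1]\cdots[m]$, $\kappa=\frac{q+1}{q-1}$. Let $n\ge 1$ and let $V$ be the $K$-vector space with basis $|\mathbf m\rangle$, $\mathbf m=(m_1,\dots,m_n)\in(\mathbb Z_{\ge0})^n$; write $\mathbf e_j$ for the $j$-th unit vector. For $x\in K^\times$ let $V_x$ be $V$ with the $q$-oscillator representation $\pi_x$ of $U_q(A^{(2)}_{2n})$, in which the generators act by $$e_0|\mathbf m\rangle=x|\mathbf m+\mathbf e_1\rangle,\quad f_0|\mathbf m\rangle=i\kappa[m_1]x^{-1}|\mathbf m-\mathbf e_1\rangle,\quad k_0|\mathbf m\rangle=-iq^{m_1+1/2}|\mathbf m\rangle,$$ $$e_j|\mathbf m\rangle=[m_j]|\mathbf m-\mathbf e_j+\mathbf e_{j+1}\rangle,\quad f_j|\mathbf m\rangle=[m_{j+1}]|\mathbf m+\mathbf e_j-\mathbf e_{j+1}\rangle,\quad k_j|\mathbf m\rangle=q^{-m_j+m_{j+1}}|\mathbf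 m\rangle\quad(1\le j\le n-1),$$ $$e_n|\mathbf m\rangle=\tfrac{[m_n][m_n-1]}{[2]^2}|\mathbf m-2\mathbf e_n\rangle,\quad f_n|\mathbf m\rangle=|\mathbf m+2\mathbf e_n\rangle,\quad k_n|\mathbf m\rangle=-q^{-2m_n-1}|\mathbf m\rangle .$$ Use the coproduct $\Delta k_r^{\pm1}=k_r^{\pm1}\otimes k_r^{\pm1}$, $\Delta e_r=1\otimes e_r+e_r\otimes k_r$, $\Delta f_r=f_r\otimes1+k_r^{-1}\otimes f_r$, let $P(u\otimes v)=v\otimes u$, and let $\Delta'=P\circ\Delta$ be the opposite coproduct. Let $x,y\in K^\times$ and $z=x/y$, and suppose that $1\mp iq^{j-1/2}z\neq0$ for both signs and all $j\ge1$. A quantum $R$ matrix is a linear operator $R$ on $V_x\otimes V_y$ with $\Delta'(g)R=R\,\Delta(g)$ for all generators $g=k_r,e_r,f_r$ $(0\le r\le n)$ (equivalently, for all $g\in U_q(A^{(2)}_{2n})$) and $R(|\mathbf 0\rangle\otimes|\mathbf 0\rangle)=|\mathbf 0\rangle\otimes|\mathbf 0\rangle$. For $l\ge0$ put $$v^{+}_l=\sum_{\substack{0\le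 k\le l\\ k\text{ even}}}q^{k(2l-k-1)/2}\frac{[l]!}{[k]![l-k]!}\,|k\mathbf e_n\rangle\otimes|(l-k)\mathbf e_n\rangle,$$ for $l\ge1$ let $v^-_l$ be the same sum over odd $k$, and let $v^-_0=|\mathbf e_{n-1}\rangle\otimes|\mathbf e_n\rangle-q|\mathbf e_n\rangle\otimes|\mathbf e_{n-1}\rangle$ if $n\ge2$, $v_0^-=0$ if $n=1$. Let $U_q(C_n)$ be the subalgebra generated by $e_r,f_r,k_r^{\pm1}$ with $1\le r\le n$, acting on $V\otimes V$ through $\Delta$. Let $V_0^\pm$ be the $U_q(C_n)$-submodule generated by $v_0^\pm$, and for $l\ge1$ let $W_l^\pm$ be the $U_q(C_n)$-submodule generated by $v_l^+\pm v_l^-$. Then $$V\otimes V=V_0^+\oplus V_0^-\oplus\bigoplus_{l\ge1}\bigl(W_l^+\oplus W_l^-\bigr).$$ Moreover there is exactly one quantum $R$ matrix $R(z)$ on $V_x\otimes V_y$, and $$PR(z)=P_0+\sum_{l=1}^\infty\left(\prod_{j=1}^l\frac{z-iq^{j-1/2}}{1-iq^{j-1/2}z}\,P^+_l+\prod_{j=1}^l\frac{z+iq^{j-1/2}}{1+iq^{j-1/2}z}\,P^-_l\right),$$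 where $P_0$ is the projector onto $V_0^+\oplus V_0^-$ and $P_l^\pm$ is the projector onto $W_l^\pm$, all with respect to the above decomposition; applied to any given vector, only finitely many terms of the sum are nonzero. -/

import Mathlib

open scoped TensorProduct

/-!
The `q`-oscillator representation of `U_q(A^{(2)}_{2n})`, for `n = N + 1`.

The base field `K` contains `im` (a square root of `-1`) and `t = q^{1/2}`; thus `q = t ^ 2`.
The sites `1, …, n` are the elements of `Fin (N + 1)`.
-/
namespace QOsc

/-- The vertices of the Dynkin diagram `0 <= 1 - 2 - ⋯ - (n-1) <= n` with `n = N + 1`: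
`zero` is the vertex `0`, `last` is the vertex `n`, and `mid j` with `j = 0, …, N - 1` is the
vertex `j + 1`, which joins the sites `j.castSucc` and `j.succ`. -/
inductive Vertex (N : ℕ) : Type
  | zero : Vertex N
  | mid (j : Fin N) : Vertex N
  | last : Vertex N

/-- The Fock space `V = F̂^{⊗ n}`, with basis `|m₁, …, m_n⟩`, `m_i ∈ ℤ_{≥ 0}`. -/
abbrev Fock (K : Type*) [Field K] (N : ℕ) : Type _ := (Fin (N + 1) → ℕ) →₀ K

section

variable {K : Type*} [Field K]

/-- The basis vector `|m⟩`. -/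
noncomputable def ket {N : ℕ} (m : Fin (N + 1) → ℕ) : Fock K N := Finsupp.single m 1

/-- The vector `a e_i` of occupation numbers. -/
def site {N : ℕ} (i : Fin (N + 1)) (a : ℕ) : Fin (N + 1) → ℕ := Pi.single i a

/-- `[m] = (q^m - q^{-m}) / (q - q^{-1})`. -/
noncomputable def qNum (q : K) (m : ℤ) : K := (q ^ m - q ^ (-m)) / (q - q⁻¹)

/-- `[m]! = [1][2]⋯[m]`. -/
noncomputable def qFact (q : K) (m : ℕ) : K := ∏ k ∈ Finset.Icc 1 m, qNum q (k : ℤ)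

/-- The `q`-binomial coefficient `[l]! / ([k]! [l-k]!)`, used for `k ≤ l` only. -/
noncomputable def qBinom (q : K) (l k : ℕ) : K := qFact q l / (qFact q k * qFact q (l - k))

/-- `κ = (q + 1) / (q - 1)`. -/
noncomputable def kappa (q : K) : K := (q + 1) / (q - 1)

/-- The action of `e_r` on `V_x`. Whenever a subtraction of occupation numbers would be
negative, the coefficient in front is zero. -/
noncomputable def eOp (N : ℕ) (t x : K) : Vertex N → Module.End K (Fock K N)
  | .zero => Finsupp.linearCombination K fun m => x • ket (m + site 0 1)
  | .mid j => Finsupp.linearCombination K fun m =>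
      qNum (t ^ 2) (m j.castSucc) • ket (m - site j.castSucc 1 + site j.succ 1)
  | .last => Finsupp.linearCombination K fun m =>
      (qNum (t ^ 2) (m (Fin.last N)) * qNum (t ^ 2) ((m (Fin.last N) : ℤ) - 1)
        / qNum (t ^ 2) 2 ^ 2) • ket (m - site (Fin.last N) 2)

/-- The action of `f_r` on `V_x`. -/
noncomputable def fOp (N : ℕ) (im t x : K) : Vertex N → Module.End K (Fock K N)
  | .zero => Finsupp.linearCombination K fun m =>
      (im * kappa (t ^ 2) * qNum (t ^ 2) (m 0) * x⁻¹) • ket (m - site 0 1)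
  | .mid j => Finsupp.linearCombination K fun m =>
      qNum (t ^ 2) (m j.succ) • ket (m + site j.castSucc 1 - site j.succ 1)
  | .last => Finsupp.linearCombination K fun m => ket (m + site (Fin.last N) 2)

/-- The eigenvalue of `k_r` on `|m⟩`. -/
noncomputable def kEig (N : ℕ) (im t : K) : Vertex N → (Fin (N + 1) → ℕ) → K
  | .zero, m => -im * t ^ (2 * (m 0 : ℤ) + 1)
  | .mid j, m => (t ^ 2) ^ (-(m j.castSucc : ℤ) + (m j.succ : ℤ))
  | .last, m => -(t ^ 2) ^ (-2 * (m (Fin.last N) : ℤ) - 1)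

/-- The action of `k_r`. -/
noncomputable def kOp (N : ℕ) (im t : K) (r : Vertex N) : Module.End K (Fock K N) :=
  Finsupp.linearCombination K fun m => kEig N im t r m • ket m

/-- The action of `k_r^{-1}`. -/
noncomputable def kInvOp (N : ℕ) (im t : K) (r : Vertex N) : Module.End K (Fock K N) :=
  Finsupp.linearCombination K fun m => (kEig N im t r m)⁻¹ • ket m

/-- The space `V ⊗ V`. -/
abbrev Fock2 (K : Type*) [Field K] (N : ℕ) : Type _ := Fock K N ⊗[K] Fock K N

/-- `(π_x ⊗ π_y) Δ(e_r)`, where `Δ e_r = 1 ⊗ e_r + e_r ⊗ k_r`. -/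
noncomputable def deltaE (N : ℕ) (im t x y : K) (r : Vertex N) : Module.End K (Fock2 K N) :=
  TensorProduct.map 1 (eOp N t y r) + TensorProduct.map (eOp N t x r) (kOp N im t r)

/-- `(π_x ⊗ π_y) Δ(f_r)`, where `Δ f_r = f_r ⊗ 1 + k_r^{-1} ⊗ f_r`. -/
noncomputable def deltaF (N : ℕ) (im t x y : K) (r : Vertex N) : Module.End K (Fock2 K N) :=
  TensorProduct.map (fOp N im t x r) 1 + TensorProduct.map (kInvOp N im t r) (fOp N im t y r)

/-- The action of `Δ(k_r) = k_r ⊗ k_r`. -/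
noncomputable def deltaK (N : ℕ) (im t : K) (r : Vertex N) : Module.End K (Fock2 K N) :=
  TensorProduct.map (kOp N im t r) (kOp N im t r)

/-- The action of `Δ(k_r^{-1}) = k_r^{-1} ⊗ k_r^{-1}`. -/
noncomputable def deltaKInv (N : ℕ) (im t : K) (r : Vertex N) : Module.End K (Fock2 K N) :=
  TensorProduct.map (kInvOp N im t r) (kInvOp N im t r)

/-- `(π_x ⊗ π_y) Δ'(e_r)` for the opposite coproduct: `Δ' e_r = e_r ⊗ 1 + k_r ⊗ e_r`. -/
noncomputable def deltaE' (N : ℕ) (im t x y : K) (r : Vertex N) : Module.End K (Fock2 K N) :=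
  TensorProduct.map (eOp N t x r) 1 + TensorProduct.map (kOp N im t r) (eOp N t y r)

/-- `(π_x ⊗ π_y) Δ'(f_r)` for the opposite coproduct: `Δ' f_r = 1 ⊗ f_r + f_r ⊗ k_r^{-1}`. -/
noncomputable def deltaF' (N : ℕ) (im t x y : K) (r : Vertex N) : Module.End K (Fock2 K N) :=
  TensorProduct.map 1 (fOp N im t y r) + TensorProduct.map (fOp N im t x r) (kInvOp N im t r)

/-- `R` is the quantum `R` matrix on `V_x ⊗ V_y`: `Δ'(g) R = R Δ(g)` for all the generators
`g = k_r, e_r, f_r` (`0 ≤ r ≤ n`), and `R (|0⟩ ⊗ |0⟩) = |0⟩ ⊗ |0⟩`. -/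
structure IsQuantumR (N : ℕ) (im t x y : K) (R : Module.End K (Fock2 K N)) : Prop where
  comm_k : ∀ r, deltaK N im t r * R = R * deltaK N im t r
  comm_e : ∀ r, deltaE' N im t x y r * R = R * deltaE N im t x y r
  comm_f : ∀ r, deltaF' N im t x y r * R = R * deltaF N im t x y r
  normalized : R (ket 0 ⊗ₜ[K] ket 0) = ket 0 ⊗ₜ[K] ket 0

/-- A subspace of `V ⊗ V` is `U_q(C_n)`-invariant if it is stable under the action of
`e_r, f_r, k_r, k_r^{-1}` for `1 ≤ r ≤ n`. This action does not involve the parameters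
`x, y`, which are put equal to `1` here. -/
def IsInvariantC (N : ℕ) (im t : K) (W : Submodule K (Fock2 K N)) : Prop :=
  ∀ r : Vertex N, r ≠ .zero → ∀ v ∈ W,
    deltaE N im t 1 1 r v ∈ W ∧ deltaF N im t 1 1 r v ∈ W ∧
      deltaK N im t r v ∈ W ∧ deltaKInv N im t r v ∈ W

/-- The `U_q(C_n)`-submodule of `V ⊗ V` generated by the vector `v`. -/
noncomputable def generatedC (N : ℕ) (im t : K) (v : Fock2 K N) : Submodule K (Fock2 K N) :=
  sInf {W | IsInvariantC N im t W ∧ v ∈ W}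

/-- `∑ q^{k(2l-k-1)/2} [l choose k] |k e_n⟩ ⊗ |(l-k) e_n⟩`, over `0 ≤ k ≤ l` with
`k ≡ p mod 2`. -/
noncomputable def paritySum (N : ℕ) (t : K) (p l : ℕ) : Fock2 K N :=
  ∑ k ∈ (Finset.range (l + 1)).filter (fun k => k % 2 = p),
    (t ^ ((k : ℤ) * (2 * (l : ℤ) - (k : ℤ) - 1)) * qBinom (t ^ 2) l k) •
      (ket (site (Fin.last N) k) ⊗ₜ[K] ket (site (Fin.last N) (l - k)))

/-- The singular vector `v^+_l`, `l ≥ 0`. -/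
noncomputable def vPlus (N : ℕ) (t : K) (l : ℕ) : Fock2 K N := paritySum N t 0 l

/-- `v^-_0 = |e_{n-1}⟩ ⊗ |e_n⟩ - q |e_n⟩ ⊗ |e_{n-1}⟩` for `n ≥ 2`; for `n = 1` there is no such
vector and the value is `0`. -/
noncomputable def vMinusZero (t : K) : (N : ℕ) → Fock2 K N
  | 0 => 0
  | N + 1 =>
      ket (site (Fin.last N).castSucc 1) ⊗ₜ[K] ket (site (Fin.last (N + 1)) 1)
        - (t ^ 2) • (ket (site (Fin.last (N + 1)) 1) ⊗ₜ[K] ket (site (Fin.last N).castSucc 1))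

/-- The singular vector `v^-_l`, `l ≥ 0`. -/
noncomputable def vMinus (N : ℕ) (t : K) (l : ℕ) : Fock2 K N :=
  if l = 0 then vMinusZero t N else paritySum N t 1 l

/-- The two signs that label the components. -/
inductive PM : Type
  | plus : PM
  | minus : PM
  deriving DecidableEq

/-- The `U_q(C_n)`-components of `V ⊗ V`. For `l = 0` they are `V^+_0` and `V^-_0`, generated by
`v^+_0` and `v^-_0`; for `l ≥ 1` they are generated by `v^+_l + v^-_l` and `v^+_l - v^-_l`. -/
noncomputable def component (N : ℕ) (im t : K) : PM × ℕ → Submodule K (Fock2 K N)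
  | (.plus, 0) => generatedC N im t (vPlus N t 0)
  | (.minus, 0) => generatedC N im t (vMinus N t 0)
  | (.plus, l + 1) => generatedC N im t (vPlus N t (l + 1) + vMinus N t (l + 1))
  | (.minus, l + 1) => generatedC N im t (vPlus N t (l + 1) - vMinus N t (l + 1))

open Classical in
/-- The projector onto the summand `W i` of a direct sum decomposition `M = ⨁ W j`, along the
other summands. (If `M` is not the internal direct sum of the `W j`, it is set to `0`.) -/
noncomputable def projector {M ι : Type*} [DecidableEq ι] [AddCommMonoid M] [Module K M]
    (W : ι → Submodule K M) (i : ι) : Module.End K M :=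
  if h : Function.Bijective (DirectSum.coeLinearMap W) then
    (W i).subtype ∘ₗ DirectSum.component K ι (fun j => W j) i ∘ₗ
      (LinearEquiv.ofBijective (DirectSum.coeLinearMap W) h).symm.toLinearMap
  else 0

/-- `P_0`, the projector on `V^+_0 ⊕ V^-_0`. -/
noncomputable def projZero (N : ℕ) (im t : K) : Module.End K (Fock2 K N) :=
  projector (component N im t) (PM.plus, 0) + projector (component N im t) (PM.minus, 0)

/-- `P^+_l`, used for `l ≥ 1`: the projector on the component containing `v^+_l + v^-_l`. -/
noncomputable def projPlus (N : ℕ) (im t : K) (l : ℕ) : Module.End K (Fock2 K N) :=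
  projector (component N im t) (PM.plus, l)

/-- `P^-_l`, used for `l ≥ 1`: the projector on the component containing `v^+_l - v^-_l`. -/
noncomputable def projMinus (N : ℕ) (im t : K) (l : ℕ) : Module.End K (Fock2 K N) :=
  projector (component N im t) (PM.minus, l)

/-- `q^{j - 1/2}`. -/
noncomputable def qHalf (t : K) (j : ℕ) : K := t ^ (2 * (j : ℤ) - 1)

end

end QOsc

/-! Put T = P R. The flip turns Δ' with parameters (x, y) into Δ with parameters (y, x), so R is a
quantum R matrix exactly when T fixes the vacuum and intertwines Δ on V_x ⊗ V_y with Δ on V_y ⊗ V_x.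
The generators with r ≥ 1 do not see x and y, so an operator that is a scalar on each component
commutes with them. What remains concerns e_0 and f_0.

Decomposition. The given vectors are singular (`IsSingular`), so the U_q(C_n)-modules they generate
are spanned by words in the f_r (`generatedC_eq_fSpan`). There is a nondegenerate diagonal form for
which f_r is adjoint to a multiple of k_r⁻¹ e_r; hence orthogonal singular vectors generate
orthogonal modules (`form2_fSpan_eq_zero`), which gives independence. Spanning is
`eq_top_of_fClosed`, an induction on a grading that the f_r raise. Neither irreducibility nor
characters are needed.

Intertwining. Write A = `crR 0` and B = `crL t 0`; then e_0 acts as y A - i q^{1/2} x B. For v =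
v_l^+ + s v_l^- with s = ±1, the vector q^l B v + s A v lies in the component of degree l + 1 and
sign s, and B v - s q^l A v in the one of degree l - 1 (in V_0^+ ⊕ V_0^- if l = 1). Comparing
coefficients leaves two scalar recursions, and the product formula satisfies both (`rho_succ_mul`,
`rho_mul_down`). Since e_0 commutes with f_r for r ≥ 1, it is enough to check singular vectors
(`ActsByRho.deltaE_zero_mul`). The relation for f_0 is the adjoint of the one for e_0: T is
self-adjoint, and taking adjoints inverts x and y (`ActsByRho.deltaF_mul`). The memberships are
computed near the last site, then carried to the first site by f_j (`crL_add_crR_zero_mem`).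

Uniqueness. The nonvanishing denominators imply that the vacuum generates V_x ⊗ V_y
(`DeltaClosed.eq_top`), so the value on the vacuum determines R. -/

namespace QOsc

/-- `t = q^{1/2}` is a nonzero element of infinite multiplicative order. -/
structure Generic {K : Type*} [Field K] (t : K) : Prop where
  ne_zero : t ≠ 0
  pow_ne_one : ∀ m : ℕ, 0 < m → t ^ m ≠ 1

/-! ### q-numbers and their nonvanishing for generic t. -/

section QNumbers

variable {K : Type*} [Field K] {t : K}

theorem Generic.zpow_ne_one (ht : Generic t) {m : ℤ} (hm : m ≠ 0) : t ^ m ≠ 1 := by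
  intro h
  have h1 : t ^ m.natAbs = 1 := by
    rcases Int.natAbs_eq m with h2 | h2
    · rw [h2, zpow_natCast] at h; exact h
    · rw [h2, zpow_neg, inv_eq_one, zpow_natCast] at h; exact h
  exact ht.pow_ne_one _ (Int.natAbs_pos.2 hm) h1

theorem Generic.sq_ne_zero (ht : Generic t) : t ^ 2 ≠ 0 := pow_ne_zero _ ht.ne_zero

theorem Generic.sub_inv_ne_zero (ht : Generic t) : t ^ 2 - (t ^ 2)⁻¹ ≠ 0 := by
  intro h
  apply ht.pow_ne_one 4 (by norm_num)
  have h0 := ht.ne_zero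
  field_simp at h
  linear_combination h

theorem Generic.sq_sq_sub_one_ne_zero (ht : Generic t) : (t ^ 2) ^ 2 - 1 ≠ 0 := by
  intro h
  exact ht.pow_ne_one 4 (by norm_num) (by linear_combination h)

theorem Generic.qNum_ne_zero (ht : Generic t) {m : ℤ} (hm : m ≠ 0) : qNum (t ^ 2) m ≠ 0 := by
  unfold qNum
  refine div_ne_zero ?_ ht.sub_inv_ne_zero
  intro h
  have h0 := ht.ne_zero
  apply ht.zpow_ne_one (m := 4 * m) (by omega)
  have h1 : (t ^ 2) ^ m ≠ 0 := zpow_ne_zero _ ht.sq_ne_zero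
  rw [zpow_neg] at h
  have h2 : ((t ^ 2) ^ m) ^ 2 = 1 := by
    field_simp at h
    linear_combination h
  rw [← h2, ← zpow_natCast, ← zpow_natCast t, ← zpow_mul, ← zpow_mul]
  congr 1; push_cast; ring

@[simp] theorem qNum_zero (q : K) : qNum q 0 = 0 := by simp [qNum]

theorem Generic.qNum_one (ht : Generic t) : qNum (t ^ 2) 1 = 1 := by
  simp only [qNum, zpow_one, zpow_neg]
  exact div_self ht.sub_inv_ne_zero

theorem Generic.qNum_two (ht : Generic t) : qNum (t ^ 2) 2 = t ^ 2 + (t ^ 2)⁻¹ := by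
  rw [qNum, div_eq_iff ht.sub_inv_ne_zero, zpow_neg]
  have := ht.ne_zero
  simp only [zpow_ofNat]
  field_simp
  ring

@[simp] theorem qFact_zero (q : K) : qFact q 0 = 1 := by simp [qFact]

theorem qFact_succ (q : K) (m : ℕ) : qFact q (m + 1) = qFact q m * qNum q ((m : ℤ) + 1) := by
  rw [qFact, Finset.prod_Icc_succ_top (by omega)]
  simp [qFact]

theorem Generic.qFact_ne_zero (ht : Generic t) (m : ℕ) : qFact (t ^ 2) m ≠ 0 := by
  induction m with
  | zero => simp
  | succ m ih =>
    rw [qFact_succ]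
    exact mul_ne_zero ih (ht.qNum_ne_zero (by omega))

end QNumbers

/-! ### The q-oscillator algebra on one Fock space. -/

section Operators

variable {K : Type*} [Field K] {N : ℕ}

/-- Creation of a particle at the site `i`. -/
noncomputable def cr (i : Fin (N + 1)) : Module.End K (Fock K N) :=
  Finsupp.linearCombination K fun m => ket (m + site i 1)

/-- Annihilation of a particle at the site `i`. -/
noncomputable def an (t : K) (i : Fin (N + 1)) : Module.End K (Fock K N) :=
  Finsupp.linearCombination K fun m => qNum (t ^ 2) (m i) • ket (m - site i 1)

/-- The operator that is diagonal on kets. -/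
noncomputable def dg (φ : (Fin (N + 1) → ℕ) → K) : Module.End K (Fock K N) :=
  Finsupp.linearCombination K fun m => φ m • ket m

theorem linearCombination_ket (g : (Fin (N + 1) → ℕ) → Fock K N) (m : Fin (N + 1) → ℕ) :
    Finsupp.linearCombination K g (ket m) = g m := by
  simp [ket]

@[simp] theorem cr_ket (i : Fin (N + 1)) (m) : (cr i : Module.End K (Fock K N)) (ket m) =
    ket (m + site i 1) := linearCombination_ket _ _

@[simp] theorem an_ket (t : K) (i : Fin (N + 1)) (m) : an t i (ket m) =
    qNum (t ^ 2) (m i) • ket (m - site i 1) := linearCombination_ket _ _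

@[simp] theorem dg_ket (φ : (Fin (N + 1) → ℕ) → K) (m) : dg φ (ket m) = φ m • ket m :=
  linearCombination_ket _ _

theorem end_ext {f g : Module.End K (Fock K N)} (h : ∀ m, f (ket m) = g (ket m)) : f = g := by
  refine Finsupp.lhom_ext' fun m => LinearMap.ext_ring ?_
  exact h m

theorem site_same (i : Fin (N + 1)) (a : ℕ) : site i a i = a := by simp [site]

theorem site_ne {i j : Fin (N + 1)} (h : j ≠ i) (a : ℕ) : site i a j = 0 := by simp [site, h]

theorem eq_sub_site_add {m : Fin (N + 1) → ℕ} {i : Fin (N + 1)} (h : m i ≠ 0) :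
    m - site i 1 + site i 1 = m := by
  ext j
  by_cases hj : j = i
  · subst hj; simp [site_same]; omega
  · simp [site_ne hj]

theorem dg_mul (φ ψ : (Fin (N + 1) → ℕ) → K) : dg φ * dg ψ = dg (φ * ψ) :=
  end_ext fun m => by simp [smul_smul, mul_comm]

theorem dg_comm (φ ψ : (Fin (N + 1) → ℕ) → K) : dg φ * dg ψ = dg ψ * dg φ := by
  rw [dg_mul, dg_mul, mul_comm]

theorem cr_comm (i j : Fin (N + 1)) : (cr i * cr j : Module.End K (Fock K N)) = cr j * cr i :=
  end_ext fun m => by simp [add_right_comm]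

theorem an_cr_comm (t : K) {i j : Fin (N + 1)} (h : i ≠ j) : an t i * cr j = cr j * an t i :=
  end_ext fun m => by
    by_cases h0 : m i = 0
    · simp [h0, site_ne h]
    · have : m + site j 1 - site i 1 = m - site i 1 + site j 1 := by
        conv_lhs => rw [← eq_sub_site_add h0, add_right_comm]
        simp
      simp [site_ne h, this]

theorem an_comm (t : K) (i j : Fin (N + 1)) : an t i * an t j = an t j * an t i := by
  by_cases h : i = j
  · subst h; rfl
  refine end_ext fun m => ?_
  simp only [Module.End.mul_apply, an_ket, map_smul, smul_smul, Pi.sub_apply, site_ne h,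
    site_ne (Ne.symm h), tsub_zero]
  rw [mul_comm, tsub_right_comm]

theorem an_cr_same (t : K) (i : Fin (N + 1)) :
    an t i * cr i = dg fun m => qNum (t ^ 2) ((m i : ℤ) + 1) :=
  end_ext fun m => by simp [site_same]

theorem cr_an_same (t : K) (i : Fin (N + 1)) :
    cr i * an t i = dg fun m => qNum (t ^ 2) (m i) :=
  end_ext fun m => by
    by_cases h0 : m i = 0
    · simp [h0]
    · simp [eq_sub_site_add h0]

theorem dg_cr {φ : (Fin (N + 1) → ℕ) → K} {i : Fin (N + 1)} {c : K}
    (h : ∀ m, φ (m + site i 1) = c * φ m) : dg φ * cr i = c • (cr i * dg φ) :=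
  end_ext fun m => by simp [h, smul_smul]

/-- Apply `h` to m - e_i when site i is occupied; when it is empty, both sides vanish. -/
theorem dg_an {φ : (Fin (N + 1) → ℕ) → K} {i : Fin (N + 1)} {c t : K} (hc : c ≠ 0)
    (h : ∀ m, φ (m + site i 1) = c * φ m) : dg φ * an t i = c⁻¹ • (an t i * dg φ) :=
  end_ext fun m => by
    by_cases h0 : m i = 0
    · simp [h0]
    · have := h (m - site i 1)
      rw [eq_sub_site_add h0] at this
      simp only [Module.End.mul_apply, an_ket, map_smul, dg_ket, LinearMap.smul_apply, this,
        smul_smul]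
      congr 1
      field_simp

end Operators

/-! ### Relations of the generators on a single factor. -/

section Generators

variable {K : Type*} [Field K] {N : ℕ}

theorem castSucc_ne_succ (j : Fin N) : j.castSucc ≠ j.succ := (Fin.castSucc_lt_succ).ne

theorem eOp_zero (t x : K) : eOp N t x .zero = x • cr 0 :=
  end_ext fun m => by simp [eOp, linearCombination_ket]

theorem eOp_mid (t x : K) (j : Fin N) : eOp N t x (.mid j) = cr j.succ * an t j.castSucc :=
  end_ext fun m => by simp [eOp, linearCombination_ket]

theorem eOp_last (t x : K) : eOp N t x .last =
    (qNum (t ^ 2) 2 ^ 2)⁻¹ • (an t (Fin.last N) * an t (Fin.last N)) :=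
  end_ext fun m => by
    simp only [eOp, linearCombination_ket, LinearMap.smul_apply, Module.End.mul_apply, an_ket,
      map_smul, smul_smul, Pi.sub_apply, site_same]
    -- Truncated and integer m - 1 differ only at m = 0, where the coefficient [0] vanishes.
    by_cases h0 : m (Fin.last N) = 0
    · simp [h0]
    · have h1 : m - site (Fin.last N) 1 - site (Fin.last N) 1 = m - site (Fin.last N) 2 := by
        rw [tsub_tsub]; simp [site, ← Pi.single_add]
      rw [h1, Nat.cast_sub (by omega)]
      congr 1
      push_cast
      ring

theorem fOp_zero (im t x : K) : fOp N im t x .zero = (im * kappa (t ^ 2) * x⁻¹) • an t 0 :=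
  end_ext fun m => by
    simp only [fOp, linearCombination_ket, LinearMap.smul_apply, an_ket, smul_smul]
    congr 1
    ring

theorem fOp_mid (im t x : K) (j : Fin N) :
    fOp N im t x (.mid j) = cr j.castSucc * an t j.succ :=
  end_ext fun m => by
    rw [← an_cr_comm _ (castSucc_ne_succ j).symm]
    simp [fOp, linearCombination_ket, site_ne (castSucc_ne_succ j).symm]

theorem fOp_last (im t x : K) : fOp N im t x .last = cr (Fin.last N) * cr (Fin.last N) :=
  end_ext fun m => by
    simp [fOp, linearCombination_ket, add_assoc, site, ← Pi.single_add]

theorem kOp_eq (im t : K) (r : Vertex N) : kOp N im t r = dg (kEig N im t r) := rfl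

theorem kInvOp_eq (im t : K) (r : Vertex N) : kInvOp N im t r = dg fun m => (kEig N im t r m)⁻¹ :=
  rfl

/-- The weight of `f_r`. -/
def shift : Vertex N → Fin (N + 1) → ℤ
  | .zero => - Pi.single 0 1
  | .mid j => Pi.single j.castSucc 1 - Pi.single j.succ 1
  | .last => Pi.single (Fin.last N) 2

theorem kEig_ne_zero {im t : K} (him : im ^ 2 = -1) (ht : Generic t) (r : Vertex N) (m) :
    kEig N im t r m ≠ 0 := by
  have h0 := ht.ne_zero
  have hi : im ≠ 0 := by rintro rfl; simp at him
  cases r <;> simp only [kEig]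
  · exact mul_ne_zero (neg_ne_zero.2 hi) (zpow_ne_zero _ h0)
  · exact zpow_ne_zero _ ht.sq_ne_zero
  · exact neg_ne_zero.2 (zpow_ne_zero _ ht.sq_ne_zero)

/-- With this scalar for one particle, k_r can be moved past any product of `cr` and `an`; the
exponents add up to the pairing of the vectors `shift`. -/
theorem kEig_add_site {im t : K} (ht : Generic t) (r : Vertex N) (i : Fin (N + 1)) (m) :
    kEig N im t r (m + site i 1) = t ^ (-2 * shift r i) * kEig N im t r m := by
  have h0 := ht.ne_zero
  have key : ∀ a : ℤ, (t ^ 2) ^ a = t ^ (2 * a) := fun a => by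
    rw [zpow_mul]; norm_cast
  rcases r with _ | j | _ <;> simp only [kEig, key, shift, Pi.add_apply, site, Pi.single_apply, Pi.neg_apply,
    Pi.sub_apply, neg_mul, mul_neg, neg_inj]
  · rw [mul_left_comm, ← zpow_add₀ h0]
    congr 2
    split_ifs <;> simp_all
    ring
  · rw [← zpow_add₀ h0]
    congr 1
    have hj := castSucc_ne_succ j
    by_cases h1 : i = j.castSucc
    · subst h1
      simp only [if_pos, if_neg hj, if_neg hj.symm]; push_cast; ring
    · by_cases h2 : i = j.succ
      · subst h2
        simp only [if_pos, if_neg hj, if_neg hj.symm]; push_cast; ring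
      · simp only [if_neg h1, if_neg h2, if_neg (Ne.symm h1), if_neg (Ne.symm h2)]
        push_cast; ring
  · rw [← zpow_add₀ h0]
    congr 1
    split_ifs <;> simp_all
    ring

theorem kOp_mul_fOp {im t x : K} (ht : Generic t) (r s : Vertex N) :
    kOp N im t r * fOp N im t x s =
      t ^ (-2 * (shift r ⬝ᵥ shift s)) • (fOp N im t x s * kOp N im t r) := by
  have h0 := ht.ne_zero
  have hc := fun i => dg_cr (K := K) (fun m => kEig_add_site (im := im) ht r i m)
  have ha := fun i => dg_an (t := t) (zpow_ne_zero _ h0)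
    (fun m => kEig_add_site (im := im) ht r i m)
  rw [kOp_eq]
  cases s with
  | zero =>
    rw [fOp_zero, mul_smul_comm, ha, smul_mul_assoc, smul_comm, ← zpow_neg]
    simp [shift, dotProduct_neg]
  | mid j =>
    rw [fOp_mid, ← mul_assoc, hc, smul_mul_assoc, mul_assoc, ha, mul_smul_comm, smul_smul,
      ← zpow_neg, ← zpow_add₀ h0, mul_assoc]
    congr 2
    simp [shift, dotProduct_sub]; ring
  | last =>
    rw [fOp_last, ← mul_assoc, hc, smul_mul_assoc, mul_assoc, hc, mul_smul_comm, smul_smul,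
      ← zpow_add₀ h0, mul_assoc]
    congr 2
    simp [shift]; ring

theorem kOp_mul_eOp {im t x : K} (ht : Generic t) (r s : Vertex N) :
    kOp N im t r * eOp N t x s =
      t ^ (2 * (shift r ⬝ᵥ shift s)) • (eOp N t x s * kOp N im t r) := by
  have h0 := ht.ne_zero
  have hc := fun i => dg_cr (K := K) (fun m => kEig_add_site (im := im) ht r i m)
  have ha := fun i => dg_an (t := t) (zpow_ne_zero _ h0)
    (fun m => kEig_add_site (im := im) ht r i m)
  rw [kOp_eq]
  cases s with
  | zero =>
    rw [eOp_zero, mul_smul_comm, hc, smul_mul_assoc, smul_comm]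
    simp [shift, dotProduct_neg]
  | mid j =>
    rw [eOp_mid, ← mul_assoc, hc, smul_mul_assoc, mul_assoc, ha, mul_smul_comm, smul_smul,
      ← zpow_neg, ← zpow_add₀ h0, mul_assoc]
    congr 2
    simp [shift, dotProduct_sub]; ring
  | last =>
    rw [eOp_last, mul_smul_comm, ← mul_assoc, ha, smul_mul_assoc, mul_assoc, ha, mul_smul_comm,
      smul_smul, smul_smul, ← zpow_neg, smul_mul_assoc, smul_smul, mul_assoc (qNum _ _ ^ 2)⁻¹,
      ← zpow_add₀ h0, mul_comm (qNum _ _ ^ 2)⁻¹, mul_assoc]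
    congr 3
    simp [shift]; ring

theorem kOp_mul_kInvOp {im t : K} (him : im ^ 2 = -1) (ht : Generic t) (r : Vertex N) :
    kOp N im t r * kInvOp N im t r = 1 :=
  end_ext fun m => by
    rw [kOp_eq, kInvOp_eq]; simp [smul_smul, kEig_ne_zero him ht]

theorem kInvOp_mul_kOp {im t : K} (him : im ^ 2 = -1) (ht : Generic t) (r : Vertex N) :
    kInvOp N im t r * kOp N im t r = 1 :=
  end_ext fun m => by
    rw [kOp_eq, kInvOp_eq]; simp [smul_smul, kEig_ne_zero him ht]

/-- For r ≠ s no site is filled by one of the two operators and emptied by the other, so all their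
factors commute. -/
theorem eOp_mul_fOp_of_ne {im t x y : K} {r s : Vertex N} (h : r ≠ s) :
    eOp N t x r * fOp N im t y s = fOp N im t y s * eOp N t x r := by
  have hl : ∀ j : Fin N, Fin.last N ≠ j.castSucc := fun j => (Fin.castSucc_lt_last j).ne'
  have hz : ∀ j : Fin N, j.succ ≠ 0 := fun j => Fin.succ_ne_zero j
  cases r with
  | zero =>
    rw [eOp_zero]
    suffices Commute (cr 0) (fOp N im t y s) by
      simpa using (this.smul_left x).eq
    cases s with
    | zero => exact absurd rfl h
    | mid j =>
      rw [fOp_mid]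
      exact Commute.mul_right (cr_comm _ _) (an_cr_comm t (hz j)).symm
    | last =>
      rw [fOp_last]
      exact Commute.mul_right (cr_comm _ _) (cr_comm _ _)
  | mid i =>
    rw [eOp_mid]
    cases s with
    | zero =>
      rw [fOp_zero]
      refine (Commute.smul_right ?_ _).eq
      exact Commute.mul_left (an_cr_comm t (hz i).symm).symm (an_comm t _ _)
    | mid j =>
      rw [fOp_mid]
      have hij : i ≠ j := fun e => h (by rw [e])
      refine (Commute.mul_left (Commute.mul_right (cr_comm _ _) (an_cr_comm t ?_).symm)
        (Commute.mul_right (an_cr_comm t ?_) (an_comm t _ _))).eq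
      · exact fun e => hij (Fin.succ_injective _ e).symm
      · exact fun e => hij (Fin.castSucc_injective _ e)
    | last =>
      rw [fOp_last]
      have : Commute (an t i.castSucc) (cr (Fin.last N)) := an_cr_comm t (hl i).symm
      refine (Commute.mul_left (Commute.mul_right (cr_comm _ _) (cr_comm _ _))
        (Commute.mul_right this this)).eq
  | last =>
    rw [eOp_last]
    refine Commute.eq (Commute.smul_left ?_ _)
    cases s with
    | zero =>
      rw [fOp_zero]
      exact Commute.smul_right (Commute.mul_left (an_comm t _ _) (an_comm t _ _)) _
    | mid j =>
      rw [fOp_mid]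
      have : Commute (an t (Fin.last N)) (cr j.castSucc) := an_cr_comm t (hl j)
      exact Commute.mul_left (Commute.mul_right this (an_comm t _ _))
        (Commute.mul_right this (an_comm t _ _))
    | last => exact absurd rfl h

/-- The constants in `[e_r, f_r] = c_r (k_r - k_r⁻¹)`, `r ≠ 0`. -/
noncomputable def bracketCoeff (t : K) : Vertex N → K
  | .zero => 0
  | .mid _ => (t ^ 2 - (t ^ 2)⁻¹)⁻¹
  | .last => (qNum (t ^ 2) 2 * (t ^ 2 - (t ^ 2)⁻¹))⁻¹

theorem eOp_mul_fOp_self {im t x y : K} (ht : Generic t) {r : Vertex N} (h : r ≠ .zero) :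
    eOp N t x r * fOp N im t y r - fOp N im t y r * eOp N t x r =
      bracketCoeff t r • (kOp N im t r - kInvOp N im t r) := by
  have h0 := ht.ne_zero
  have h1 := ht.sub_inv_ne_zero
  have key : ∀ a : ℤ, (t ^ 2) ^ a ≠ 0 := fun a => zpow_ne_zero _ ht.sq_ne_zero
  refine end_ext fun m => ?_
  cases r with
  | zero => exact absurd rfl h
  | mid j =>
    -- After reordering, each product is diagonal: at one site `an * cr` is [m+1] and `cr * an` is
    -- [m]. What remains is an identity between q-numbers.
    have e1 : (cr j.succ * an t j.castSucc) * (cr j.castSucc * an t j.succ) =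
        dg (fun m => qNum (t ^ 2) ((m j.castSucc : ℤ) + 1)) *
          dg (fun m => qNum (t ^ 2) (m j.succ)) := by
      rw [← an_cr_same, ← cr_an_same]
      rw [mul_assoc, ← mul_assoc (an t _), ← mul_assoc (cr j.succ), ← mul_assoc,
        ← an_cr_comm _ (castSucc_ne_succ j), mul_assoc (an t j.castSucc), cr_comm]
      simp only [mul_assoc]
    have e2 : (cr j.castSucc * an t j.succ) * (cr j.succ * an t j.castSucc) =
        dg (fun m => qNum (t ^ 2) ((m j.succ : ℤ) + 1)) *
          dg (fun m => qNum (t ^ 2) (m j.castSucc)) := by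
      rw [← an_cr_same, ← cr_an_same]
      rw [mul_assoc, ← mul_assoc (an t _), ← mul_assoc (cr j.castSucc), ← mul_assoc,
        ← an_cr_comm _ (castSucc_ne_succ j).symm, mul_assoc (an t j.succ), cr_comm]
      simp only [mul_assoc]
    rw [eOp_mid, fOp_mid, e1, e2, kOp_eq, kInvOp_eq, dg_mul, dg_mul]
    simp only [LinearMap.sub_apply, dg_ket, LinearMap.smul_apply, ← sub_smul, smul_smul,
      Pi.mul_apply, kEig, bracketCoeff, qNum]
    congr 1
    have ha := key (m j.castSucc)
    have hb := key (m j.succ)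
    have hq := ht.sq_ne_zero
    have hq2 := ht.sq_sq_sub_one_ne_zero
    simp only [neg_add, zpow_add₀ ht.sq_ne_zero, zpow_neg, zpow_one, mul_inv, inv_inv]
    generalize (t ^ 2) ^ (m j.castSucc : ℤ) = P at *
    generalize (t ^ 2) ^ (m j.succ : ℤ) = Q at *
    generalize t ^ 2 = q at *
    field_simp
    ring
  | last =>
    have e1 : ∀ m : Fin (N + 1) → ℕ, (an t (Fin.last N) * an t (Fin.last N)) ((cr (Fin.last N) *
        cr (Fin.last N) : Module.End K (Fock K N)) (ket m)) = (qNum (t ^ 2) ((m (Fin.last N) : ℤ) + 1) *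
          qNum (t ^ 2) ((m (Fin.last N) : ℤ) + 2)) • (ket m : Fock K N) := by
      intro m
      have : (an t (Fin.last N) * an t (Fin.last N)) * (cr (Fin.last N) * cr (Fin.last N)) =
        an t (Fin.last N) * (an t (Fin.last N) * cr (Fin.last N)) * cr (Fin.last N) := by
        simp only [mul_assoc]
      rw [← Module.End.mul_apply, this, an_cr_same]
      simp [site_same, smul_smul, add_assoc, mul_comm]
    have e2 : ∀ m : Fin (N + 1) → ℕ, (cr (Fin.last N) * cr (Fin.last N) : Module.End K (Fock K N)) ((an t (Fin.last N) *
        an t (Fin.last N)) (ket m)) = (qNum (t ^ 2) ((m (Fin.last N) : ℤ)) *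
          qNum (t ^ 2) ((m (Fin.last N) : ℤ) - 1)) • (ket m : Fock K N) := by
      intro m
      have : (cr (Fin.last N) * cr (Fin.last N)) * (an t (Fin.last N) * an t (Fin.last N)) =
        cr (Fin.last N) * (cr (Fin.last N) * an t (Fin.last N)) * an t (Fin.last N) := by
        simp only [mul_assoc]
      rw [← Module.End.mul_apply, this, cr_an_same]
      by_cases hm : m (Fin.last N) = 0
      · simp [hm]
      · have h3 : ((m (Fin.last N) - 1 : ℕ) : ℤ) = (m (Fin.last N) : ℤ) - 1 := by omega
        simp [site_same, smul_smul, eq_sub_site_add hm, h3]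
    rw [eOp_last, fOp_last, kOp_eq, kInvOp_eq]
    rw [smul_mul_assoc, mul_smul_comm, LinearMap.sub_apply, LinearMap.smul_apply,
      LinearMap.smul_apply, Module.End.mul_apply, Module.End.mul_apply (cr _ * cr _), e1, e2]
    simp only [LinearMap.sub_apply, dg_ket, LinearMap.smul_apply, ← sub_smul, smul_smul,
      kEig, bracketCoeff]
    congr 1
    have ha := key (m (Fin.last N))
    have h2 := ht.qNum_ne_zero (m := 2) (by norm_num)
    have h2' : t ^ 2 + (t ^ 2)⁻¹ ≠ 0 := by rwa [← ht.qNum_two]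
    rw [ht.qNum_two]
    simp only [qNum]
    generalize hQ : (t ^ 2) ^ (m (Fin.last N) : ℤ) = Q at ha
    have hm2 : (t ^ 2) ^ (-2 * (m (Fin.last N) : ℤ)) = (Q ^ 2)⁻¹ := by
      rw [← hQ, mul_comm, zpow_mul, zpow_neg]; norm_cast
    simp only [neg_add, zpow_sub₀ ht.sq_ne_zero, zpow_add₀ ht.sq_ne_zero, hm2, zpow_neg, mul_inv,
      hQ, zpow_ofNat]
    generalize t ^ 2 = q at *
    have hq : q ≠ 0 := by rintro rfl; simp at h1
    have h1' : q ^ 2 - 1 ≠ 0 := fun h => h1 (by field_simp; linear_combination h)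
    have h2'' : q ^ 2 + 1 ≠ 0 := fun h => h2' (by field_simp; linear_combination h)
    field_simp
    ring

end Generators

end QOsc

namespace QOsc

/-! ### The coproduct action on V ⊗ V. -/

section Tensor

variable {K : Type*} [Field K] {N : ℕ}

/-- The additive group of `V ⊗ V`; instance search does not find it through the reducible
definition of the Fock space. -/
@[reducible] noncomputable def addCommGroupFock2 : AddCommGroup (Fock2 K N) :=
  { (inferInstance : AddCommMonoid (Fock2 K N)) with
    neg := Neg.neg
    sub := Sub.sub
    sub_eq_add_neg := fun _ _ => rfl
    neg_add_cancel := fun v => (TensorProduct.addCommGroup (R := K) (M := Fock K N)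
      (N := Fock K N)).neg_add_cancel v
    zsmul := (TensorProduct.addCommGroup (R := K) (M := Fock K N) (N := Fock K N)).zsmul
    zsmul_zero' :=
      (TensorProduct.addCommGroup (R := K) (M := Fock K N) (N := Fock K N)).zsmul_zero'
    zsmul_succ' :=
      (TensorProduct.addCommGroup (R := K) (M := Fock K N) (N := Fock K N)).zsmul_succ'
    zsmul_neg' :=
      (TensorProduct.addCommGroup (R := K) (M := Fock K N) (N := Fock K N)).zsmul_neg' }

attribute [local instance] addCommGroupFock2

/-- The basis vector `|a⟩ ⊗ |b⟩`. -/
noncomputable def ket2 (a b : Fin (N + 1) → ℕ) : Fock2 K N := ket a ⊗ₜ[K] ket b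

theorem eq_top_of_ket2_mem {S : Submodule K (Fock2 K N)} (h : ∀ a b, ket2 a b ∈ S) : S = ⊤ := by
  rw [eq_top_iff, ← TensorProduct.span_tmul_eq_top, Submodule.span_le]
  rintro _ ⟨u, v, rfl⟩
  induction u using Finsupp.induction_linear with
  | zero => simp
  | add u u' hu hu' => rw [TensorProduct.add_tmul]; exact S.add_mem hu hu'
  | single a c =>
    induction v using Finsupp.induction_linear with
    | zero => simp
    | add v v' hv hv' => rw [TensorProduct.tmul_add]; exact S.add_mem hv hv'
    | single b d =>
      have : (Finsupp.single a c : Fock K N) ⊗ₜ[K] (Finsupp.single b d : Fock K N) =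
          (c * d) • ket2 a b := by
        rw [ket2, ket, ket, mul_smul, ← TensorProduct.tmul_smul, TensorProduct.smul_tmul']
        simp
      rw [this]
      exact S.smul_mem _ (h a b)

theorem end2_ext {M : Type*} [AddCommMonoid M] [Module K M] {f g : Fock2 K N →ₗ[K] M}
    (h : ∀ a b, f (ket2 a b) = g (ket2 a b)) : f = g := by
  have : LinearMap.eqLocus f g = ⊤ := eq_top_of_ket2_mem h
  exact LinearMap.ext fun v => (this ▸ Submodule.mem_top : v ∈ LinearMap.eqLocus f g)

theorem map_ket2 (f g : Module.End K (Fock K N)) (a b) :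
    TensorProduct.map f g (ket2 a b) = f (ket a) ⊗ₜ[K] g (ket b) := rfl

theorem map_comm_of_commute {f f' g g' : Module.End K (Fock K N)} (h1 : f * f' = f' * f)
    (h2 : g * g' = g' * g) : TensorProduct.map f g * TensorProduct.map f' g' =
      TensorProduct.map f' g' * TensorProduct.map f g := by
  rw [← TensorProduct.map_mul, ← TensorProduct.map_mul, h1, h2]

section Relations

variable {im t : K}

theorem mul_kInvOp_of_kOp_mul (him : im ^ 2 = -1) (ht : Generic t) {r : Vertex N} {c : K}
    {f : Module.End K (Fock K N)} (h : kOp N im t r * f = c • (f * kOp N im t r)) :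
    f * kInvOp N im t r = c • (kInvOp N im t r * f) := by
  calc f * kInvOp N im t r
      = kInvOp N im t r * (kOp N im t r * f) * kInvOp N im t r := by
        rw [← mul_assoc, kInvOp_mul_kOp him ht, one_mul]
    _ = c • (kInvOp N im t r * f * (kOp N im t r * kInvOp N im t r)) := by
        rw [h]; simp [mul_assoc]
    _ = _ := by rw [kOp_mul_kInvOp him ht, mul_one]

/-- The scalar from moving k_r past f_s in the second factor cancels the one from moving k_s⁻¹ past
e_r in the first, because the pairing of weights is symmetric. -/
theorem map_eOp_kOp_comm_map_kInvOp_fOp (him : im ^ 2 = -1) (ht : Generic t) (x y : K)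
    (r s : Vertex N) :
    TensorProduct.map (eOp N t x r) (kOp N im t r) *
        TensorProduct.map (kInvOp N im t s) (fOp N im t y s) =
      TensorProduct.map (kInvOp N im t s) (fOp N im t y s) *
        TensorProduct.map (eOp N t x r) (kOp N im t r) := by
  rw [← TensorProduct.map_mul, ← TensorProduct.map_mul, kOp_mul_fOp ht,
    mul_kInvOp_of_kOp_mul him ht (kOp_mul_eOp ht s r), TensorProduct.map_smul_left,
    TensorProduct.map_smul_right, smul_smul, dotProduct_comm, ← zpow_add₀ ht.ne_zero]
  simp

theorem kOp_comm_kInvOp (r s : Vertex N) :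
    kOp N im t r * kInvOp N im t s = kInvOp N im t s * kOp N im t r := dg_comm _ _

/-- Creation at the site `i` of the second factor. -/
noncomputable def crR (i : Fin (N + 1)) : Module.End K (Fock2 K N) := TensorProduct.map 1 (cr i)

/-- Creation at the site `i` of the first factor, with the factor `q^{m_i}` on the second one. -/
noncomputable def crL (t : K) (i : Fin (N + 1)) : Module.End K (Fock2 K N) :=
  TensorProduct.map (cr i) (dg fun m => (t ^ 2) ^ m i)

theorem kOp_zero (ht : Generic t) :
    kOp N im t .zero = (-im * t) • dg fun m => (t ^ 2) ^ m 0 :=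
  end_ext fun m => by
    rw [kOp_eq, dg_ket, LinearMap.smul_apply, dg_ket, smul_smul, kEig, zpow_add₀ ht.ne_zero,
      zpow_mul, zpow_natCast, zpow_one]
    congr 1
    norm_cast
    ring

/-- The parameters x and y enter e_0 only as coefficients of two fixed operators; every statement
about e_0 below is one about `crR 0` and `crL t 0`. -/
theorem deltaE_zero (ht : Generic t) (x y : K) :
    deltaE N im t x y .zero = y • crR 0 + (x * (-im * t)) • crL t 0 := by
  rw [deltaE, eOp_zero, eOp_zero, kOp_zero ht, TensorProduct.map_smul_right,
    TensorProduct.map_smul_right, TensorProduct.map_smul_left, smul_smul, crR, crL, mul_comm x]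

/-- The parameters of e_r and f_s are independent, so that e_0 on V_x ⊗ V_y and on V_y ⊗ V_x can
both be moved past f_s taken with parameters 1, 1. -/
theorem deltaE_comm_deltaF (him : im ^ 2 = -1) (ht : Generic t) {x y x' y' : K} {r s : Vertex N}
    (h : r ≠ s) : deltaE N im t x y r * deltaF N im t x' y' s =
      deltaF N im t x' y' s * deltaE N im t x y r := by
  rw [deltaF, deltaE, mul_add, add_mul, add_mul, add_mul, mul_add, mul_add,
    map_eOp_kOp_comm_map_kInvOp_fOp him ht,
    map_comm_of_commute (f := 1) (f' := fOp N im t x' s) (by simp) (by simp),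
    map_comm_of_commute (f := 1) (f' := kInvOp N im t s) (by simp) (eOp_mul_fOp_of_ne h),
    map_comm_of_commute (f' := fOp N im t x' s) (g' := 1) (eOp_mul_fOp_of_ne h) (by simp)]

theorem deltaE_bracket_deltaF (him : im ^ 2 = -1) (ht : Generic t) {x y x' y' : K} {r : Vertex N}
    (h : r ≠ .zero) : deltaE N im t x y r * deltaF N im t x' y' r =
      deltaF N im t x' y' r * deltaE N im t x y r +
        bracketCoeff t r • (deltaK N im t r - deltaKInv N im t r) := by
  have e0 : ∀ x y, eOp N t x r * fOp N im t y r = fOp N im t y r * eOp N t x r +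
      bracketCoeff t r • (kOp N im t r + (-1 : K) • kInvOp N im t r) := fun x y => by
    have := eOp_mul_fOp_self (im := im) (x := x) (y := y) ht h
    refine LinearMap.ext fun v => ?_
    have := congrArg (fun f => f v) this
    simp only [LinearMap.sub_apply, LinearMap.smul_apply, LinearMap.add_apply] at this ⊢
    rw [sub_eq_iff_eq_add'] at this
    rw [this]
    module
  have e1 : TensorProduct.map 1 (eOp N t y r) *
      TensorProduct.map (kInvOp N im t r) (fOp N im t y' r) =
      TensorProduct.map (kInvOp N im t r) (fOp N im t y' r) *
        TensorProduct.map 1 (eOp N t y r) + bracketCoeff t r •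
        (TensorProduct.map (kInvOp N im t r) (kOp N im t r) +
          (-1 : K) • deltaKInv N im t r) := by
    rw [← TensorProduct.map_mul, ← TensorProduct.map_mul, one_mul, mul_one,
      e0, TensorProduct.map_add_right, TensorProduct.map_smul_right, deltaKInv,
      TensorProduct.map_add_right, TensorProduct.map_smul_right]
  have e2 : TensorProduct.map (eOp N t x r) (kOp N im t r) *
      TensorProduct.map (fOp N im t x' r) 1 =
      TensorProduct.map (fOp N im t x' r) 1 *
        TensorProduct.map (eOp N t x r) (kOp N im t r) + bracketCoeff t r •
        (deltaK N im t r + (-1 : K) • TensorProduct.map (kInvOp N im t r) (kOp N im t r)) := by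
    rw [← TensorProduct.map_mul, ← TensorProduct.map_mul, one_mul, mul_one,
      e0, TensorProduct.map_add_left, TensorProduct.map_smul_left, deltaK,
      TensorProduct.map_add_left, TensorProduct.map_smul_left]
  rw [deltaF, deltaE, mul_add, add_mul, add_mul, add_mul, mul_add, mul_add,
    map_eOp_kOp_comm_map_kInvOp_fOp him ht,
    map_comm_of_commute (f := 1) (f' := fOp N im t x' r) (by simp) (by simp), e1, e2]
  module

theorem deltaK_mul_deltaF (ht : Generic t) {x y : K} (r s : Vertex N) :
    deltaK N im t r * deltaF N im t x y s =
      t ^ (-2 * (shift r ⬝ᵥ shift s)) • (deltaF N im t x y s * deltaK N im t r) := by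
  rw [deltaK, deltaF, mul_add, add_mul, ← TensorProduct.map_mul, ← TensorProduct.map_mul,
    ← TensorProduct.map_mul, ← TensorProduct.map_mul, kOp_mul_fOp ht, kOp_mul_fOp ht,
    kOp_comm_kInvOp, TensorProduct.map_smul_left, TensorProduct.map_smul_right, mul_one, one_mul,
    smul_add]

theorem deltaKInv_mul_deltaK (him : im ^ 2 = -1) (ht : Generic t) (r : Vertex N) :
    deltaKInv N im t r * deltaK N im t r = 1 := by
  rw [deltaK, deltaKInv, ← TensorProduct.map_mul, kInvOp_mul_kOp him ht, TensorProduct.map_one]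

theorem deltaK_mul_deltaKInv (him : im ^ 2 = -1) (ht : Generic t) (r : Vertex N) :
    deltaK N im t r * deltaKInv N im t r = 1 := by
  rw [deltaK, deltaKInv, ← TensorProduct.map_mul, kOp_mul_kInvOp him ht, TensorProduct.map_one]

theorem deltaE_eq_one {r : Vertex N} (hr : r ≠ .zero) (x y : K) :
    deltaE N im t x y r = deltaE N im t 1 1 r := by
  cases r <;> first | exact absurd rfl hr | rfl

theorem deltaF_eq_one {r : Vertex N} (hr : r ≠ .zero) (x y : K) :
    deltaF N im t x y r = deltaF N im t 1 1 r := by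
  cases r <;> first | exact absurd rfl hr | rfl

end Relations

section KetFormulas

variable (im t : K)

theorem fOp_mid_ket (x : K) (j : Fin N) (m) : fOp N im t x (.mid j) (ket m) =
    qNum (t ^ 2) (m j.succ) • ket (m + site j.castSucc 1 - site j.succ 1) :=
  linearCombination_ket _ _

theorem fOp_last_ket (x : K) (m) : fOp N im t x .last (ket m) = ket (m + site (Fin.last N) 2) :=
  linearCombination_ket _ _

theorem eOp_mid_ket (x : K) (j : Fin N) (m) : eOp N t x (.mid j) (ket m) =
    qNum (t ^ 2) (m j.castSucc) • ket (m - site j.castSucc 1 + site j.succ 1) :=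
  linearCombination_ket _ _

theorem deltaF_mid_ket2 (j : Fin N) (a b) : deltaF N im t 1 1 (.mid j) (ket2 a b) =
    qNum (t ^ 2) (a j.succ) • ket2 (a + site j.castSucc 1 - site j.succ 1) b +
    ((t ^ 2) ^ ((a j.castSucc : ℤ) - a j.succ) * qNum (t ^ 2) (b j.succ)) •
      ket2 a (b + site j.castSucc 1 - site j.succ 1) := by
  simp only [deltaF, LinearMap.add_apply, map_ket2, fOp_mid_ket, Module.End.one_apply, kInvOp_eq,
    dg_ket, kEig, TensorProduct.tmul_smul, ← TensorProduct.smul_tmul', smul_smul]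
  simp only [ket2]
  rw [← zpow_neg, neg_add, neg_neg, ← sub_eq_add_neg, mul_comm]

theorem deltaF_last_ket2 (a b) : deltaF N im t 1 1 .last (ket2 a b) =
    ket2 (a + site (Fin.last N) 2) b -
      (t ^ 2) ^ (2 * (a (Fin.last N)) + 1) • ket2 a (b + site (Fin.last N) 2) := by
  simp only [deltaF, LinearMap.add_apply, map_ket2, fOp_last_ket, Module.End.one_apply, kInvOp_eq,
    dg_ket, kEig, ← TensorProduct.smul_tmul']
  simp only [ket2]
  have h : -(-2 * (a (Fin.last N) : ℤ) - 1) = ((2 * a (Fin.last N) + 1 : ℕ) : ℤ) := by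
    push_cast; ring
  rw [inv_neg, ← zpow_neg, neg_smul, ← sub_eq_add_neg, h, zpow_natCast]

theorem deltaE_mid_ket2 (j : Fin N) (a b) : deltaE N im t 1 1 (.mid j) (ket2 a b) =
    qNum (t ^ 2) (b j.castSucc) • ket2 a (b - site j.castSucc 1 + site j.succ 1) +
    (qNum (t ^ 2) (a j.castSucc) * (t ^ 2) ^ ((b j.succ : ℤ) - b j.castSucc)) •
      ket2 (a - site j.castSucc 1 + site j.succ 1) b := by
  simp only [deltaE, LinearMap.add_apply, map_ket2, eOp_mid_ket, Module.End.one_apply, kOp_eq,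
    dg_ket, kEig, TensorProduct.tmul_smul, ← TensorProduct.smul_tmul', smul_smul]
  simp only [ket2]
  rw [neg_add_eq_sub, mul_comm]

theorem deltaE_last_ket2 (a b) : deltaE N im t 1 1 .last (ket2 a b) =
    (qNum (t ^ 2) (b (Fin.last N)) * qNum (t ^ 2) ((b (Fin.last N) : ℤ) - 1)
        / qNum (t ^ 2) 2 ^ 2) • ket2 a (b - site (Fin.last N) 2) -
    (qNum (t ^ 2) (a (Fin.last N)) * qNum (t ^ 2) ((a (Fin.last N) : ℤ) - 1)
        / qNum (t ^ 2) 2 ^ 2 * (t ^ 2) ^ (-2 * (b (Fin.last N) : ℤ) - 1)) •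
      ket2 (a - site (Fin.last N) 2) b := by
  simp only [deltaE, LinearMap.add_apply, map_ket2, eOp, linearCombination_ket,
    Module.End.one_apply, kOp_eq, dg_ket, kEig, TensorProduct.tmul_smul,
    ← TensorProduct.smul_tmul', smul_smul]
  simp only [ket2]
  rw [neg_mul, neg_smul, sub_eq_add_neg, mul_comm (_ / _) (_ ^ _ : K)]
  rfl

@[simp] theorem crR_ket2 (i : Fin (N + 1)) (a b) :
    crR i (ket2 a b : Fock2 K N) = ket2 a (b + site i 1) := by
  rw [crR, map_ket2]; simp [ket2]

@[simp] theorem crL_ket2 (i : Fin (N + 1)) (a b) :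
    crL t i (ket2 a b : Fock2 K N) = (t ^ 2) ^ b i • ket2 (a + site i 1) b := by
  rw [crL, map_ket2]; simp [ket2, TensorProduct.tmul_smul]

theorem deltaK_ket2 (r : Vertex N) (a b) : deltaK N im t r (ket2 a b) =
    (kEig N im t r a * kEig N im t r b) • ket2 a b := by
  simp only [deltaK, map_ket2, kOp_eq, dg_ket, TensorProduct.smul_tmul_smul]
  rfl

end KetFormulas

/-- Stability under `f_r`, `1 ≤ r ≤ n`. -/
def FClosed (im t : K) (S : Submodule K (Fock2 K N)) : Prop :=
  ∀ r : Vertex N, r ≠ .zero → ∀ v ∈ S, deltaF N im t 1 1 r v ∈ S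

end Tensor

end QOsc

open Finset.HasAntidiagonal (antidiagonal)

namespace QOsc

/-! ### The coefficients of the singular vectors and a q-binomial theorem. -/

section Antidiagonal

/-- The summation pattern behind every use of Pascal's rule: an interior term receives one
contribution from each neighbour on the lower antidiagonal, an end term only one. -/
theorem sum_antidiagonal_succ_of_split {M : Type*} [AddCommMonoid M] {l : ℕ} {h p r : ℕ → ℕ → M}
    (h0 : h 0 (l + 1) = p 0 l) (h1 : h (l + 1) 0 = r l 0)
    (h2 : ∀ k j, k + j + 1 = l → h (k + 1) (j + 1) = p (k + 1) j + r k (j + 1)) :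
    ∑ x ∈ antidiagonal (l + 1), h x.1 x.2 =
      ∑ x ∈ antidiagonal l, p x.1 x.2 + ∑ x ∈ antidiagonal l, r x.1 x.2 := by
  cases l with
  | zero =>
    rw [Finset.Nat.sum_antidiagonal_succ]
    simpa using congrArg₂ (· + ·) h0 h1
  | succ l =>
    rw [Finset.Nat.sum_antidiagonal_succ, Finset.Nat.sum_antidiagonal_succ' (n := l),
      Finset.Nat.sum_antidiagonal_succ (n := l) (f := fun x => p x.1 x.2),
      Finset.Nat.sum_antidiagonal_succ' (n := l) (f := fun x => r x.1 x.2), h0, h1]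
    have : ∑ x ∈ antidiagonal l, h (x.1 + 1) (x.2 + 1) =
        ∑ x ∈ antidiagonal l, p (x.1 + 1) x.2 +
          ∑ x ∈ antidiagonal l, r x.1 (x.2 + 1) := by
      rw [← Finset.sum_add_distrib]
      refine Finset.sum_congr rfl fun x hx => h2 _ _ ?_
      rw [Finset.HasAntidiagonal.mem_antidiagonal.1 hx]
    simp only [this]
    abel

end Antidiagonal

section Coefficients

variable {K : Type*} [Field K] {t : K}

/-- The coefficient of `|k e_n⟩ ⊗ |j e_n⟩` in the singular vectors of degree `k + j`. -/
noncomputable def cf (t : K) (k j : ℕ) : K :=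
  t ^ ((k : ℤ) * ((k : ℤ) + 2 * j - 1)) * qBinom (t ^ 2) (k + j) k

theorem cf_eq (k j : ℕ) : cf t k j = t ^ ((k : ℤ) * ((k : ℤ) + 2 * j - 1)) *
    (qFact (t ^ 2) (k + j) / (qFact (t ^ 2) k * qFact (t ^ 2) j)) := by
  rw [cf, qBinom, Nat.add_sub_cancel_left]

theorem Generic.cf_zero_left (ht : Generic t) (j : ℕ) : cf t 0 j = 1 := by
  rw [cf_eq]; simp [ht.qFact_ne_zero]

theorem Generic.cf_zero_right (ht : Generic t) (k : ℕ) : cf t k 0 = t ^ (k * (k - 1)) := by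
  have : ((k : ℤ) * ((k : ℤ) + 2 * (0 : ℕ) - 1)) = ((k * (k - 1) : ℕ) : ℤ) := by
    cases k <;> simp
  rw [cf_eq, this, zpow_natCast]
  simp [ht.qFact_ne_zero]

theorem Generic.cf_succ_left (ht : Generic t) (k j : ℕ) :
    cf t (k + 1) j * qNum (t ^ 2) ((k : ℤ) + 1) =
      (t ^ 2) ^ (k + j) * qNum (t ^ 2) ((k : ℤ) + j + 1) * cf t k j := by
  have h1 := ht.qFact_ne_zero k
  have h2 := ht.qFact_ne_zero j
  have h3 := ht.qNum_ne_zero (m := (k : ℤ) + 1) (by omega)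
  have e1 : t ^ (((k + 1 : ℕ) : ℤ) * (((k + 1 : ℕ) : ℤ) + 2 * j - 1)) =
      (t ^ 2) ^ (k + j) * t ^ ((k : ℤ) * ((k : ℤ) + 2 * j - 1)) := by
    rw [← pow_mul, ← zpow_natCast t (2 * _), ← zpow_add₀ ht.ne_zero]
    congr 1; push_cast; ring
  rw [cf_eq, cf_eq, e1, add_right_comm k 1 j, qFact_succ, qFact_succ]
  push_cast
  field_simp

theorem Generic.cf_succ_right (ht : Generic t) (k j : ℕ) :
    cf t k (j + 1) * qNum (t ^ 2) ((j : ℤ) + 1) =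
      (t ^ 2) ^ k * qNum (t ^ 2) ((k : ℤ) + j + 1) * cf t k j := by
  have h1 := ht.qFact_ne_zero k
  have h2 := ht.qFact_ne_zero j
  have h3 := ht.qNum_ne_zero (m := (j : ℤ) + 1) (by omega)
  have e1 : t ^ ((k : ℤ) * ((k : ℤ) + 2 * (j + 1 : ℕ) - 1)) =
      (t ^ 2) ^ k * t ^ ((k : ℤ) * ((k : ℤ) + 2 * j - 1)) := by
    rw [← pow_mul, ← zpow_natCast t (2 * _), ← zpow_add₀ ht.ne_zero]
    congr 1; push_cast; ring
  rw [cf_eq, cf_eq, e1, ← add_assoc, qFact_succ, qFact_succ]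
  push_cast
  field_simp

theorem qNum_eq (t : K) (m : ℤ) : qNum (t ^ 2) m =
    ((t ^ 2) ^ m - ((t ^ 2) ^ m)⁻¹) / (t ^ 2 - (t ^ 2)⁻¹) := by
  rw [qNum, zpow_neg]

/-- Multiplied by [k+1][j+1], every term becomes a multiple of `cf t k j`, and `key` is what is
left. -/
theorem Generic.cf_pascal (ht : Generic t) (k j : ℕ) :
    cf t (k + 1) (j + 1) =
      cf t (k + 1) j + (t ^ 2) ^ (k + j + 1) * (t ^ 2) ^ (j + 1) * cf t k (j + 1) := by
  have hk := ht.qNum_ne_zero (m := (k : ℤ) + 1) (by omega)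
  have hj := ht.qNum_ne_zero (m := (j : ℤ) + 1) (by omega)
  have e1 := ht.cf_succ_left k j
  have e2 := ht.cf_succ_right k j
  have e3 := ht.cf_succ_right (k + 1) j
  have hq := ht.sq_ne_zero
  have hs := ht.sq_sq_sub_one_ne_zero
  refine mul_right_cancel₀ hj (mul_right_cancel₀ hk ?_)
  have l1 : cf t (k + 1) (j + 1) * qNum (t ^ 2) ((j : ℤ) + 1) * qNum (t ^ 2) ((k : ℤ) + 1) =
      (t ^ 2) ^ (k + 1) * qNum (t ^ 2) ((k : ℤ) + j + 2) * ((t ^ 2) ^ (k + j) *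
        qNum (t ^ 2) ((k : ℤ) + j + 1) * cf t k j) := by
    rw [e3, ← e1]; push_cast
    rw [show (k : ℤ) + 1 + j + 1 = k + j + 2 by ring]; ring
  have l2 : (cf t (k + 1) j + (t ^ 2) ^ (k + j + 1) * (t ^ 2) ^ (j + 1) * cf t k (j + 1)) *
      qNum (t ^ 2) ((j : ℤ) + 1) * qNum (t ^ 2) ((k : ℤ) + 1) =
      qNum (t ^ 2) ((j : ℤ) + 1) * ((t ^ 2) ^ (k + j) * qNum (t ^ 2) ((k : ℤ) + j + 1) *
        cf t k j) + qNum (t ^ 2) ((k : ℤ) + 1) * (t ^ 2) ^ (k + j + 1) * (t ^ 2) ^ (j + 1) *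
        ((t ^ 2) ^ k * qNum (t ^ 2) ((k : ℤ) + j + 1) * cf t k j) := by
    rw [← e1, ← e2]; ring
  rw [l1, l2]
  have key : (t ^ 2) ^ (k + 1) * qNum (t ^ 2) ((k : ℤ) + j + 2) =
      qNum (t ^ 2) ((j : ℤ) + 1) + qNum (t ^ 2) ((k : ℤ) + 1) * (t ^ 2) * (t ^ 2) ^ (j + 1) *
        (t ^ 2) ^ k := by
    simp only [qNum_eq, zpow_add₀ hq, zpow_natCast, zpow_ofNat]
    have hk' := pow_ne_zero k hq
    have hj' := pow_ne_zero j hq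
    simp only [pow_succ (t ^ 2) k, pow_succ (t ^ 2) j]
    generalize (t ^ 2) ^ k = A at *
    generalize (t ^ 2) ^ j = B at *
    generalize t ^ 2 = q at *
    field_simp
    ring
  linear_combination ((t ^ 2) ^ (k + j) * qNum (t ^ 2) ((k : ℤ) + j + 1) * cf t k j) * key

/-- The q-binomial theorem in base q². It is used at u = 1 and u = -1, which give the sum and the
difference of its even and odd parts. -/
theorem Generic.sum_cf (ht : Generic t) (u : K) (l : ℕ) :
    ∑ x ∈ antidiagonal l, u ^ x.1 * (cf t x.1 x.2 * t ^ (x.1 * (x.1 - 1))) =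
      ∏ j ∈ Finset.range l, (1 + u * (t ^ 2) ^ (2 * j)) := by
  induction l with
  | zero => simp [ht.cf_zero_left]
  | succ l ih =>
    have hpow : ∀ k : ℕ, t ^ ((k + 1) * (k + 1 - 1)) = (t ^ 2) ^ k * t ^ (k * (k - 1)) := by
      intro k
      rw [← pow_mul, ← pow_add]
      congr 1
      cases k
      · simp
      · simp; ring
    rw [Finset.prod_range_succ, ← ih, mul_add, mul_one, Finset.sum_mul]
    refine sum_antidiagonal_succ_of_split (l := l)
      (h := fun a b => u ^ a * (cf t a b * t ^ (a * (a - 1))))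
      (p := fun a b => u ^ a * (cf t a b * t ^ (a * (a - 1))))
      (r := fun a b => u ^ a * (cf t a b * t ^ (a * (a - 1))) * (u * (t ^ 2) ^ (2 * l))) ?_ ?_ ?_
    · simp [ht.cf_zero_left]
    · simp only [ht.cf_zero_right, hpow]
      ring
    · rintro k j rfl
      simp only [ht.cf_pascal, hpow]
      ring

/-- The factor j = 0 of the product is 1 - 1. This serves both the spanning argument and the
orthogonality of v_l^+ + v_l^- and v_l^+ - v_l^-. -/
theorem Generic.sum_cf_neg_one (ht : Generic t) (l : ℕ) :
    ∑ x ∈ antidiagonal (l + 1),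
      (-1) ^ x.1 * (cf t x.1 x.2 * t ^ (x.1 * (x.1 - 1))) = 0 := by
  rw [ht.sum_cf, Finset.prod_range_succ']
  simp

/-- The factor j = 0 is 2; another factor could vanish only if t were a root of unity. -/
theorem Generic.sum_cf_one_ne_zero [CharZero K] (ht : Generic t) (l : ℕ) :
    ∑ x ∈ antidiagonal l, (cf t x.1 x.2 * t ^ (x.1 * (x.1 - 1))) ≠ 0 := by
  have := ht.sum_cf 1 l
  simp only [one_pow, one_mul] at this
  rw [this, Finset.prod_ne_zero_iff]
  intro j _ h
  rcases Nat.eq_zero_or_pos j with rfl | hj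
  · norm_num at h
  · apply ht.pow_ne_one (8 * j) (by omega)
    have : t ^ (8 * j) = ((t ^ 2) ^ (2 * j)) ^ 2 := by
      rw [← pow_mul, ← pow_mul]; congr 1; ring
    rw [this, eq_neg_of_add_eq_zero_right h]
    ring

end Coefficients

/-! ### Recursions for the singular vectors. -/

section SingularVectors

variable {K : Type*} [Field K] {N : ℕ}

attribute [local instance] addCommGroupFock2

/-- `|k e_n⟩ ⊗ |j e_n⟩`. -/
noncomputable def lastKet (N : ℕ) (k j : ℕ) : Fock2 K N :=
  ket2 (site (Fin.last N) k) (site (Fin.last N) j)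

/-- The sum of `ε^k cf(k, j) g(k, j) |k e_n⟩ ⊗ |j e_n⟩` over `k + j = l`. -/
noncomputable def weightedSum (N : ℕ) (t ε : K) (l : ℕ) (g : ℕ → ℕ → K) : Fock2 K N :=
  ∑ x ∈ antidiagonal l, (ε ^ x.1 * cf t x.1 x.2 * g x.1 x.2) • lastKet N x.1 x.2

/-- `∑ ε^k q^{k(2l-k-1)/2} [l choose k] |k e_n⟩ ⊗ |(l-k) e_n⟩`; for `ε = ± 1` this is
`v^+_l ± v^-_l`. -/
noncomputable def signedSum (N : ℕ) (t ε : K) (l : ℕ) : Fock2 K N :=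
  ∑ x ∈ antidiagonal l, (ε ^ x.1 * cf t x.1 x.2) • lastKet N x.1 x.2

theorem weightedSum_one (t ε : K) (l : ℕ) :
    weightedSum N t ε l (fun _ _ => 1) = signedSum N t ε l := by
  simp [weightedSum, signedSum]

theorem paritySum_eq (t : K) (p l : ℕ) : paritySum N t p l =
    ∑ x ∈ antidiagonal l, (if x.1 % 2 = p then cf t x.1 x.2 else 0) •
      lastKet N x.1 x.2 := by
  rw [Finset.Nat.sum_antidiagonal_eq_sum_range_succ
    (f := fun a b => (if a % 2 = p then cf t a b else 0) • (lastKet N a b : Fock2 K N)),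
    paritySum, Finset.sum_filter]
  refine Finset.sum_congr rfl fun k hk => ?_
  have hk' : k ≤ l := by simpa [Nat.lt_succ_iff] using hk
  split_ifs
  · rw [cf, Nat.add_sub_cancel' hk']
    congr 3
    push_cast [Nat.cast_sub hk']
    ring
  · simp

theorem vPlus_add_vMinus (t : K) (l : ℕ) :
    vPlus N t (l + 1) + vMinus N t (l + 1) = signedSum N t 1 (l + 1) := by
  rw [vPlus, vMinus, if_neg (by omega), paritySum_eq, paritySum_eq, signedSum,
    ← Finset.sum_add_distrib]
  refine Finset.sum_congr rfl fun x _ => ?_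
  rcases Nat.mod_two_eq_zero_or_one x.1 with h | h <;> simp [h]

theorem vPlus_sub_vMinus (t : K) (l : ℕ) :
    vPlus N t (l + 1) - vMinus N t (l + 1) = signedSum N t (-1) (l + 1) := by
  rw [vPlus, vMinus, if_neg (by omega), paritySum_eq, paritySum_eq, signedSum,
    ← Finset.sum_sub_distrib]
  refine Finset.sum_congr rfl fun x _ => ?_
  rcases Nat.mod_two_eq_zero_or_one x.1 with h | h
  · simp [h, (Nat.even_iff.2 h).neg_one_pow]
  · simp [h, (Nat.odd_iff.2 h).neg_one_pow]

theorem signedSum_zero {t : K} (ht : Generic t) (ε : K) : signedSum N t ε 0 = ket2 0 0 := by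
  simp [signedSum, ht.cf_zero_left, lastKet, site]

theorem vPlus_zero (t ε : K) : vPlus N t 0 = signedSum N t ε 0 := by
  rw [vPlus, paritySum_eq, signedSum]
  simp

theorem site_add (i : Fin (N + 1)) (a b : ℕ) : site i a + site i b = site i (a + b) := by
  simp [site, ← Pi.single_add]

theorem site_sub (i : Fin (N + 1)) (a b : ℕ) : site i a - site i b = site i (a - b) := by
  ext j
  by_cases h : j = i
  · subst h; simp [site_same]
  · simp [site_ne h]

theorem site_zero (i : Fin (N + 1)) : site i 0 = 0 := by simp [site]

theorem crR_lastKet (k j : ℕ) : crR (Fin.last N) (lastKet N k j : Fock2 K N) =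
    lastKet N k (j + 1) := by
  rw [lastKet, crR_ket2, site_add, lastKet]

theorem crL_lastKet (t : K) (k j : ℕ) : crL t (Fin.last N) (lastKet N k j : Fock2 K N) =
    (t ^ 2) ^ j • lastKet N (k + 1) j := by
  rw [lastKet, crL_ket2, site_add, site_same, lastKet]

theorem deltaF_last_lastKet (im t : K) (k j : ℕ) :
    deltaF N im t 1 1 .last (lastKet N k j) =
      lastKet N (k + 2) j - (t ^ 2) ^ (2 * k + 1) • lastKet N k (j + 2) := by
  rw [lastKet, deltaF_last_ket2, site_add, site_add, site_same, lastKet, lastKet]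

/-- Pascal's rule in operator form. For n = 1 it already places q^l B v_l + ε A v_l in the module of
v_{l+1}. -/
theorem signedSum_succ {t : K} (ht : Generic t) (ε : K) (l : ℕ) : signedSum N t ε (l + 1) =
    crR (Fin.last N) (signedSum N t ε l) +
      (ε * (t ^ 2) ^ l) • crL t (Fin.last N) (signedSum N t ε l) := by
  simp only [signedSum, map_sum, map_smul, Finset.smul_sum, crR_lastKet, crL_lastKet, smul_smul]
  refine sum_antidiagonal_succ_of_split (l := l)
      (h := fun a b => (ε ^ a * cf t a b) • (lastKet N a b : Fock2 K N))
      (p := fun a b => (ε ^ a * cf t a b) • (lastKet N a (b + 1) : Fock2 K N))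
      (r := fun a b => (ε * (t ^ 2) ^ l * (ε ^ a * cf t a b * (t ^ 2) ^ b)) •
        (lastKet N (a + 1) b : Fock2 K N)) ?_ ?_ ?_
  · simp [ht.cf_zero_left]
  · congr 1
    have := ht.cf_succ_left l 0
    rw [ht.cf_zero_right, ht.cf_zero_right, ← pow_mul]
    cases l
    · simp
    · simp; ring
  · rintro k j rfl
    simp only [ht.cf_pascal, ← add_smul]
    congr 1
    ring

/-- By induction with `signedSum_succ`: f_n commutes with both creation operators at the last site,
while these q-commute with each other. For n = 1 this is the part of e_0 v_{l+1} that lies in the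
module of v_l. -/
theorem deltaF_last_signedSum {t : K} (ht : Generic t) (im ε : K) (hε : ε ^ 2 = 1) (l : ℕ) :
    crL t (Fin.last N) (signedSum N t ε (l + 1)) -
      (ε * (t ^ 2) ^ (l + 1)) • crR (Fin.last N) (signedSum N t ε (l + 1)) =
    (ε * (t ^ 2) ^ l) • deltaF N im t 1 1 .last (signedSum N t ε l) := by
  have hAB : ∀ v : Fock2 K N, crL t (Fin.last N) (crR (Fin.last N) v) =
      (t ^ 2) • crR (Fin.last N) (crL t (Fin.last N) v) := by
    intro v
    rw [← Module.End.mul_apply, ← Module.End.mul_apply, ← LinearMap.smul_apply]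
    congr 1
    refine end2_ext fun a b => ?_
    simp only [Module.End.mul_apply, crR_ket2, crL_ket2, LinearMap.smul_apply, map_smul, smul_smul,
      Pi.add_apply, site_same, pow_succ]
    rw [mul_comm]
  have hFA : ∀ v : Fock2 K N, deltaF N im t 1 1 .last (crR (Fin.last N) v) =
      crR (Fin.last N) (deltaF N im t 1 1 .last v) := by
    intro v
    rw [← Module.End.mul_apply, ← Module.End.mul_apply]
    congr 1
    refine end2_ext fun a b => ?_
    simp only [Module.End.mul_apply, crR_ket2, map_smul, deltaF_last_ket2, map_sub,
      add_right_comm]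
  have hFB : ∀ v : Fock2 K N, deltaF N im t 1 1 .last (crL t (Fin.last N) v) =
      crL t (Fin.last N) (deltaF N im t 1 1 .last v) := by
    intro v
    rw [← Module.End.mul_apply, ← Module.End.mul_apply]
    congr 1
    refine end2_ext fun a b => ?_
    simp only [Module.End.mul_apply, crL_ket2, map_smul, deltaF_last_ket2, map_sub, smul_sub,
      Pi.add_apply, site_same, add_right_comm a, smul_smul]
    congr 2
    ring
  induction l with
  | zero =>
    rw [signedSum_succ ht, signedSum_zero ht, deltaF_last_ket2]
    simp only [map_add, map_smul, crR_ket2, crL_ket2, Pi.zero_apply, pow_zero, one_smul,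
      mul_one, zero_add, pow_one, site_add, site_same, mul_zero, smul_smul, smul_add]
    match_scalars
    all_goals first | ring1 | linear_combination -(t ^ 2) * hε
  | succ l ih =>
    have e1 := congrArg (fun v => (t ^ 2) • crR (Fin.last N) v) ih
    have e2 := congrArg (fun v => (ε * (t ^ 2) ^ (l + 1)) • crL t (Fin.last N) v) ih
    have e3 := congrArg (fun v => (ε * (t ^ 2) ^ (l + 1)) • deltaF N im t 1 1 .last v)
      (signedSum_succ (N := N) ht ε l)
    simp only [map_sub, map_add, map_smul, hFA, hFB, hAB] at e1 e2 e3
    rw [signedSum_succ ht ε (l + 1)]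
    simp only [map_add, map_smul, hAB]
    have e4 : (ε * (t ^ 2) ^ (l + 1)) • deltaF N im t 1 1 .last (signedSum N t ε (l + 1)) =
        (t ^ 2) • (ε * (t ^ 2) ^ l) • crR (Fin.last N)
          (deltaF N im t 1 1 .last (signedSum N t ε l)) +
        (ε * (t ^ 2) ^ (l + 1)) • (ε * (t ^ 2) ^ l) • crL t (Fin.last N)
          (deltaF N im t 1 1 .last (signedSum N t ε l)) := by
      rw [e3]; module
    rw [e4, ← e1, ← e2]
    match_scalars
    · ring
    · ring
    · ring

end SingularVectors

end QOsc

namespace QOsc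

/-! ### The action of f_n and e_n on the singular vectors. -/

section WeightedSums

variable {K : Type*} [Field K] {N : ℕ}

attribute [local instance] addCommGroupFock2

theorem weightedSum_congr {t ε : K} {l : ℕ} {g g' : ℕ → ℕ → K}
    (h : ∀ k j, k + j = l → g k j = g' k j) : weightedSum N t ε l g = weightedSum N t ε l g' :=
  Finset.sum_congr rfl fun x hx => by
    rw [h _ _ (Finset.HasAntidiagonal.mem_antidiagonal.1 hx)]

theorem smul_weightedSum (c t ε : K) (l : ℕ) (g : ℕ → ℕ → K) :
    c • weightedSum N t ε l g = weightedSum N t ε l fun k j => c * g k j := by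
  rw [weightedSum, weightedSum, Finset.smul_sum]
  refine Finset.sum_congr rfl fun x _ => ?_
  rw [smul_smul]
  congr 1
  ring

theorem weightedSum_sub (t ε : K) (l : ℕ) (g g' : ℕ → ℕ → K) :
    weightedSum N t ε l g - weightedSum N t ε l g' =
      weightedSum N t ε l fun k j => g k j - g' k j := by
  rw [weightedSum, weightedSum, weightedSum, ← Finset.sum_sub_distrib]
  refine Finset.sum_congr rfl fun x _ => ?_
  rw [← sub_smul]
  congr 1
  ring

/-- The weight that describes the action of `f_n` on the singular vectors. -/
noncomputable def raiseWeight (t : K) (k j : ℕ) : K :=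
  (t ^ 2) ^ (1 - (k : ℤ)) * qNum (t ^ 2) k - (t ^ 2) ^ ((j : ℤ) - 1) * qNum (t ^ 2) j

/-- Up to a scalar, f_n v_l has the terms of v_{l+2} multiplied by `raiseWeight`; so vectors of the
same degree can be compared term by term. -/
theorem deltaF_last_signedSum_eq_weightedSum {t : K} (ht : Generic t) (im : K) {ε : K}
    (hε : ε ^ 2 = 1) (l : ℕ) : (qNum (t ^ 2) ((l : ℤ) + 2) * (t ^ 2) ^ l) • deltaF N im t 1 1 .last (signedSum N t ε l) =
      weightedSum N t ε (l + 2) (raiseWeight t) := by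
  have h1 := congrArg (fun v => (qNum (t ^ 2) ((l : ℤ) + 2) * ε) • v)
    (deltaF_last_signedSum (N := N) ht im ε hε l)
  have h2 : (qNum (t ^ 2) ((l : ℤ) + 2) * (t ^ 2) ^ l) •
      deltaF N im t 1 1 .last (signedSum N t ε l) = (qNum (t ^ 2) ((l : ℤ) + 2) * ε) •
        (ε * (t ^ 2) ^ l) • deltaF N im t 1 1 .last (signedSum N t ε l) := by
    rw [smul_smul]
    congr 1
    linear_combination -qNum (t ^ 2) ((l : ℤ) + 2) * (t ^ 2) ^ l * hε
  have h3 : weightedSum N t ε (l + 2) (raiseWeight t) =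
      ∑ x ∈ antidiagonal (l + 1), (-(qNum (t ^ 2) ((l : ℤ) + 2) * (t ^ 2) ^ (l + 1) *
          (ε ^ x.1 * cf t x.1 x.2))) • lastKet N x.1 (x.2 + 1) +
        ∑ x ∈ antidiagonal (l + 1), (qNum (t ^ 2) ((l : ℤ) + 2) * ε *
          (ε ^ x.1 * cf t x.1 x.2) * (t ^ 2) ^ x.2) • lastKet N (x.1 + 1) x.2 := by
    have hL : ∀ k : ℕ, ∀ j : ℕ, k + j = l + 1 → cf t (k + 1) j * ((t ^ 2) ^ (1 - ((k + 1 : ℕ) : ℤ))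
        * qNum (t ^ 2) ((k + 1 : ℕ) : ℤ)) =
        qNum (t ^ 2) ((l : ℤ) + 2) * cf t k j * (t ^ 2) ^ j := by
      intro k j hkj
      have e1 := ht.cf_succ_left k j
      have e2 : (t ^ 2) ^ (1 - ((k + 1 : ℕ) : ℤ)) * (t ^ 2) ^ (k + j) = (t ^ 2) ^ j := by
        rw [← zpow_natCast (t ^ 2) (k + j), ← zpow_natCast (t ^ 2) j, ← zpow_add₀ ht.sq_ne_zero]
        congr 1; push_cast; ring
      have e3 : (k : ℤ) + j + 1 = l + 2 := by omega
      rw [e3] at e1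
      push_cast at e2 ⊢
      linear_combination (t ^ 2) ^ (1 - ((k : ℤ) + 1)) * e1 +
        qNum (t ^ 2) ((l : ℤ) + 2) * cf t k j * e2
    have hR : ∀ k : ℕ, ∀ j : ℕ, k + j = l + 1 → cf t k (j + 1) * ((t ^ 2) ^ (((j + 1 : ℕ) : ℤ) - 1)
        * qNum (t ^ 2) ((j + 1 : ℕ) : ℤ)) =
        qNum (t ^ 2) ((l : ℤ) + 2) * cf t k j * (t ^ 2) ^ (l + 1) := by
      intro k j hkj
      have e1 := ht.cf_succ_right k j
      have e2 : (t ^ 2) ^ (((j + 1 : ℕ) : ℤ) - 1) * (t ^ 2) ^ k = (t ^ 2) ^ (l + 1) := by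
        rw [← zpow_natCast (t ^ 2) k, ← zpow_natCast (t ^ 2) (l + 1), ← zpow_add₀ ht.sq_ne_zero]
        congr 1; push_cast; omega
      have e3 : (k : ℤ) + j + 1 = l + 2 := by omega
      rw [e3] at e1
      push_cast at e2 ⊢
      linear_combination (t ^ 2) ^ ((j : ℤ) + 1 - 1) * e1 +
        qNum (t ^ 2) ((l : ℤ) + 2) * cf t k j * e2
    refine sum_antidiagonal_succ_of_split (l := l + 1)
      (h := fun a b => (ε ^ a * cf t a b * raiseWeight t a b) • (lastKet N a b : Fock2 K N))
      (p := fun a b => (-(qNum (t ^ 2) ((l : ℤ) + 2) * (t ^ 2) ^ (l + 1) *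
          (ε ^ a * cf t a b))) • (lastKet N a (b + 1) : Fock2 K N))
      (r := fun a b => (qNum (t ^ 2) ((l : ℤ) + 2) * ε *
          (ε ^ a * cf t a b) * (t ^ 2) ^ b) • (lastKet N (a + 1) b : Fock2 K N)) ?_ ?_ ?_
    · congr 1
      rw [raiseWeight]
      simp only [Nat.cast_zero, qNum_zero, mul_zero, zero_sub]
      linear_combination -(ε ^ 0) * hR 0 (l + 1) (by omega)
    · congr 1
      rw [raiseWeight]
      simp only [Nat.cast_zero, qNum_zero, mul_zero, sub_zero]
      linear_combination (ε ^ (l + 2)) * hL (l + 1) 0 (by omega)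
    · rintro k j hkj
      rw [← add_smul]
      congr 1
      rw [raiseWeight]
      linear_combination (ε ^ (k + 1)) * hL k (j + 1) (by omega) -
        (ε ^ (k + 1)) * hR (k + 1) j (by omega)
  rw [h2, ← h1, h3, smul_sub, sub_eq_neg_add, smul_smul, ← neg_smul]
  simp only [signedSum, map_sum, map_smul, Finset.smul_sum, crR_lastKet, crL_lastKet, smul_smul]
  congr 1
  all_goals
    refine Finset.sum_congr rfl fun x _ => ?_
    congr 1
  · linear_combination -(qNum (t ^ 2) ((l : ℤ) + 2) * (t ^ 2) ^ (l + 1) *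
      (ε ^ x.1 * cf t x.1 x.2)) * hε
  · ring

/-- The ket |k⟩ ⊗ |j⟩ is reached from (k, j + 2) and from (k + 2, j). Both coefficients are
multiples of `cf t k j`, and the two contributions cancel because ε² = 1. -/
theorem deltaE_last_signedSum {t : K} (ht : Generic t) (im : K) {ε : K} (hε : ε ^ 2 = 1) (l : ℕ) :
    deltaE N im t 1 1 .last (signedSum N t ε l) = 0 := by
  have hformula : ∀ k j, deltaE N im t 1 1 .last (lastKet N k j) =
      (qNum (t ^ 2) j * qNum (t ^ 2) ((j : ℤ) - 1) / qNum (t ^ 2) 2 ^ 2) • lastKet N k (j - 2) -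
      (qNum (t ^ 2) k * qNum (t ^ 2) ((k : ℤ) - 1)
        / qNum (t ^ 2) 2 ^ 2 * (t ^ 2) ^ (-2 * (j : ℤ) - 1)) • lastKet N (k - 2) j := by
    intro k j
    rw [lastKet, deltaE_last_ket2, site_same, site_same, site_sub, site_sub, lastKet, lastKet]
  simp only [signedSum, map_sum, map_smul, hformula, smul_sub, Finset.sum_sub_distrib, smul_smul]
  rw [sub_eq_zero]
  rcases l with _ | _ | l
  · simp
  · simp [Finset.Nat.sum_antidiagonal_succ]
  -- Two end terms are split off from each sum; they carry [0] or [1][0] and vanish. The remaining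
  -- sums are matched by (k, j + 2) ↔ (k + 2, j).
  · rw [Finset.Nat.sum_antidiagonal_succ', Finset.Nat.sum_antidiagonal_succ',
      Finset.Nat.sum_antidiagonal_succ (n := l + 1), Finset.Nat.sum_antidiagonal_succ]
    simp only [Nat.cast_zero, qNum_zero, zero_mul, zero_div, mul_zero, zero_smul, zero_add,
      Nat.cast_one, sub_self]
    refine Finset.sum_congr rfl fun x _ => ?_
    obtain ⟨k, j⟩ := x
    have h1 := ht.cf_succ_right k j
    have h2 := ht.cf_succ_right k (j + 1)
    have h3 := ht.cf_succ_left k j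
    have h4 := ht.cf_succ_left (k + 1) j
    have hA : cf t k (j + 2) * (qNum (t ^ 2) ((j : ℤ) + 2) * qNum (t ^ 2) ((j : ℤ) + 1)) =
        (t ^ 2) ^ (2 * k) * (qNum (t ^ 2) ((k : ℤ) + j + 2) *
          qNum (t ^ 2) ((k : ℤ) + j + 1)) * cf t k j := by
      push_cast at h2
      rw [add_assoc (j : ℤ) 1 1, show (k : ℤ) + (j + 1) + 1 = k + j + 2 by ring,
        one_add_one_eq_two] at h2
      rw [← mul_assoc, h2, two_mul, pow_add]
      linear_combination (t ^ 2) ^ k * qNum (t ^ 2) ((k : ℤ) + j + 2) * h1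
    have hB : cf t (k + 2) j * (qNum (t ^ 2) ((k : ℤ) + 2) * qNum (t ^ 2) ((k : ℤ) + 1)) =
        (t ^ 2) ^ (2 * k + 2 * j + 1) * (qNum (t ^ 2) ((k : ℤ) + j + 2) *
          qNum (t ^ 2) ((k : ℤ) + j + 1)) * cf t k j := by
      push_cast at h4
      rw [add_assoc (k : ℤ) 1 1, show (k : ℤ) + 1 + j + 1 = k + j + 2 by ring,
        one_add_one_eq_two] at h4
      rw [← mul_assoc, h4, show 2 * k + 2 * j + 1 = (k + 1 + j) + (k + j) by ring, pow_add]
      linear_combination (t ^ 2) ^ (k + 1 + j) * qNum (t ^ 2) ((k : ℤ) + j + 2) * h3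
    have hC : (t ^ 2) ^ (2 * k + 2 * j + 1) * (t ^ 2) ^ (-2 * (j : ℤ) - 1) = (t ^ 2) ^ (2 * k) := by
      rw [← zpow_natCast (t ^ 2) (2 * k + 2 * j + 1), ← zpow_natCast (t ^ 2) (2 * k),
        ← zpow_add₀ ht.sq_ne_zero]
      congr 1; push_cast; ring
    congr 1
    push_cast
    rw [show (j : ℤ) + 1 + 1 = j + 2 by ring, show (k : ℤ) + 1 + 1 = k + 2 by ring,
      show (j : ℤ) + 2 - 1 = j + 1 by ring, show (k : ℤ) + 2 - 1 = k + 1 by ring]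
    have h5 := ht.qNum_ne_zero (m := 2) (by norm_num)
    field_simp
    linear_combination ε ^ k * hA - ε ^ (k + 2) * (t ^ 2) ^ (-2 * (j : ℤ) - 1) * hB -
      ε ^ (k + 2) * (qNum (t ^ 2) ((k : ℤ) + j + 2) * qNum (t ^ 2) ((k : ℤ) + j + 1)) *
        cf t k j * hC - ε ^ k * (t ^ 2) ^ (2 * k) * (qNum (t ^ 2) ((k : ℤ) + j + 2) *
          qNum (t ^ 2) ((k : ℤ) + j + 1)) * cf t k j * hε

end WeightedSums

/-! ### Computations on the last two sites. -/

section TopSites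

variable {K : Type*} [Field K] {M N : ℕ}

attribute [local instance] addCommGroupFock2

/-- The occupation numbers `a` at the site `n - 1` and `b` at the site `n`, for `n = M + 2`. -/
def topPair (M a b : ℕ) : Fin (M + 2) → ℕ :=
  site (Fin.last M).castSucc a + site (Fin.last (M + 1)) b

/-- The product of two basis vectors that live on the sites `n - 1` and `n`. -/
noncomputable def topKet (M a b c d : ℕ) : Fock2 K (M + 1) := ket2 (topPair M a b) (topPair M c d)

theorem castSucc_last_ne : (Fin.last M).castSucc ≠ Fin.last (M + 1) :=
  (Fin.castSucc_lt_last _).ne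

@[simp] theorem topPair_castSucc (a b : ℕ) : topPair M a b (Fin.last M).castSucc = a := by
  simp [topPair, site_same, site_ne castSucc_last_ne]

@[simp] theorem topPair_last (a b : ℕ) : topPair M a b (Fin.last (M + 1)) = b := by
  simp [topPair, site_same, site_ne castSucc_last_ne.symm]

theorem topPair_of_lt {i : Fin (M + 2)} (hi : i < (Fin.last M).castSucc) (a b : ℕ) :
    topPair M a b i = 0 := by
  simp [topPair, site_ne hi.ne, site_ne (hi.trans (Fin.castSucc_lt_last _)).ne]

theorem eq_topPair {m : Fin (M + 2) → ℕ} {a b : ℕ} (ha : m (Fin.last M).castSucc = a)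
    (hb : m (Fin.last (M + 1)) = b) (h : ∀ i < (Fin.last M).castSucc, m i = 0) :
    m = topPair M a b := by
  ext i
  rcases lt_trichotomy i (Fin.last M).castSucc with hi | rfl | hi
  · rw [topPair_of_lt hi, h i hi]
  · simpa using ha
  · have : i = Fin.last (M + 1) := by
      rw [Fin.lt_def] at hi
      ext
      simp at hi ⊢
      omega
    subst this
    simpa using hb

theorem topPair_add (a b c d : ℕ) : topPair M a b + topPair M c d = topPair M (a + c) (b + d) :=
  eq_topPair (by simp) (by simp) fun i hi => by simp [topPair_of_lt hi]

theorem topPair_sub (a b c d : ℕ) : topPair M a b - topPair M c d = topPair M (a - c) (b - d) :=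
  eq_topPair (by simp) (by simp) fun i hi => by simp [topPair_of_lt hi]

theorem site_castSucc_last (a : ℕ) : site (Fin.last M).castSucc a = topPair M a 0 := by
  simp [topPair, site_zero]

theorem site_last_succ (a : ℕ) : site (Fin.last (M + 1)) a = topPair M 0 a := by
  simp [topPair, site_zero]

theorem lastKet_eq_topKet (k j : ℕ) : (lastKet (M + 1) k j : Fock2 K (M + 1)) =
    topKet M 0 k 0 j := by
  rw [lastKet, site_last_succ, site_last_succ, topKet]

theorem deltaF_mid_topKet (im t : K) (a b c d : ℕ) :
    deltaF (M + 1) im t 1 1 (.mid (Fin.last M)) (topKet M a b c d) =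
      qNum (t ^ 2) b • topKet M (a + 1) (b - 1) c d +
      ((t ^ 2) ^ ((a : ℤ) - b) * qNum (t ^ 2) d) • topKet M a b (c + 1) (d - 1) := by
  simp only [topKet, deltaF_mid_ket2, Fin.succ_last, topPair_castSucc, topPair_last,
    site_castSucc_last, site_last_succ, topPair_add, topPair_sub, Nat.succ_eq_add_one, add_zero,
    Nat.sub_zero]

theorem deltaF_last_topKet (im t : K) (a b c d : ℕ) :
    deltaF (M + 1) im t 1 1 .last (topKet M a b c d) =
      topKet M a (b + 2) c d - (t ^ 2) ^ (2 * b + 1) • topKet M a b c (d + 2) := by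
  simp only [topKet, deltaF_last_ket2, topPair_last, site_last_succ, topPair_add, add_zero]

theorem deltaE_mid_topKet (im t : K) (a b c d : ℕ) :
    deltaE (M + 1) im t 1 1 (.mid (Fin.last M)) (topKet M a b c d) =
      qNum (t ^ 2) c • topKet M a b (c - 1) (d + 1) +
      (qNum (t ^ 2) a * (t ^ 2) ^ ((d : ℤ) - c)) • topKet M (a - 1) (b + 1) c d := by
  simp only [topKet, deltaE_mid_ket2, Fin.succ_last, topPair_castSucc, topPair_last,
    site_castSucc_last, site_last_succ, topPair_add, topPair_sub, Nat.succ_eq_add_one, add_zero,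
    Nat.sub_zero]

theorem crR_topKet (a b c d : ℕ) : crR (Fin.last M).castSucc (topKet M a b c d : Fock2 K _) =
    topKet M a b (c + 1) d := by
  simp [topKet, site_castSucc_last, topPair_add]

theorem crL_topKet (t : K) (a b c d : ℕ) :
    crL t (Fin.last M).castSucc (topKet M a b c d : Fock2 K _) =
      (t ^ 2) ^ c • topKet M (a + 1) b c d := by
  simp [topKet, site_castSucc_last, topPair_add]

/-- f_{n-1} moves one particle from site n to site n - 1 in either factor; by the ratios of the `cf`
the result is again a weighted sum, with the weight shifted in the matching argument. -/
theorem deltaF_mid_weightedSum {t : K} (ht : Generic t) (im ε : K) (l : ℕ) (g : ℕ → ℕ → K) :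
    deltaF (M + 1) im t 1 1 (.mid (Fin.last M)) (weightedSum (M + 1) t ε (l + 1) g) =
      qNum (t ^ 2) ((l : ℤ) + 1) • (crR (Fin.last M).castSucc
          (weightedSum (M + 1) t ε l fun k j => g k (j + 1)) +
        (ε * (t ^ 2) ^ l) • crL t (Fin.last M).castSucc
          (weightedSum (M + 1) t ε l fun k j => g (k + 1) j)) := by
  simp only [weightedSum, map_sum, map_smul, lastKet_eq_topKet, deltaF_mid_topKet, smul_add,
    Finset.sum_add_distrib, smul_smul, crR_topKet, crL_topKet, Finset.smul_sum]
  rw [Finset.Nat.sum_antidiagonal_succ, Finset.Nat.sum_antidiagonal_succ' (n := l)]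
  simp only [Nat.cast_zero, qNum_zero, mul_zero, zero_smul, zero_add, Nat.add_sub_cancel]
  refine (add_comm _ _).trans ?_
  congr 1
  all_goals
    refine Finset.sum_congr rfl fun x hx => ?_
    obtain ⟨k, j⟩ := x
    have hl := Finset.HasAntidiagonal.mem_antidiagonal.1 hx
    simp only at hl
    subst hl
    congr 1
    push_cast
  · have h1 := ht.cf_succ_right k j
    have h2 : (t ^ 2) ^ (0 - (k : ℤ)) * (t ^ 2) ^ k = 1 := by
      rw [zero_sub, ← zpow_natCast (t ^ 2) k, ← zpow_add₀ ht.sq_ne_zero]; simp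
    linear_combination ε ^ k * g k (j + 1) * (t ^ 2) ^ (0 - (k : ℤ)) * h1 +
      ε ^ k * g k (j + 1) * qNum (t ^ 2) ((k : ℤ) + j + 1) * cf t k j * h2
  · have h1 := ht.cf_succ_left k j
    linear_combination ε ^ (k + 1) * g (k + 1) j * h1

theorem deltaF_mid_signedSum {t : K} (ht : Generic t) (im ε : K) (l : ℕ) :
    deltaF (M + 1) im t 1 1 (.mid (Fin.last M)) (signedSum (M + 1) t ε (l + 1)) =
      qNum (t ^ 2) ((l : ℤ) + 1) • (crR (Fin.last M).castSucc (signedSum (M + 1) t ε l) +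
        (ε * (t ^ 2) ^ l) • crL t (Fin.last M).castSucc (signedSum (M + 1) t ε l)) := by
  simp only [← weightedSum_one, deltaF_mid_weightedSum ht]

theorem deltaF_last_comm_crR (im t : K) {i : Fin (N + 1)} (v : Fock2 K N) :
    deltaF N im t 1 1 .last (crR i v) = crR i (deltaF N im t 1 1 .last v) := by
  rw [← Module.End.mul_apply, ← Module.End.mul_apply]
  congr 1
  refine end2_ext fun a b => ?_
  simp only [Module.End.mul_apply, crR_ket2, map_smul, deltaF_last_ket2, map_sub,
    add_right_comm]

theorem deltaF_last_comm_crL (im t : K) {i : Fin (N + 1)} (hi : i ≠ Fin.last N)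
    (v : Fock2 K N) :
    deltaF N im t 1 1 .last (crL t i v) = crL t i (deltaF N im t 1 1 .last v) := by
  rw [← Module.End.mul_apply, ← Module.End.mul_apply]
  congr 1
  refine end2_ext fun a b => ?_
  simp only [Module.End.mul_apply, crL_ket2, map_smul, deltaF_last_ket2, map_sub, smul_sub,
    Pi.add_apply, site_ne hi, site_ne hi.symm, add_zero, add_right_comm a, smul_smul]
  congr 2
  ring

/-- The point is that the right side depends on m alone. The same two coefficients work in
`raiseWeight_succ_left`, so one linear combination makes both weighted sums proportional to the
singular vector. -/
theorem raiseWeight_succ_right {t : K} (ht : Generic t) {k j m : ℕ} (h : k + j = m + 2) :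
    ((t ^ 2) ^ (m + 1) + ((t ^ 2) ^ (m + 1))⁻¹) * raiseWeight t k (j + 1) -
      t ^ 2 * ((t ^ 2) ^ (m + 2) + ((t ^ 2) ^ (m + 2))⁻¹) * raiseWeight t k j =
      - qNum (t ^ 2) 2 * (t ^ 2) ^ (m + 2) := by
  have hq := ht.sq_ne_zero
  have hs := ht.sq_sq_sub_one_ne_zero
  have hk' := pow_ne_zero k hq
  have hj' := pow_ne_zero j hq
  have hm : (t ^ 2) ^ (m + 2) = (t ^ 2) ^ k * (t ^ 2) ^ j := by rw [← h, pow_add]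
  have hm1 : (t ^ 2) ^ (m + 1) = (t ^ 2) ^ k * (t ^ 2) ^ j * (t ^ 2)⁻¹ := by
    rw [← hm, pow_succ (t ^ 2) (m + 1), mul_inv_cancel_right₀ hq]
  rw [hm, hm1, ht.qNum_two]
  simp only [raiseWeight, qNum_eq, zpow_sub₀ hq, zpow_natCast, Nat.cast_add, Nat.cast_one,
    zpow_add₀ hq, zpow_one]
  generalize (t ^ 2) ^ k = A at *
  generalize (t ^ 2) ^ j = B at *
  generalize t ^ 2 = q at *
  field_simp
  ring

theorem raiseWeight_succ_left {t : K} (ht : Generic t) {k j m : ℕ} (h : k + j = m + 2) :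
    ((t ^ 2) ^ (m + 1) + ((t ^ 2) ^ (m + 1))⁻¹) * ((t ^ 2) ^ 2 * raiseWeight t (k + 1) j) -
      t ^ 2 * ((t ^ 2) ^ (m + 2) + ((t ^ 2) ^ (m + 2))⁻¹) * raiseWeight t k j =
      qNum (t ^ 2) 2 * ((t ^ 2) ^ m)⁻¹ := by
  have hq := ht.sq_ne_zero
  have hs := ht.sq_sq_sub_one_ne_zero
  have hk' := pow_ne_zero k hq
  have hj' := pow_ne_zero j hq
  have hm : (t ^ 2) ^ (m + 2) = (t ^ 2) ^ k * (t ^ 2) ^ j := by rw [← h, pow_add]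
  have hm1 : (t ^ 2) ^ (m + 1) = (t ^ 2) ^ k * (t ^ 2) ^ j * (t ^ 2)⁻¹ := by
    rw [← hm, pow_succ (t ^ 2) (m + 1), mul_inv_cancel_right₀ hq]
  have hm0 : (t ^ 2) ^ m = (t ^ 2) ^ k * (t ^ 2) ^ j * (t ^ 2)⁻¹ * (t ^ 2)⁻¹ := by
    rw [← hm1, pow_succ (t ^ 2) m, mul_inv_cancel_right₀ hq]
  rw [hm, hm1, hm0, ht.qNum_two]
  simp only [raiseWeight, qNum_eq, zpow_sub₀ hq, zpow_natCast, Nat.cast_add, Nat.cast_one,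
    zpow_add₀ hq, zpow_one]
  generalize (t ^ 2) ^ k = A at *
  generalize (t ^ 2) ^ j = B at *
  generalize t ^ 2 = q at *
  field_simp
  ring

/-- The part of `e_0 v_l` in the component of `v_{l-1}`, at the site `n - 1`. -/
theorem crL_sub_crR_signedSum_mem {im t ε : K} (ht : Generic t) (hε : ε ^ 2 = 1)
    {S : Submodule K (Fock2 K (M + 1))} (hS : FClosed im t S) (m : ℕ)
    (hv : signedSum (M + 1) t ε (m + 1) ∈ S) :
    crL t (Fin.last M).castSucc (signedSum (M + 1) t ε (m + 2)) -
      (ε * (t ^ 2) ^ (m + 2)) • crR (Fin.last M).castSucc (signedSum (M + 1) t ε (m + 2)) ∈ S := by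
  have hq := ht.sq_ne_zero
  -- The vector f_{n-1} f_n v_{m+1}, without its nonzero scalar.
  have h1 : crR (Fin.last M).castSucc
        (weightedSum (M + 1) t ε (m + 2) fun k j => raiseWeight t k (j + 1)) +
      (ε * (t ^ 2) ^ (m + 2)) • crL t (Fin.last M).castSucc
        (weightedSum (M + 1) t ε (m + 2) fun k j => raiseWeight t (k + 1) j) ∈ S := by
    have := hS (.mid (Fin.last M)) (by simp) _ (S.smul_mem
      (qNum (t ^ 2) (((m + 1 : ℕ) : ℤ) + 2) * (t ^ 2) ^ (m + 1)) (hS .last (by simp) _ hv))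
    rw [deltaF_last_signedSum_eq_weightedSum ht im hε, deltaF_mid_weightedSum ht,
      Submodule.smul_mem_iff _ (ht.qNum_ne_zero (by omega))] at this
    exact this
  -- The vector f_n f_{n-1} v_{m+1}, up to a scalar: the same weight, but the weights of the sum are
  -- not shifted.
  have h2 : crR (Fin.last M).castSucc (weightedSum (M + 1) t ε (m + 2) (raiseWeight t)) +
      (ε * (t ^ 2) ^ m) • crL t (Fin.last M).castSucc
        (weightedSum (M + 1) t ε (m + 2) (raiseWeight t)) ∈ S := by
    have := hS .last (by simp) _ (hS (.mid (Fin.last M)) (by simp) _ hv)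
    rw [deltaF_mid_signedSum ht, map_smul, Submodule.smul_mem_iff _ (ht.qNum_ne_zero (by omega)),
      map_add, map_smul, deltaF_last_comm_crR, deltaF_last_comm_crL _ _ castSucc_last_ne] at this
    have := S.smul_mem (qNum (t ^ 2) ((m : ℤ) + 2) * (t ^ 2) ^ m) this
    rw [smul_add, smul_comm _ (ε * _), ← map_smul (crR _), ← map_smul (crL _ _),
      deltaF_last_signedSum_eq_weightedSum ht im hε] at this
    exact this
  -- The coefficients are those for which the two `raiseWeight` identities remove the dependence on
  -- k and j.
  have h3 := S.smul_mem ε (S.sub_mem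
    (S.smul_mem ((t ^ 2) ^ (m + 1) + ((t ^ 2) ^ (m + 1))⁻¹) h1)
    (S.smul_mem (t ^ 2 * ((t ^ 2) ^ (m + 2) + ((t ^ 2) ^ (m + 2))⁻¹)) h2))
  rw [← Submodule.smul_mem_iff _ (ht.qNum_ne_zero (m := 2) (by norm_num))]
  convert h3 using 1
  have e1 : ((t ^ 2) ^ (m + 1) + ((t ^ 2) ^ (m + 1))⁻¹) •
        weightedSum (M + 1) t ε (m + 2) (fun k j => raiseWeight t k (j + 1)) -
      (t ^ 2 * ((t ^ 2) ^ (m + 2) + ((t ^ 2) ^ (m + 2))⁻¹)) •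
        weightedSum (M + 1) t ε (m + 2) (raiseWeight t) =
      (- qNum (t ^ 2) 2 * (t ^ 2) ^ (m + 2)) • signedSum (M + 1) t ε (m + 2) := by
    rw [← weightedSum_one, smul_weightedSum, smul_weightedSum, smul_weightedSum, weightedSum_sub]
    refine weightedSum_congr fun k j h => ?_
    rw [raiseWeight_succ_right ht h, mul_one]
  have e2 : ((t ^ 2) ^ (m + 1) + ((t ^ 2) ^ (m + 1))⁻¹) • (t ^ 2) ^ 2 •
        weightedSum (M + 1) t ε (m + 2) (fun k j => raiseWeight t (k + 1) j) -
      (t ^ 2 * ((t ^ 2) ^ (m + 2) + ((t ^ 2) ^ (m + 2))⁻¹)) •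
        weightedSum (M + 1) t ε (m + 2) (raiseWeight t) =
      (qNum (t ^ 2) 2 * ((t ^ 2) ^ m)⁻¹) • signedSum (M + 1) t ε (m + 2) := by
    rw [← weightedSum_one, smul_weightedSum, smul_weightedSum, smul_weightedSum, smul_weightedSum,
      weightedSum_sub]
    refine weightedSum_congr fun k j h => ?_
    rw [raiseWeight_succ_left ht h, mul_one]
  have e1' := congrArg (crR (Fin.last M).castSucc) e1
  have e2' := congrArg (fun v => (ε * (t ^ 2) ^ m) • crL t (Fin.last M).castSucc v) e2
  simp only [map_sub, map_smul] at e1' e2'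
  have e3 : (ε * (t ^ 2) ^ m) • (qNum (t ^ 2) 2 * ((t ^ 2) ^ m)⁻¹) •
      crL t (Fin.last M).castSucc (signedSum (M + 1) t ε (m + 2)) =
      (ε * qNum (t ^ 2) 2) • crL t (Fin.last M).castSucc (signedSum (M + 1) t ε (m + 2)) := by
    rw [smul_smul]
    congr 1
    have := pow_ne_zero m hq
    field_simp
  rw [e3] at e2'
  have e4 : qNum (t ^ 2) 2 • (crL t (Fin.last M).castSucc (signedSum (M + 1) t ε (m + 2)) -
      (ε * (t ^ 2) ^ (m + 2)) • crR (Fin.last M).castSucc (signedSum (M + 1) t ε (m + 2))) =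
      ε • ((- qNum (t ^ 2) 2 * (t ^ 2) ^ (m + 2)) •
        crR (Fin.last M).castSucc (signedSum (M + 1) t ε (m + 2)) + (ε * qNum (t ^ 2) 2) •
          crL t (Fin.last M).castSucc (signedSum (M + 1) t ε (m + 2))) := by
    match_scalars
    · linear_combination -qNum (t ^ 2) 2 * hε
    · ring
  rw [e4, ← e1', ← e2']
  module

/-- In the lowest degree the vector meets both V_0^+ and V_0^-; this is how v_0^- enters the image
of e_0. -/
theorem crL_sub_crR_signedSum_one {t ε : K} (ht : Generic t) (im : K) (hε : ε ^ 2 = 1) :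
    crL t (Fin.last M).castSucc (signedSum (M + 1) t ε 1) -
      (ε * t ^ 2) • crR (Fin.last M).castSucc (signedSum (M + 1) t ε 1) =
    vMinusZero t (M + 1) + (ε * (qNum (t ^ 2) 2)⁻¹) • deltaF (M + 1) im t 1 1 (.mid (Fin.last M))
      (deltaF (M + 1) im t 1 1 .last (topKet M 0 0 0 0)) := by
  have h1 : signedSum (M + 1) t ε 1 = topKet M 0 0 0 1 + ε • topKet M 0 1 0 0 := by
    simp [signedSum, Finset.Nat.sum_antidiagonal_succ, ht.cf_zero_left, ht.cf_zero_right,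
      lastKet_eq_topKet]
  have h2 : vMinusZero t (M + 1) = topKet M 1 0 0 1 - t ^ 2 • topKet M 0 1 1 0 := by
    rw [vMinusZero, site_castSucc_last, site_last_succ]
    rfl
  have h3 := ht.qNum_ne_zero (m := 2) (by norm_num)
  simp only [h1, h2, map_add, map_sub, map_smul, crR_topKet, crL_topKet, deltaF_last_topKet,
    deltaF_mid_topKet]
  simp only [Nat.cast_zero, qNum_zero, mul_zero, zero_smul, zero_add, pow_zero, one_smul,
    Nat.cast_ofNat, pow_one, sub_zero, zpow_zero, one_mul, add_zero]
  match_scalars <;> field_simp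
  all_goals first | ring1 | linear_combination -(t ^ 2) * hε

end TopSites

end QOsc

namespace QOsc

/-! ### The singular vectors generate V ⊗ V under the f_r. -/

section Generation

variable {K : Type*} [Field K] {N M : ℕ}

attribute [local instance] addCommGroupFock2

/-- A grading that is strictly increased by `f_r`, `1 ≤ r ≤ n`. -/
def height (a : Fin (N + 1) → ℕ) : ℕ := ∑ i, (N + 1 - i) * a i

theorem height_add (a b : Fin (N + 1) → ℕ) : height (a + b) = height a + height b := by
  simp [height, mul_add, Finset.sum_add_distrib]

theorem height_site (i : Fin (N + 1)) (c : ℕ) : height (site i c) = (N + 1 - i) * c := by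
  rw [height, Finset.sum_eq_single i]
  · rw [site_same]
  · intro j _ hj; rw [site_ne hj, mul_zero]
  · simp

theorem height_site_last (c : ℕ) : height (site (Fin.last N) c) = c := by
  simp [height_site]

theorem height_site_castSucc (j : Fin N) : height (site j.castSucc 1) =
    height (site j.succ 1) + 1 := by
  simp [height_site]; omega

theorem height_topPair (a b : ℕ) : height (topPair M a b) = 2 * a + b := by
  rw [topPair, height_add, height_site_last, height_site]
  simp only [Fin.val_castSucc, Fin.val_last]
  congr 2
  omega

theorem height_zero : height (0 : Fin (N + 1) → ℕ) = 0 := by simp [height]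

variable {im t : K} {S : Submodule K (Fock2 K N)} {H : ℕ}

theorem eq_site_last {a : Fin (N + 1) → ℕ} (h : ∀ j : Fin N, a j.castSucc = 0) :
    a = site (Fin.last N) (a (Fin.last N)) := by
  ext i
  refine Fin.lastCases ?_ (fun j => ?_) i
  · rw [site_same]
  · rw [site_ne (Fin.castSucc_lt_last j).ne, h]

/-- Apply f_r to a ket of smaller total height: modulo S, this trades a ket for one whose first
factor is lower. The descent on the height of the first factor stops at 0 and e_n; f_n removes
particles there in pairs. -/
theorem ket2_mem_of_base (ht : Generic t) (hS : FClosed im t S)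
    (hH : ∀ a b : Fin (N + 1) → ℕ, height a + height b < H → ket2 a b ∈ S)
    (h0 : ∀ b : Fin (N + 1) → ℕ, height b = H → ket2 0 b ∈ S)
    (h1 : ∀ b : Fin (N + 1) → ℕ, 1 + height b = H → ket2 (site (Fin.last N) 1) b ∈ S)
    (a b : Fin (N + 1) → ℕ) (hab : height a + height b = H) : ket2 a b ∈ S := by
  induction hm : height a using Nat.strong_induction_on generalizing a b with
  | _ m ih =>
    subst hm
    by_cases hj : ∃ j : Fin N, a j.castSucc ≠ 0
    · obtain ⟨j, hj⟩ := hj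
      obtain ⟨a', rfl⟩ : ∃ a', a = a' + site j.castSucc 1 := ⟨_, (eq_sub_site_add hj).symm⟩
      have hh := height_site_castSucc j
      have e1 := hS (.mid j) (by simp) _ (hH (a' + site j.succ 1) b (by
        simp only [height_add] at hab ⊢; omega))
      rw [deltaF_mid_ket2, add_right_comm, add_tsub_cancel_right] at e1
      have e2 : ((t ^ 2) ^ (((a' + site j.succ 1) j.castSucc : ℤ) - (a' + site j.succ 1) j.succ) *
          qNum (t ^ 2) (b j.succ)) •
          ket2 (a' + site j.succ 1) (b + site j.castSucc 1 - site j.succ 1) ∈ S := by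
        by_cases hb : b j.succ = 0
        · simp [hb]
        · obtain ⟨b', rfl⟩ : ∃ b', b = b' + site j.succ 1 := ⟨_, (eq_sub_site_add hb).symm⟩
          refine S.smul_mem _ ?_
          rw [add_right_comm b', add_tsub_cancel_right]
          simp only [height_add] at hab
          refine ih (height (a' + site j.succ 1)) ?_ _ _ ?_ rfl
          · simp only [height_add]; omega
          · simp only [height_add]; omega
      have e3 := (Submodule.add_mem_iff_left _ e2).1 e1
      refine (Submodule.smul_mem_iff _ (ht.qNum_ne_zero ?_)).1 e3
      simp [site_same]; omega
    · push Not at hj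
      obtain ⟨k, rfl⟩ : ∃ k, a = site (Fin.last N) k := ⟨_, eq_site_last hj⟩
      rw [height_site_last] at hab
      rcases k with _ | _ | k
      · rw [site_zero]; exact h0 b (by omega)
      · exact h1 b (by omega)
      · have e1 := hS .last (by simp) _ (hH (site (Fin.last N) k) b (by
          rw [height_site_last]; omega))
        rw [deltaF_last_ket2, site_add] at e1
        refine (Submodule.sub_mem_iff_left _ (S.smul_mem _ ?_)).1 e1
        refine ih k ?_ _ _ ?_ (height_site_last k)
        · rw [height_site_last]; omega
        · rw [height_add, height_site_last, height_site_last]; omega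

/-- With site j + 1 of the first factor empty, f acts on the second factor only, so its image is a
single ket. -/
theorem ket2_zero_mem_of_castSucc_ne_zero (ht : Generic t) (hS : FClosed im t S)
    (hH : ∀ a b : Fin (N + 1) → ℕ, height a + height b < H → ket2 a b ∈ S)
    {a b : Fin (N + 1) → ℕ} (hb : height a + height b = H) {j : Fin N} (hj : b j.castSucc ≠ 0)
    (ha : a j.succ = 0) : ket2 a b ∈ S := by
  obtain ⟨b', rfl⟩ : ∃ b', b = b' + site j.castSucc 1 := ⟨_, (eq_sub_site_add hj).symm⟩
  have hh := height_site_castSucc j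
  have e1 := hS (.mid j) (by simp) _ (hH a (b' + site j.succ 1) (by
    simp only [height_add] at hb ⊢; omega))
  rw [deltaF_mid_ket2, add_right_comm b', add_tsub_cancel_right, ha] at e1
  simp only [Nat.cast_zero, qNum_zero, zero_smul, zero_add] at e1
  refine (Submodule.smul_mem_iff _ (mul_ne_zero (zpow_ne_zero _ ht.sq_ne_zero)
    (ht.qNum_ne_zero ?_))).1 e1
  simp [site_same]; omega

/-- Modulo S, f_n exchanges |k+2⟩ ⊗ |j⟩ with q^{2k+1} |k⟩ ⊗ |j+2⟩; only the parity of k survives. -/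
theorem lastKet_sub_mem (hS : FClosed im t S) {l : ℕ}
    (hH : ∀ a b : Fin (N + 1) → ℕ, height a + height b < l → ket2 a b ∈ S) (k j : ℕ)
    (h : k + j = l) :
    lastKet N k j - t ^ (k * (k - 1)) • lastKet N (k % 2) (l - k % 2) ∈ S := by
  induction k using Nat.twoStepInduction generalizing j with
  | zero => subst h; simp
  | one => subst h; simp
  | more k ih _ =>
    have e1 := hS .last (by simp) (lastKet N k j) (hH _ _ (by
      rw [height_site_last, height_site_last]; omega))
    rw [deltaF_last_lastKet] at e1
    have e2 := S.add_mem e1 (S.smul_mem ((t ^ 2) ^ (2 * k + 1)) (ih (j + 2) (by omega)))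
    convert e2 using 1
    have : t ^ ((k + 2) * (k + 2 - 1)) = (t ^ 2) ^ (2 * k + 1) * t ^ (k * (k - 1)) := by
      rw [← pow_mul, ← pow_add]
      congr 1
      cases k
      · simp
      · simp; ring
    rw [this, Nat.add_mod_right]
    module

/-- Reduced by parity, the vector of sign ε becomes G 0 |0⟩ ⊗ |l+1⟩ + ε G 1 |1⟩ ⊗ |l⟩. The
q-binomial theorem at -1 and 1 gives G 0 = G 1 ≠ 0, so both kets can be solved for. -/
theorem lastKet_mem [CharZero K] (ht : Generic t) (hS : FClosed im t S) {l : ℕ}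
    (hH : ∀ a b : Fin (N + 1) → ℕ, height a + height b < l + 1 → ket2 a b ∈ S)
    (h1 : signedSum N t 1 (l + 1) ∈ S) (h2 : signedSum N t (-1) (l + 1) ∈ S) :
    lastKet N 0 (l + 1) ∈ S ∧ lastKet N 1 l ∈ S := by
  have key : ∀ ε : K, signedSum N t ε (l + 1) - ∑ x ∈ antidiagonal (l + 1),
      (ε ^ x.1 * (cf t x.1 x.2 * t ^ (x.1 * (x.1 - 1)))) •
        lastKet N (x.1 % 2) (l + 1 - x.1 % 2) ∈ S := by
    intro ε
    rw [signedSum, ← Finset.sum_sub_distrib]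
    refine S.sum_mem fun x hx => ?_
    have := S.smul_mem (ε ^ x.1 * cf t x.1 x.2)
      (lastKet_sub_mem hS hH x.1 x.2 (Finset.HasAntidiagonal.mem_antidiagonal.1 hx))
    rwa [smul_sub, smul_smul, mul_assoc] at this
  have h1' := (Submodule.sub_mem_iff_right _ h1).1 (key 1)
  have h2' := (Submodule.sub_mem_iff_right _ h2).1 (key (-1))
  set c : ℕ → ℕ → K := fun k j => cf t k j * t ^ (k * (k - 1)) with hc
  set G : ℕ → K := fun p => ∑ x ∈ antidiagonal (l + 1), if x.1 % 2 = p then c x.1 x.2 else 0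
    with hG
  have hsplit : ∀ ε : K, ε ^ 2 = 1 → ∑ x ∈ antidiagonal (l + 1),
      (ε ^ x.1 * c x.1 x.2) • (lastKet N (x.1 % 2) (l + 1 - x.1 % 2) : Fock2 K N) =
      G 0 • lastKet N 0 (l + 1) + (ε * G 1) • lastKet N 1 l := by
    intro ε hε
    simp only [hG, Finset.mul_sum, Finset.sum_smul]
    rw [← Finset.sum_add_distrib]
    refine Finset.sum_congr rfl fun x _ => ?_
    have hp : ε ^ x.1 = ε ^ (x.1 % 2) := by
      conv_lhs => rw [← Nat.div_add_mod x.1 2, pow_add, pow_mul, hε, one_pow, one_mul]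
    rcases Nat.mod_two_eq_zero_or_one x.1 with h | h <;> simp [hp, h]
  have hsum : ∀ ε : K, ε ^ 2 = 1 → ∑ x ∈ antidiagonal (l + 1), ε ^ x.1 * c x.1 x.2 =
      G 0 + ε * G 1 := by
    intro ε hε
    simp only [hG, Finset.mul_sum]
    rw [← Finset.sum_add_distrib]
    refine Finset.sum_congr rfl fun x _ => ?_
    have hp : ε ^ x.1 = ε ^ (x.1 % 2) := by
      conv_lhs => rw [← Nat.div_add_mod x.1 2, pow_add, pow_mul, hε, one_pow, one_mul]
    rcases Nat.mod_two_eq_zero_or_one x.1 with h | h <;> simp [hp, h]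
  have g1 := ht.sum_cf_one_ne_zero (l + 1)
  have g2 := ht.sum_cf_neg_one l
  have g3 := hsum 1 (by simp)
  have g4 := hsum (-1) (by simp)
  simp only [one_pow, one_mul] at g3
  change ∑ x ∈ antidiagonal (l + 1), c x.1 x.2 ≠ 0 at g1
  change ∑ x ∈ antidiagonal (l + 1), (-1) ^ x.1 * c x.1 x.2 = 0 at g2
  have h01 : G 0 = G 1 := by linear_combination g2 - g4
  have h00 : G 0 * 2 ≠ 0 := by
    rw [g3] at g1
    intro h
    apply g1
    linear_combination h - h01
  change ∑ x ∈ antidiagonal (l + 1), (1 ^ x.1 * c x.1 x.2) • lastKet N (x.1 % 2)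
    (l + 1 - x.1 % 2) ∈ S at h1'
  change ∑ x ∈ antidiagonal (l + 1), ((-1) ^ x.1 * c x.1 x.2) • lastKet N (x.1 % 2)
    (l + 1 - x.1 % 2) ∈ S at h2'
  rw [hsplit _ (by simp)] at h1' h2'
  rw [← h01] at h1' h2'
  constructor
  · rw [← Submodule.smul_mem_iff _ h00]
    convert S.add_mem h1' h2' using 1
    module
  · rw [← Submodule.smul_mem_iff _ h00]
    convert S.sub_mem h1' h2' using 1
    module

end Generation

/-! ### Kets with first factor e_n and second factor on the last two sites. -/

section TopGeneration

variable {K : Type*} [Field K] {M : ℕ} {im t : K} {S : Submodule K (Fock2 K (M + 1))} {H : ℕ}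

attribute [local instance] addCommGroupFock2

/-- f_{n-1} on |0,1⟩ ⊗ |b+1,c+1⟩ gives the wanted ket and |1,0⟩ ⊗ |b+1,c+1⟩. The latter is in S
because f_{n-1} on |1,0⟩ ⊗ |b,c+2⟩ has a single term. -/
theorem topKet_zero_one_add_two_mem (ht : Generic t) (hS : FClosed im t S)
    (hH : ∀ a b : Fin (M + 2) → ℕ, height a + height b < H → ket2 a b ∈ S) {b c : ℕ}
    (h : 2 * b + c + 5 = H) : topKet M 0 1 (b + 2) c ∈ S := by
  have e1 := hS (.mid (Fin.last M)) (by simp) (topKet M 0 1 (b + 1) (c + 1)) (hH _ _ (by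
    simp only [height_topPair]; omega))
  have e2 := hS (.mid (Fin.last M)) (by simp) (topKet M 1 0 b (c + 2)) (hH _ _ (by
    simp only [height_topPair]; omega))
  rw [deltaF_mid_topKet] at e1 e2
  simp only [Nat.cast_zero, qNum_zero, zero_smul, zero_add, Nat.add_sub_cancel, Nat.reduceAdd,
    Nat.reduceSub] at e1 e2
  have e3 := (Submodule.smul_mem_iff _ (mul_ne_zero (zpow_ne_zero _ ht.sq_ne_zero)
    (ht.qNum_ne_zero (by omega)))).1 e2
  have e4 := (Submodule.add_mem_iff_right _ (S.smul_mem _ e3)).1 e1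
  exact (Submodule.smul_mem_iff _ (mul_ne_zero (zpow_ne_zero _ ht.sq_ne_zero)
    (ht.qNum_ne_zero (by omega)))).1 e4

/-- Here v_0^- is needed: it and f_{n-1} (|e_n⟩ ⊗ |e_n⟩) are combinations of the same two kets, and
their difference is [2] times the wanted one. -/
theorem topKet_zero_one_one_zero_mem (ht : Generic t) (hS : FClosed im t S)
    (h1 : topKet M 0 1 0 1 ∈ S) (h0 : vMinusZero t (M + 1) ∈ S) : topKet M 0 1 1 0 ∈ S := by
  have h2 : vMinusZero t (M + 1) = topKet M 1 0 0 1 - t ^ 2 • topKet M 0 1 1 0 := by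
    rw [vMinusZero, site_castSucc_last, site_last_succ]
    rfl
  have e1 := hS (.mid (Fin.last M)) (by simp) _ h1
  rw [deltaF_mid_topKet] at e1
  simp only [Nat.cast_one, Nat.cast_zero, ht.qNum_one, one_smul, zero_add, Nat.sub_self,
    mul_one, zero_sub, zpow_neg_one] at e1
  rw [h2] at h0
  have h3 := ht.qNum_ne_zero (m := 2) (by norm_num)
  rw [ht.qNum_two] at h3
  rw [← Submodule.smul_mem_iff _ h3]
  convert S.sub_mem e1 h0 using 1
  module

theorem qNum_three_mul {t : K} (ht : Generic t) (c : ℤ) :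
    qNum (t ^ 2) 3 * qNum (t ^ 2) (c + 1) - qNum (t ^ 2) (c - 1) =
      qNum (t ^ 2) 2 * qNum (t ^ 2) (c + 2) := by
  have hq := ht.sq_ne_zero
  have hs := ht.sq_sq_sub_one_ne_zero
  have hk := zpow_ne_zero c hq
  simp only [qNum_eq, zpow_sub₀ hq, zpow_add₀ hq, zpow_ofNat]
  generalize (t ^ 2) ^ c = A at *
  generalize t ^ 2 = q at *
  field_simp
  ring

/-- Four images under f_{n-1} and f_n involve the wanted ket and three others. Eliminating the
others leaves -[2][c+3], by `qNum_three_mul`, which is nonzero. -/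
theorem topKet_zero_one_one_succ_mem (ht : Generic t) (hS : FClosed im t S)
    (hH : ∀ a b : Fin (M + 2) → ℕ, height a + height b < H → ket2 a b ∈ S) {c : ℕ}
    (h : c + 4 = H) : topKet M 0 1 1 (c + 1) ∈ S := by
  have e1 := hS (.mid (Fin.last M)) (by simp) (topKet M 0 1 0 (c + 2)) (hH _ _ (by
    simp only [height_topPair]; omega))
  have e2 := hS .last (by simp) (topKet M 1 0 0 c) (hH _ _ (by
    simp only [height_topPair]; omega))
  have e3 := hS (.mid (Fin.last M)) (by simp) (topKet M 0 3 0 c) (hH _ _ (by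
    simp only [height_topPair]; omega))
  -- The factor [c] makes the truncated c - 1 harmless at c = 0.
  have e4 : (qNum (t ^ 2) c) • topKet M 0 3 1 (c - 1) -
      ((t ^ 2) ^ 3 * qNum (t ^ 2) c) • topKet M 0 1 1 (c + 1) ∈ S := by
    rcases c with _ | c
    · simp
    · have := hS .last (by simp) (topKet M 0 1 1 c) (hH _ _ (by
        simp only [height_topPair]; omega))
      rw [deltaF_last_topKet] at this
      have := S.smul_mem (qNum (t ^ 2) (c + 1 : ℕ)) this
      rw [smul_sub, smul_smul, mul_comm _ ((t ^ 2) ^ _)] at this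
      exact this
  rw [deltaF_mid_topKet] at e1 e3
  rw [deltaF_last_topKet] at e2
  have hq := ht.sq_ne_zero
  have h3 : (t ^ 2) ^ (((0 : ℕ) : ℤ) - (3 : ℕ)) = ((t ^ 2) ^ 3)⁻¹ := by
    rw [Nat.cast_zero, zero_sub, zpow_neg, zpow_natCast]
  have h1 : (t ^ 2) ^ (((0 : ℕ) : ℤ) - (1 : ℕ)) = (t ^ 2)⁻¹ := by simp
  rw [h1] at e1
  rw [h3] at e3
  simp only [Nat.cast_one, ht.qNum_one, one_smul, Nat.reduceSub, zero_add, mul_zero, pow_one] at e1 e2 e3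
  have e1' := S.smul_mem (qNum (t ^ 2) 3 * t ^ 2) e1
  have e2' := S.smul_mem (qNum (t ^ 2) 3) e2
  have e4' := S.smul_mem ((t ^ 2) ^ 3)⁻¹ e4
  have key := qNum_three_mul ht ((c : ℤ) + 1)
  have hne : -(qNum (t ^ 2) 2 * qNum (t ^ 2) ((c : ℤ) + 1 + 2)) ≠ 0 :=
    neg_ne_zero.2 (mul_ne_zero (ht.qNum_ne_zero (by omega)) (ht.qNum_ne_zero (by omega)))
  rw [← Submodule.smul_mem_iff _ hne]
  convert S.sub_mem (S.sub_mem (S.sub_mem e3 e2') e4') e1' using 1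
  push_cast
  rw [← key, show (c : ℤ) + 1 + 1 = c + 2 by ring, show (c : ℤ) + 1 - 1 = c by ring]
  have ht0 := ht.ne_zero
  match_scalars <;> field_simp <;> ring

theorem ket2_site_last_one_mem (ht : Generic t) (hS : FClosed im t S)
    (hH : ∀ a b : Fin (M + 2) → ℕ, height a + height b < H → ket2 a b ∈ S)
    (hl : ∀ l, 1 + l = H → lastKet (M + 1) 1 l ∈ S)
    (h0 : vMinusZero t (M + 1) ∈ S) (b : Fin (M + 2) → ℕ) (hb : 1 + height b = H) :
    ket2 (site (Fin.last (M + 1)) 1) b ∈ S := by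
  by_cases hj : ∃ i < (Fin.last M).castSucc, b i ≠ 0
  · obtain ⟨i, hi, hj⟩ := hj
    have hiM : (i : ℕ) < M := by simpa [Fin.lt_def] using hi
    obtain ⟨j, rfl⟩ : ∃ j : Fin (M + 1), i = j.castSucc := ⟨⟨i, by omega⟩, rfl⟩
    refine ket2_zero_mem_of_castSucc_ne_zero ht hS hH (by rw [height_site_last, hb]) hj ?_
    refine site_ne ?_ _
    rw [Fin.ne_iff_vne]
    simp at hiM ⊢
    omega
  · push Not at hj
    obtain ⟨β, γ, rfl⟩ : ∃ β γ, b = topPair M β γ := ⟨_, _, eq_topPair rfl rfl hj⟩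
    rw [height_topPair] at hb
    rw [site_last_succ]
    change topKet M 0 1 β γ ∈ S
    rcases β with _ | _ | β
    · rw [← lastKet_eq_topKet]
      exact hl γ (by omega)
    · rcases γ with _ | γ
      · refine topKet_zero_one_one_zero_mem ht hS (hH _ _ ?_) h0
        simp only [height_topPair]; omega
      · exact topKet_zero_one_one_succ_mem ht hS hH (by omega)
    · exact topKet_zero_one_add_two_mem ht hS hH (by omega)

end TopGeneration

section

variable {K : Type*} [Field K] [CharZero K] {N : ℕ} {im t : K} {S : Submodule K (Fock2 K N)}

/-- The singular vectors generate `V ⊗ V` under `f_r`, `1 ≤ r ≤ n`. -/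
theorem eq_top_of_fClosed (ht : Generic t) (hS : FClosed im t S)
    (h1 : ∀ l, signedSum N t 1 l ∈ S) (h2 : ∀ l, signedSum N t (-1) l ∈ S)
    (h0 : vMinusZero t N ∈ S) : S = ⊤ := by
  refine eq_top_of_ket2_mem fun a b => ?_
  induction hH : height a + height b using Nat.strong_induction_on generalizing a b with
  | _ H ih =>
    replace ih : ∀ a b : Fin (N + 1) → ℕ, height a + height b < H → ket2 a b ∈ S :=
      fun a b h => ih _ h a b rfl
    have hlast : ∀ k l, k ≤ 1 → k + l = H → lastKet N k l ∈ S := by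
      intro k l hk hl
      rcases H with _ | H
      · obtain rfl : k = 0 := by omega
        obtain rfl : l = 0 := by omega
        have := h1 0
        rw [signedSum_zero ht] at this
        simpa [lastKet, site_zero] using this
      · have := lastKet_mem ht hS ih (h1 _) (h2 _)
        obtain rfl | rfl : k = 0 ∨ k = 1 := by omega
        · obtain rfl : l = H + 1 := by omega
          exact this.1
        · obtain rfl : l = H := by omega
          exact this.2
    refine ket2_mem_of_base ht hS ih (fun b hb => ?_) ?_ a b hH
    · by_cases hj : ∃ j : Fin N, b j.castSucc ≠ 0
      · obtain ⟨j, hj⟩ := hj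
        exact ket2_zero_mem_of_castSucc_ne_zero ht hS ih (by rw [height_zero, hb, zero_add]) hj rfl
      · push Not at hj
        rw [eq_site_last hj] at hb ⊢
        rw [height_site_last] at hb
        simpa [lastKet, site_zero] using hlast 0 _ (by omega) ((zero_add _).trans hb)
    · cases N with
      | zero =>
        intro b hb
        have hj : ∀ j : Fin 0, b j.castSucc = 0 := fun j => j.elim0
        rw [eq_site_last hj] at hb ⊢
        rw [height_site_last] at hb
        exact hlast 1 _ le_rfl hb
      | succ M => exact ket2_site_last_one_mem ht hS ih (fun l hl => hlast 1 l le_rfl hl) h0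

end

end QOsc

namespace QOsc

/-! ### A contravariant bilinear form. -/

section Form

variable {K : Type*} [Field K] {N : ℕ}

attribute [local instance] addCommGroupFock2

/-- The squared norm of `|m⟩`. -/
noncomputable def nrm (t : K) (m : Fin (N + 1) → ℕ) : K :=
  ∏ i, qFact (t ^ 2) (m i) * t ^ (m i * (m i - 1))

theorem nrm_ne_zero {t : K} (ht : Generic t) (m : Fin (N + 1) → ℕ) : nrm t m ≠ 0 :=
  Finset.prod_ne_zero_iff.2 fun _ _ => mul_ne_zero (ht.qFact_ne_zero _) (pow_ne_zero _ ht.ne_zero)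

theorem nrm_add_site (t : K) (m : Fin (N + 1) → ℕ) (i : Fin (N + 1)) :
    nrm t (m + site i 1) = (t ^ 2) ^ m i * qNum (t ^ 2) ((m i : ℤ) + 1) * nrm t m := by
  have h : nrm t (m + site i 1) = ∏ j, (qFact (t ^ 2) (m j) * t ^ (m j * (m j - 1))) *
      if j = i then (t ^ 2) ^ m i * qNum (t ^ 2) ((m i : ℤ) + 1) else 1 := by
    refine Finset.prod_congr rfl fun j _ => ?_
    by_cases hj : j = i
    · subst hj
      rw [if_pos rfl, Pi.add_apply, site_same, qFact_succ]
      have : t ^ ((m j + 1) * (m j + 1 - 1)) = (t ^ 2) ^ m j * t ^ (m j * (m j - 1)) := by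
        rw [← pow_mul, ← pow_add]
        congr 1
        cases m j
        · simp
        · simp; ring
      rw [this]; ring
    · rw [if_neg hj, Pi.add_apply, site_ne hj, add_zero, mul_one]
  rw [h, Finset.prod_mul_distrib, Finset.prod_ite_eq' Finset.univ i]
  simp [nrm, mul_comm]

theorem nrm_site (t : K) (i : Fin (N + 1)) (k : ℕ) :
    nrm t (site i k) = qFact (t ^ 2) k * t ^ (k * (k - 1)) := by
  rw [nrm, Finset.prod_eq_single i]
  · rw [site_same]
  · intro j _ hj; simp [site_ne hj]
  · simp

/-- The diagonal bilinear form on the Fock space. -/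
noncomputable def form (t : K) : LinearMap.BilinForm K (Fock K N) :=
  Finsupp.linearCombination K fun m => nrm t m • Finsupp.lapply m

theorem form_ket (t : K) (a b : Fin (N + 1) → ℕ) :
    form t (ket a) (ket b) = if a = b then nrm t b else 0 := by
  rw [form, ket, Finsupp.linearCombination_single]
  simp only [one_smul, LinearMap.smul_apply, Finsupp.lapply_apply, ket, Finsupp.single_apply,
    smul_eq_mul]
  by_cases h : a = b
  · simp [h]
  · simp [h, Ne.symm h]

/-- The operators `f` and `g` are adjoint with respect to `B`. -/
def IsAdj {M : Type*} [AddCommMonoid M] [Module K M] (B : LinearMap.BilinForm K M)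
    (f g : Module.End K M) : Prop := LinearMap.IsAdjointPair B B f g

theorem IsAdj.mul {M : Type*} [AddCommMonoid M] [Module K M] {B : LinearMap.BilinForm K M}
    {f g f' g' : Module.End K M} (h : IsAdj B f g) (h' : IsAdj B f' g') :
    IsAdj B (f * f') (g' * g) := LinearMap.IsAdjointPair.mul h h'

theorem IsAdj.smul {M : Type*} [AddCommMonoid M] [Module K M] {B : LinearMap.BilinForm K M}
    {f g : Module.End K M} (c : K) (h : IsAdj B f g) : IsAdj B (c • f) (c • g) :=
  fun u v => by simpa using congrArg (c * ·) (h u v)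

theorem isAdj_of_ket {t : K} {f g : Module.End K (Fock K N)}
    (h : ∀ a b, form t (f (ket a)) (ket b) = form t (ket a) (g (ket b))) :
    IsAdj (form t) f g := by
  intro u v
  have : (form t).compl₂ g = LinearMap.comp (form t) f := by
    refine Finsupp.lhom_ext' fun a => LinearMap.ext_ring (Finsupp.lhom_ext' fun b =>
      LinearMap.ext_ring ?_)
    exact (h a b).symm
  exact (LinearMap.congr_fun₂ this u v).symm

theorem isAdj_dg (t : K) (φ : (Fin (N + 1) → ℕ) → K) :
    IsAdj (form t) (dg φ) (dg φ) :=
  isAdj_of_ket fun a b => by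
    simp only [dg_ket, map_smul, LinearMap.smul_apply, form_ket]
    split_ifs with h
    · rw [h]
    · simp

theorem isAdj_cr (t : K) (i : Fin (N + 1)) :
    IsAdj (form t) (cr i) ((dg fun m => (t ^ 2) ^ m i) * an t i) :=
  isAdj_of_ket fun a b => by
    simp only [cr_ket, Module.End.mul_apply, an_ket, map_smul, dg_ket, form_ket, smul_eq_mul]
    by_cases h0 : b i = 0
    · rw [if_neg, h0]
      · simp
      · rintro rfl; simp [site_same] at h0
    · obtain ⟨c, rfl⟩ : ∃ c, b = c + site i 1 := ⟨_, (eq_sub_site_add h0).symm⟩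
      simp only [add_left_inj, add_tsub_cancel_right, nrm_add_site, Pi.add_apply, site_same]
      split_ifs
      · push_cast; ring
      · simp

theorem form_symm (t : K) (u v : Fock K N) : form t u v = form t v u := by
  have : (form t : LinearMap.BilinForm K (Fock K N)) = (form t).flip := by
    refine Finsupp.lhom_ext' fun a => LinearMap.ext_ring (Finsupp.lhom_ext' fun b =>
      LinearMap.ext_ring ?_)
    change form t (ket a) (ket b) = form t (ket b) (ket a)
    rw [form_ket, form_ket]
    by_cases h : a = b
    · simp [h]
    · simp [h, Ne.symm h]
  exact LinearMap.congr_fun₂ this u v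

theorem isAdj_an {t : K} (ht : Generic t) (i : Fin (N + 1)) :
    IsAdj (form t) (an t i)
      (cr i * dg fun m => ((t ^ 2) ^ m i)⁻¹) := by
  have h1 : an t i = (dg fun m => ((t ^ 2) ^ m i)⁻¹) * ((dg fun m => (t ^ 2) ^ m i) * an t i) := by
    rw [← mul_assoc, dg_mul]
    have : ((fun m => ((t ^ 2) ^ m i)⁻¹) * fun m => (t ^ 2) ^ m i :
        (Fin (N + 1) → ℕ) → K) = 1 := by
      ext m
      exact inv_mul_cancel₀ (pow_ne_zero _ ht.sq_ne_zero)
    rw [this]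
    exact end_ext fun m => by simp
  intro u v
  conv_lhs => rw [h1]
  rw [Module.End.mul_apply, isAdj_dg, form_symm, ← isAdj_cr t i, form_symm]
  rfl

/-- The constants in `f_r† = d_r k_r⁻¹ e_r`. -/
noncomputable def adjCoeff (t : K) : Vertex N → K
  | .zero => kappa (t ^ 2) * t ^ 3
  | .mid _ => t ^ 2
  | .last => -qNum (t ^ 2) 2 ^ 2

/-- The power of t in `nrm` supplies the factor q^m in the adjoint of `cr`, and these factors
combine to k_r⁻¹. For r = 0 the parameter x is replaced by its inverse. -/
theorem isAdj_fOp {im t : K} (him : im ^ 2 = -1) (ht : Generic t) (x : K) (r : Vertex N) :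
    IsAdj (form t) (fOp N im t x r)
      (adjCoeff t r • (kInvOp N im t r * eOp N t x⁻¹ r)) := by
  have hq := ht.sq_ne_zero
  have h0 := ht.ne_zero
  have hi : im ≠ 0 := by rintro rfl; simp at him
  cases r with
  | zero =>
    rw [fOp_zero]
    convert IsAdj.smul (im * kappa (t ^ 2) * x⁻¹) (isAdj_an ht (0 : Fin (N + 1))) using 1
    refine end_ext fun m => ?_
    simp only [adjCoeff, kInvOp_eq, eOp_zero, LinearMap.smul_apply, Module.End.mul_apply, cr_ket,
      dg_ket, map_smul, smul_smul, kEig, Pi.add_apply, site_same]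
    congr 1
    have h2 : t ^ (2 * ((m 0 + 1 : ℕ) : ℤ) + 1) = t ^ 3 * (t ^ 2) ^ m 0 := by
      rw [← pow_mul, ← pow_add, ← zpow_natCast]
      congr 1; push_cast; ring
    rw [h2]
    field_simp
    linear_combination -(kappa (t ^ 2) * x⁻¹) * him
  | mid j =>
    have hj := castSucc_ne_succ j
    have h := IsAdj.mul (isAdj_cr t j.castSucc) (isAdj_an ht j.succ)
    rw [fOp_mid]
    convert h using 1
    refine end_ext fun m => ?_
    simp only [adjCoeff, kInvOp_eq, eOp_mid, LinearMap.smul_apply, Module.End.mul_apply, cr_ket,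
      an_ket, dg_ket, map_smul, smul_smul, kEig, Pi.add_apply, Pi.sub_apply, site_same,
      site_ne hj, site_ne hj.symm]
    by_cases hm : m j.castSucc = 0
    · simp [hm]
    · obtain ⟨c, rfl⟩ : ∃ c, m = c + site j.castSucc 1 := ⟨_, (eq_sub_site_add hm).symm⟩
      simp only [add_tsub_cancel_right, Pi.add_apply, site_same, site_ne hj.symm, add_zero]
      congr 1
      push_cast
      rw [neg_add_eq_sub, Nat.sub_zero, add_sub_right_comm, zpow_add₀ hq, zpow_sub₀ hq, zpow_natCast,
        zpow_natCast, zpow_one]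
      field_simp
  | last =>
    have h := IsAdj.mul (isAdj_cr t (Fin.last N)) (isAdj_cr t (Fin.last N))
    have h2 := ht.qNum_ne_zero (m := 2) (by norm_num)
    rw [fOp_last]
    convert h using 1
    rw [eOp_last]
    refine end_ext fun m => ?_
    simp only [adjCoeff, kInvOp_eq, LinearMap.smul_apply, Module.End.mul_apply,
      an_ket, dg_ket, map_smul, smul_smul, kEig, Pi.sub_apply, site_same]
    congr 1
    by_cases hm : m (Fin.last N) = 0
    · simp [hm]
    · by_cases hm1 : m (Fin.last N) = 1
      · simp [hm1]
      · obtain ⟨c, hc⟩ : ∃ c, m (Fin.last N) = c + 2 := ⟨m (Fin.last N) - 2, by omega⟩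
        simp only [hc, Nat.add_sub_cancel, show c + 2 - 1 = c + 1 by omega]
        have h3 : (t ^ 2) ^ (-2 * (c : ℤ) - 1) = ((t ^ 2) ^ (2 * c + 1))⁻¹ := by
          rw [← zpow_natCast (t ^ 2), ← zpow_neg]; congr 1; push_cast; ring
        rw [h3]
        field_simp
        ring

/-- The diagonal bilinear form on `V ⊗ V`. -/
noncomputable def form2 (t : K) : LinearMap.BilinForm K (Fock2 K N) :=
  LinearMap.BilinForm.tmul (form t) (form t)

theorem form2_tmul (t : K) (a b c d : Fock K N) :
    form2 t (a ⊗ₜ[K] b) (c ⊗ₜ[K] d) = form t a c * form t b d := by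
  rw [form2, LinearMap.BilinForm.tmul, LinearMap.BilinForm.tensorDistrib_tmul, mul_comm]
  rfl

theorem form2_ket2 (t : K) (a b c d : Fin (N + 1) → ℕ) :
    form2 t (ket2 a b) (ket2 c d) = if a = c ∧ b = d then nrm t c * nrm t d else 0 := by
  rw [ket2, ket2, form2_tmul, form_ket, form_ket]
  by_cases h1 : a = c <;> by_cases h2 : b = d <;> simp [h1, h2]

theorem form2_symm (t : K) (u v : Fock2 K N) : form2 t u v = form2 t v u := by
  have : (form2 t : LinearMap.BilinForm K (Fock2 K N)) = (form2 t).flip := by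
    refine end2_ext fun a b => end2_ext fun c d => ?_
    change form2 t (ket2 a b) (ket2 c d) = form2 t (ket2 c d) (ket2 a b)
    simp only [ket2, form2_tmul, form_symm t (ket c), form_symm t (ket d)]
  exact LinearMap.congr_fun₂ this u v

/-- The form is diagonal in the basis of kets, with nonzero norms. -/
theorem eq_zero_of_form2 {t : K} (ht : Generic t) {v : Fock2 K N} (h : ∀ u, form2 t u v = 0) :
    v = 0 := by
  let b := (Finsupp.basisSingleOne (R := K) (ι := Fin (N + 1) → ℕ)).tensorProduct
    (Finsupp.basisSingleOne (R := K) (ι := Fin (N + 1) → ℕ))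
  have hb : ∀ x, b x = ket2 x.1 x.2 := fun x => by
    simp [b, ket2, ket, Module.Basis.tensorProduct_apply']
  refine b.ext_elem fun x => ?_
  have h1 : form2 t (ket2 x.1 x.2) = (nrm t x.1 * nrm t x.2) • b.coord x := by
    refine b.ext fun y => ?_
    rw [hb, form2_ket2, ← hb, LinearMap.smul_apply, Module.Basis.coord_apply, b.repr_self,
      Finsupp.single_apply]
    by_cases hxy : y = x
    · subst hxy; simp
    · have : ¬ (x.1 = y.1 ∧ x.2 = y.2) := fun h => hxy (Prod.ext h.1.symm h.2.symm)
      simp [hxy, this]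
  have h2 := h (ket2 x.1 x.2)
  rw [h1, LinearMap.smul_apply, smul_eq_mul, mul_eq_zero] at h2
  simpa using h2.resolve_left (mul_ne_zero (nrm_ne_zero ht _) (nrm_ne_zero ht _))

theorem isAdj_map {t : K} {f f' g g' : Module.End K (Fock K N)}
    (h1 : IsAdj (form t) f f')
    (h2 : IsAdj (form t) g g') :
    IsAdj (form2 t) (TensorProduct.map f g)
      (TensorProduct.map f' g') := by
  intro u v
  have : (form2 t).compl₂ (TensorProduct.map f' g') =
      LinearMap.comp (form2 t) (TensorProduct.map f g) := by
    refine end2_ext fun a b => end2_ext fun c d => ?_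
    change form2 t (ket2 a b) (TensorProduct.map f' g' (ket2 c d)) =
      form2 t (TensorProduct.map f g (ket2 a b)) (ket2 c d)
    rw [map_ket2, map_ket2]
    simp only [ket2, form2_tmul, h1 (ket a), h2 (ket b)]
  exact (LinearMap.congr_fun₂ this u v).symm

/-- (k⁻¹ ⊗ k⁻¹)(1 ⊗ e + e ⊗ k) = k⁻¹ ⊗ k⁻¹e + k⁻¹e ⊗ 1, which is Δ(f) with each f replaced by k⁻¹e.
Thus the adjoint is compatible with the coproduct. -/
theorem isAdj_deltaF {im t : K} (him : im ^ 2 = -1) (ht : Generic t) (x y : K)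
    (r : Vertex N) : IsAdj (form2 t) (deltaF N im t x y r)
      (adjCoeff t r • (deltaKInv N im t r * deltaE N im t x⁻¹ y⁻¹ r)) := by
  have h1 : IsAdj (form t) (1 : Module.End K (Fock K N)) 1 :=
    fun _ _ => rfl
  have e1 := isAdj_map (isAdj_fOp him ht x r) h1
  have e2 := isAdj_map (isAdj_dg t fun m => (kEig N im t r m)⁻¹)
    (isAdj_fOp him ht y r)
  have e3 : adjCoeff t r • (deltaKInv N im t r * deltaE N im t x⁻¹ y⁻¹ r) =
      TensorProduct.map (adjCoeff t r • (kInvOp N im t r * eOp N t x⁻¹ r)) 1 +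
      TensorProduct.map (dg fun m => (kEig N im t r m)⁻¹)
        (adjCoeff t r • (kInvOp N im t r * eOp N t y⁻¹ r)) := by
    rw [deltaKInv, deltaE, mul_add, ← TensorProduct.map_mul, ← TensorProduct.map_mul, mul_one,
      kInvOp_mul_kOp him ht, TensorProduct.map_smul_left, TensorProduct.map_smul_right,
      ← kInvOp_eq, smul_add]
    exact add_comm _ _
  rw [e3]
  intro u v
  rw [deltaF, LinearMap.add_apply, map_add, LinearMap.add_apply, LinearMap.add_apply, map_add,
    e1, ← kInvOp_eq]
  exact congrArg _ (e2 u v)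

end Form

end QOsc

namespace QOsc

/-! ### Submodules generated by singular vectors. -/

section Span

variable {K : Type*} [Field K] {N : ℕ}

attribute [local instance] addCommGroupFock2

/-- The subspace generated by `v` under `f_r`, `1 ≤ r ≤ n`. -/
noncomputable def fSpan (im t : K) (v : Fock2 K N) : Submodule K (Fock2 K N) :=
  sInf {S | FClosed im t S ∧ v ∈ S}

variable {im t : K} {v : Fock2 K N}

theorem mem_fSpan_self : v ∈ fSpan im t v := Submodule.mem_sInf.2 fun _ h => h.2

theorem fClosed_fSpan : FClosed im t (fSpan im t v) := fun r hr _ hu =>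
  Submodule.mem_sInf.2 fun S h => h.1 r hr _ (Submodule.mem_sInf.1 hu S h)

theorem fSpan_le {S : Submodule K (Fock2 K N)} (hS : FClosed im t S) (hv : v ∈ S) :
    fSpan im t v ≤ S := sInf_le ⟨hS, hv⟩

/-- The vector `v` is annihilated by `e_r` and an eigenvector of `k_r`, `1 ≤ r ≤ n`. -/
structure IsSingular (im t : K) (v : Fock2 K N) : Prop where
  deltaE_eq_zero : ∀ r : Vertex N, r ≠ .zero → deltaE N im t 1 1 r v = 0
  deltaK_eq_smul : ∀ r : Vertex N, ∃ c : K, deltaK N im t r v = c • v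

/-- By minimality of the span it suffices that those of its vectors which k_r keeps inside form an
f-closed subspace containing v. The lemmas for k_r⁻¹ and e_r follow the same pattern. -/
theorem fSpan_le_comap (hv : IsSingular im t v) (ht : Generic t) (r : Vertex N) :
    fSpan im t v ≤ (fSpan im t v).comap (deltaK N im t r) := by
  have : FClosed im t (fSpan im t v ⊓ (fSpan im t v).comap (deltaK N im t r)) := by
    rintro s hs u ⟨hu, hu'⟩
    refine ⟨fClosed_fSpan s hs u hu, ?_⟩
    change deltaK N im t r (deltaF N im t 1 1 s u) ∈ fSpan im t v
    rw [← Module.End.mul_apply, deltaK_mul_deltaF ht]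
    exact Submodule.smul_mem _ _ (fClosed_fSpan s hs _ hu')
  refine (fSpan_le this ⟨mem_fSpan_self, ?_⟩).trans inf_le_right
  obtain ⟨c, hc⟩ := hv.deltaK_eq_smul r
  change deltaK N im t r v ∈ fSpan im t v
  rw [hc]
  exact Submodule.smul_mem _ _ mem_fSpan_self

theorem deltaKInv_mul_deltaF (him : im ^ 2 = -1) (ht : Generic t) {x y : K} (r s : Vertex N) :
    deltaKInv N im t r * deltaF N im t x y s =
      (t ^ (-2 * (shift r ⬝ᵥ shift s)))⁻¹ • (deltaF N im t x y s * deltaKInv N im t r) := by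
  have h := deltaK_mul_deltaF (im := im) ht (x := x) (y := y) r s
  have hc : t ^ (-2 * (shift r ⬝ᵥ shift s)) ≠ 0 := zpow_ne_zero _ ht.ne_zero
  rw [eq_inv_smul_iff₀ hc]
  calc t ^ (-2 * (shift r ⬝ᵥ shift s)) • (deltaKInv N im t r * deltaF N im t x y s)
      = deltaKInv N im t r * (t ^ (-2 * (shift r ⬝ᵥ shift s)) •
          (deltaF N im t x y s * deltaK N im t r)) * deltaKInv N im t r := by
        rw [mul_smul_comm, smul_mul_assoc, mul_assoc, mul_assoc, deltaK_mul_deltaKInv him ht,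
          mul_one]
    _ = _ := by rw [← h, ← mul_assoc, deltaKInv_mul_deltaK him ht, one_mul]

theorem fSpan_le_comap_inv (hv : IsSingular im t v) (him : im ^ 2 = -1) (ht : Generic t)
    (r : Vertex N) : fSpan im t v ≤ (fSpan im t v).comap (deltaKInv N im t r) := by
  have : FClosed im t (fSpan im t v ⊓ (fSpan im t v).comap (deltaKInv N im t r)) := by
    rintro s hs u ⟨hu, hu'⟩
    refine ⟨fClosed_fSpan s hs u hu, ?_⟩
    change deltaKInv N im t r (deltaF N im t 1 1 s u) ∈ fSpan im t v
    rw [← Module.End.mul_apply, deltaKInv_mul_deltaF him ht]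
    exact Submodule.smul_mem _ _ (fClosed_fSpan s hs _ hu')
  refine (fSpan_le this ⟨mem_fSpan_self, ?_⟩).trans inf_le_right
  obtain ⟨c, hc⟩ := hv.deltaK_eq_smul r
  have h1 : v = c • deltaKInv N im t r v := by
    rw [← map_smul, ← hc, ← Module.End.mul_apply, deltaKInv_mul_deltaK him ht]
    rfl
  change deltaKInv N im t r v ∈ fSpan im t v
  by_cases h0 : c = 0
  · rw [h0, zero_smul] at h1
    rw [h1, map_zero]
    exact Submodule.zero_mem _
  · rw [← Submodule.smul_mem_iff _ h0, ← h1]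
    exact mem_fSpan_self

/-- Moving e_r through a word in the f_s produces only terms with k_r - k_r⁻¹, until e_r reaches v
and kills it. -/
theorem isInvariantC_fSpan (hv : IsSingular im t v) (him : im ^ 2 = -1) (ht : Generic t) :
    IsInvariantC N im t (fSpan im t v) := by
  intro r hr u hu
  refine ⟨?_, fClosed_fSpan r hr u hu, fSpan_le_comap hv ht r hu,
    fSpan_le_comap_inv hv him ht r hu⟩
  have : FClosed im t (fSpan im t v ⊓ (fSpan im t v).comap (deltaE N im t 1 1 r)) := by
    rintro s hs u ⟨hu, hu'⟩
    refine ⟨fClosed_fSpan s hs u hu, ?_⟩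
    change deltaE N im t 1 1 r (deltaF N im t 1 1 s u) ∈ fSpan im t v
    have h1 : deltaF N im t 1 1 s (deltaE N im t 1 1 r u) ∈ fSpan im t v :=
      fClosed_fSpan s hs _ hu'
    by_cases hrs : r = s
    · subst hrs
      have h := LinearMap.congr_fun
        (deltaE_bracket_deltaF (N := N) him ht (x := 1) (y := 1) (x' := 1) (y' := 1) hr) u
      rw [LinearMap.add_apply, Module.End.mul_apply, Module.End.mul_apply] at h
      rw [h]
      refine Submodule.add_mem _ h1 ?_
      rw [LinearMap.smul_apply, LinearMap.sub_apply]
      exact Submodule.smul_mem _ _ (Submodule.sub_mem _ (fSpan_le_comap hv ht r hu)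
        (fSpan_le_comap_inv hv him ht r hu))
    · rw [← Module.End.mul_apply, deltaE_comm_deltaF him ht hrs]
      exact h1
  refine ((fSpan_le this ⟨mem_fSpan_self, ?_⟩).trans inf_le_right) hu
  change deltaE N im t 1 1 r v ∈ fSpan im t v
  rw [hv.deltaE_eq_zero r hr]
  exact Submodule.zero_mem _

theorem generatedC_eq_fSpan (hv : IsSingular im t v) (him : im ^ 2 = -1) (ht : Generic t) :
    generatedC N im t v = fSpan im t v :=
  le_antisymm (sInf_le ⟨isInvariantC_fSpan hv him ht, mem_fSpan_self⟩)
    (le_sInf fun _ h => fSpan_le (fun r hr u hu => (h.1 r hr u hu).2.1) h.2)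

/-- Across the form each f_r becomes a multiple of k_r⁻¹ e_r, which preserves the other module; v
itself is orthogonal to every image of f_r because e_r v = 0. -/
theorem form2_fSpan_eq_zero {v v' : Fock2 K N} (hv : IsSingular im t v) (hv' : IsSingular im t v')
    (him : im ^ 2 = -1) (ht : Generic t) (h : form2 t v v' = 0) {u u' : Fock2 K N}
    (hu : u ∈ fSpan im t v) (hu' : u' ∈ fSpan im t v') : form2 t u u' = 0 := by
  have key : ∀ r : Vertex N, r ≠ .zero → ∀ a b : Fock2 K N, form2 t (deltaF N im t 1 1 r a) b =
      adjCoeff t r * form2 t a (deltaKInv N im t r (deltaE N im t 1 1 r b)) := fun r hr a b => by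
    rw [isAdj_deltaF him ht 1 1 r a b, inv_one]
    simp
  let S : Submodule K (Fock2 K N) :=
    { carrier := {a | ∀ b ∈ fSpan im t v', form2 t a b = 0}
      add_mem' := fun {a b} ha hb c hc => by simp [ha c hc, hb c hc]
      zero_mem' := fun c _ => by simp
      smul_mem' := fun c a ha b hb => by simp [ha b hb] }
  have hS : FClosed im t S := fun r hr a ha b hb => by
    rw [key r hr, ha _ (fSpan_le_comap_inv hv' him ht r
      (isInvariantC_fSpan hv' him ht r hr b hb).1), mul_zero]
  have hvS : v ∈ S := by
    intro b hb
    let T : Submodule K (Fock2 K N) :=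
      { carrier := {a | form2 t v a = 0}
        add_mem' := fun {a b} ha hb => by
          simp only [Set.mem_ofPred_eq] at *
          rw [map_add, ha, hb, add_zero]
        zero_mem' := by simp
        smul_mem' := fun c a ha => by
          simp only [Set.mem_ofPred_eq] at *
          rw [map_smul, ha, smul_zero] }
    refine (fSpan_le (S := T) (fun r hr a _ => ?_) h) hb
    change form2 t v _ = 0
    rw [form2_symm, key r hr, hv.deltaE_eq_zero r hr]
    simp
  exact fSpan_le hS hvS hu u' hu'

end Span

/-! ### Singularity and orthogonality of the given vectors. -/

section Singular

variable {K : Type*} [Field K] {N : ℕ} {im t : K}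

attribute [local instance] addCommGroupFock2

/-- The eigenvalue on |a⟩ ⊗ |b⟩ depends on a + b only, so a combination of kets of equal total
occupation is an eigenvector. -/
theorem kEig_mul_kEig (ht : Generic t) (r : Vertex N) (a b : Fin (N + 1) → ℕ) :
    kEig N im t r a * kEig N im t r b = kEig N im t r (a + b) * kEig N im t r 0 := by
  have h0 := ht.ne_zero
  have hq := ht.sq_ne_zero
  cases r <;> simp only [kEig, Pi.add_apply, Pi.zero_apply]
  · rw [mul_mul_mul_comm, ← zpow_add₀ h0, mul_mul_mul_comm, ← zpow_add₀ h0]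
    congr 2
    push_cast
    ring
  · rw [← zpow_add₀ hq, ← zpow_add₀ hq]
    congr 1
    push_cast
    ring
  · rw [neg_mul_neg, neg_mul_neg, ← zpow_add₀ hq, ← zpow_add₀ hq]
    congr 1
    push_cast
    ring

theorem exists_deltaK_eq_smul (ht : Generic t) (r : Vertex N) (s : Fin (N + 1) → ℕ) :
    ∃ c : K, ∀ a b, a + b = s → deltaK N im t r (ket2 a b) = c • ket2 a b :=
  ⟨_, fun a b h => by rw [deltaK_ket2, kEig_mul_kEig ht, h]⟩

theorem isSingular_signedSum (ht : Generic t) {ε : K} (hε : ε ^ 2 = 1) (l : ℕ) :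
    IsSingular im t (signedSum N t ε l) where
  deltaE_eq_zero r hr := by
    cases r with
    | zero => exact absurd rfl hr
    | mid j =>
      have h := (Fin.castSucc_lt_last j).ne
      simp only [signedSum, map_sum, map_smul, lastKet, deltaE_mid_ket2, site_ne h]
      simp
    | last => exact deltaE_last_signedSum ht im hε l
  deltaK_eq_smul r := by
    obtain ⟨c, hc⟩ := exists_deltaK_eq_smul (im := im) ht r (site (Fin.last N) l)
    refine ⟨c, ?_⟩
    rw [signedSum, map_sum, Finset.smul_sum]
    refine Finset.sum_congr rfl fun x hx => ?_
    rw [map_smul, lastKet, hc _ _ (by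
      rw [site_add, Finset.HasAntidiagonal.mem_antidiagonal.1 hx]), smul_comm]

theorem vMinusZero_succ (t : K) (M : ℕ) :
    vMinusZero t (M + 1) = topKet M 1 0 0 1 - t ^ 2 • topKet M 0 1 1 0 := by
  rw [vMinusZero, site_castSucc_last, site_last_succ]
  rfl

theorem isSingular_vMinusZero (ht : Generic t) : IsSingular im t (vMinusZero t N) := by
  cases N with
  | zero => exact ⟨fun _ _ => map_zero _, fun _ => ⟨0, by rw [vMinusZero, map_zero, smul_zero]⟩⟩
  | succ M =>
    rw [vMinusZero_succ]
    constructor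
    · intro r hr
      cases r with
      | zero => exact absurd rfl hr
      | mid j =>
        rcases eq_or_ne j (Fin.last M) with rfl | hj
        · rw [map_sub, map_smul, deltaE_mid_topKet, deltaE_mid_topKet]
          simp [ht.qNum_one]
        · have h : j.castSucc < (Fin.last M).castSucc := by
            rw [Fin.castSucc_lt_castSucc_iff]
            exact lt_of_le_of_ne (Fin.le_last j) hj
          rw [map_sub, map_smul, topKet, topKet, deltaE_mid_ket2, deltaE_mid_ket2]
          simp [topPair_of_lt h]
      | last =>
        rw [map_sub, map_smul, topKet, topKet, deltaE_last_ket2, deltaE_last_ket2]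
        simp
    · intro r
      obtain ⟨c, hc⟩ := exists_deltaK_eq_smul (im := im) ht r (topPair M 1 1)
      refine ⟨c, ?_⟩
      rw [map_sub, map_smul, topKet, topKet, hc _ _ (by simp [topPair_add]),
        hc _ _ (by simp [topPair_add]), smul_sub, smul_comm]

theorem form2_lastKet (t : K) (k j k' j' : ℕ) :
    form2 t (lastKet N k j) (lastKet N k' j') = if k = k' ∧ j = j' then
      qFact (t ^ 2) k' * t ^ (k' * (k' - 1)) * (qFact (t ^ 2) j' * t ^ (j' * (j' - 1))) else 0 := by
  have h : ∀ a b, (site (Fin.last N) a = site (Fin.last N) b) ↔ a = b := fun a b =>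
    ⟨fun h => by simpa [site_same] using congrFun h (Fin.last N), fun h => by rw [h]⟩
  rw [lastKet, lastKet, form2_ket2, nrm_site, nrm_site]
  simp only [h]

theorem form2_signedSum (t ε ε' : K) (l l' : ℕ) :
    form2 t (signedSum N t ε l) (signedSum N t ε' l') =
      ∑ x ∈ antidiagonal l, if x ∈ antidiagonal l' then ε ^ x.1 * cf t x.1 x.2 *
        (ε' ^ x.1 * cf t x.1 x.2) * (qFact (t ^ 2) x.1 * t ^ (x.1 * (x.1 - 1)) *
          (qFact (t ^ 2) x.2 * t ^ (x.2 * (x.2 - 1)))) else 0 := by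
  simp only [signedSum, map_sum, map_smul, LinearMap.sum_apply, LinearMap.smul_apply,
    form2_lastKet, smul_eq_mul, Finset.mul_sum]
  rw [Finset.sum_comm]
  refine Finset.sum_congr rfl fun x _ => ?_
  rw [← Finset.sum_ite_eq (antidiagonal l') x fun x => ε ^ x.1 * cf t x.1 x.2 *
        (ε' ^ x.1 * cf t x.1 x.2) * (qFact (t ^ 2) x.1 * t ^ (x.1 * (x.1 - 1)) *
          (qFact (t ^ 2) x.2 * t ^ (x.2 * (x.2 - 1))))]
  refine Finset.sum_congr rfl fun y _ => ?_
  by_cases h : x = y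
  · subst h
    simp
    ring
  · have : ¬ (x.1 = y.1 ∧ x.2 = y.2) := fun h' => h (Prod.ext h'.1 h'.2)
    rw [if_neg h, if_neg this, mul_zero, mul_zero]

theorem form2_signedSum_of_ne (t ε ε' : K) {l l' : ℕ} (h : l ≠ l') :
    form2 t (signedSum N t ε l) (signedSum N t ε' l') = 0 := by
  rw [form2_signedSum]
  refine Finset.sum_eq_zero fun x hx => if_neg fun hx' => h ?_
  rw [← Finset.HasAntidiagonal.mem_antidiagonal.1 hx, Finset.HasAntidiagonal.mem_antidiagonal.1 hx']

/-- One factor `cf` times the norms is the same number for all terms; the rest is the alternating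
sum of `sum_cf_neg_one`. -/
theorem form2_signedSum_neg (ht : Generic t) {ε : K} (hε : ε ^ 2 = 1) (l : ℕ) :
    form2 t (signedSum N t ε (l + 1)) (signedSum N t (-ε) (l + 1)) = 0 := by
  rw [form2_signedSum]
  have h := congrArg (fun c => qFact (t ^ 2) (l + 1) * t ^ ((l + 1) * l) * c) (ht.sum_cf_neg_one l)
  simp only [mul_zero] at h
  rw [← h, Finset.mul_sum]
  refine Finset.sum_congr rfl fun x hx => ?_
  rw [if_pos hx]
  have hx' := Finset.HasAntidiagonal.mem_antidiagonal.1 hx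
  obtain ⟨k, j⟩ := x
  simp only at hx' ⊢
  have h0 := ht.ne_zero
  have h1 := ht.qFact_ne_zero k
  have h2 := ht.qFact_ne_zero j
  have h3 : cf t k j * (qFact (t ^ 2) k *
      (qFact (t ^ 2) j * t ^ (j * (j - 1)))) = qFact (t ^ 2) (l + 1) * t ^ ((l + 1) * l) := by
    have h4 : t ^ ((k : ℤ) * ((k : ℤ) + 2 * j - 1)) * t ^ (j * (j - 1)) =
        t ^ ((l + 1) * l) := by
      simp only [← zpow_natCast t, ← zpow_add₀ h0]
      congr 1
      have hc : ∀ m : ℕ, ((m * (m - 1) : ℕ) : ℤ) = m * (m - 1) := fun m => by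
        cases m <;> simp
      rw [hc]
      have : (l : ℤ) = k + j - 1 := by omega
      push_cast
      rw [this]; ring
    rw [cf_eq, hx', ← h4]
    field_simp
  have h5 : ε ^ k * (-ε) ^ k = (-1) ^ k := by
    rw [← mul_pow]; congr 1; linear_combination -hε
  rw [← h3, ← h5]
  ring

theorem form2_signedSum_vMinusZero (t ε : K) (l : ℕ) :
    form2 t (signedSum N t ε l) (vMinusZero t N) = 0 := by
  cases N with
  | zero => rw [vMinusZero, map_zero]
  | succ M =>
    have h : ∀ a b c d : ℕ, topPair M a b = topPair M c d → a = c := fun a b c d h => by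
      simpa using congrFun h (Fin.last M).castSucc
    rw [vMinusZero_succ, signedSum, map_sum, LinearMap.sum_apply]
    refine Finset.sum_eq_zero fun x _ => ?_
    rw [map_smul, LinearMap.smul_apply, map_sub, map_smul, lastKet_eq_topKet, topKet, topKet,
      topKet, form2_ket2, form2_ket2, if_neg, if_neg]
    · simp
    · exact fun h' => absurd (h _ _ _ _ h'.2) (by norm_num)
    · exact fun h' => absurd (h _ _ _ _ h'.1) (by norm_num)

end Singular

end QOsc

namespace QOsc

/-! ### V ⊗ V is the direct sum of the components. -/

section Decomposition

variable {K : Type*} [Field K] {N : ℕ} {im t : K}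

attribute [local instance] addCommGroupFock2

/-- The sign `± 1` attached to a label. -/
def PM.sign (K : Type*) [Field K] : PM → K
  | .plus => 1
  | .minus => -1

theorem PM.sign_sq (σ : PM) : σ.sign K ^ 2 = 1 := by cases σ <;> simp [PM.sign]

/-- The singular vector that generates a component. -/
noncomputable def singVec (N : ℕ) (t : K) : PM × ℕ → Fock2 K N
  | (.plus, 0) => ket2 0 0
  | (.minus, 0) => vMinusZero t N
  | (σ, l + 1) => signedSum N t (σ.sign K) (l + 1)

theorem singVec_succ (t : K) (σ : PM) (l : ℕ) :
    singVec N t (σ, l + 1) = signedSum N t (σ.sign K) (l + 1) := by cases σ <;> rfl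

theorem isSingular_singVec (ht : Generic t) (i : PM × ℕ) : IsSingular im t (singVec N t i) := by
  obtain ⟨σ, l⟩ := i
  cases l with
  | zero =>
    cases σ
    · rw [singVec, ← signedSum_zero ht 1]
      exact isSingular_signedSum ht (by simp) 0
    · exact isSingular_vMinusZero ht
  | succ l => rw [singVec_succ]; exact isSingular_signedSum ht σ.sign_sq _

theorem component_eq_fSpan (him : im ^ 2 = -1) (ht : Generic t) (i : PM × ℕ) :
    component N im t i = fSpan im t (singVec N t i) := by
  rw [← generatedC_eq_fSpan (isSingular_singVec ht i) him ht]
  obtain ⟨σ, l⟩ := i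
  cases l with
  | zero =>
    cases σ
    · rw [component, vPlus_zero t 1, signedSum_zero ht, singVec]
    · rfl
  | succ l =>
    rw [singVec_succ]
    cases σ
    · rw [component, vPlus_add_vMinus, PM.sign]
    · rw [component, vPlus_sub_vMinus, PM.sign]

theorem singVec_mem (him : im ^ 2 = -1) (ht : Generic t) (i : PM × ℕ) :
    singVec N t i ∈ component N im t i := by
  rw [component_eq_fSpan him ht]
  exact mem_fSpan_self

theorem fClosed_component (him : im ^ 2 = -1) (ht : Generic t) (i : PM × ℕ) :
    FClosed im t (component N im t i) := by
  rw [component_eq_fSpan him ht]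
  exact fClosed_fSpan

theorem isInvariantC_component (him : im ^ 2 = -1) (ht : Generic t) (i : PM × ℕ) :
    IsInvariantC N im t (component N im t i) := by
  rw [component_eq_fSpan him ht]
  exact isInvariantC_fSpan (isSingular_singVec ht i) him ht

theorem deltaK_component_mem (him : im ^ 2 = -1) (ht : Generic t) (i : PM × ℕ) (r : Vertex N)
    {v : Fock2 K N} (hv : v ∈ component N im t i) : deltaK N im t r v ∈ component N im t i := by
  rw [component_eq_fSpan him ht] at hv ⊢
  exact fSpan_le_comap (isSingular_singVec ht i) ht r hv

theorem form2_singVec (ht : Generic t) {i j : PM × ℕ} (h : i ≠ j) :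
    form2 t (singVec N t i) (singVec N t j) = 0 := by
  obtain ⟨σ, l⟩ := i
  obtain ⟨τ, m⟩ := j
  have h0 : (singVec N t (.plus, 0) : Fock2 K N) = signedSum N t 1 0 := (signedSum_zero ht 1).symm
  have h1 : (singVec N t (.minus, 0) : Fock2 K N) = vMinusZero t N := rfl
  rcases l with _ | l <;> rcases m with _ | m
  · cases σ <;> cases τ
    · exact absurd rfl h
    · rw [h0, h1, form2_signedSum_vMinusZero]
    · rw [h0, h1, form2_symm, form2_signedSum_vMinusZero]
    · exact absurd rfl h
  · rw [singVec_succ]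
    cases σ
    · rw [h0, form2_signedSum_of_ne _ _ _ (by omega)]
    · rw [h1, form2_symm, form2_signedSum_vMinusZero]
  · rw [singVec_succ]
    cases τ
    · rw [h0, form2_signedSum_of_ne _ _ _ (by omega)]
    · rw [h1, form2_signedSum_vMinusZero]
  · rw [singVec_succ, singVec_succ]
    rcases eq_or_ne l m with rfl | hlm
    · have hs : τ.sign K = -σ.sign K := by
        cases σ <;> cases τ <;> simp [PM.sign] at h ⊢
      rw [hs, form2_signedSum_neg ht σ.sign_sq l]
    · rw [form2_signedSum_of_ne _ _ _ (by omega)]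

theorem form2_component (him : im ^ 2 = -1) (ht : Generic t) {i j : PM × ℕ} (h : i ≠ j)
    {u v : Fock2 K N} (hu : u ∈ component N im t i) (hv : v ∈ component N im t j) :
    form2 t u v = 0 := by
  rw [component_eq_fSpan him ht] at hu hv
  exact form2_fSpan_eq_zero (isSingular_singVec ht i) (isSingular_singVec ht j) him ht
    (form2_singVec ht h) hu hv

theorem eq_top_of_singVec_mem [CharZero K] (ht : Generic t) {S : Submodule K (Fock2 K N)}
    (hS : FClosed im t S) (h : ∀ i, singVec N t i ∈ S) : S = ⊤ := by
  have h0 : ∀ ε, signedSum N t ε 0 ∈ S := fun ε => by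
    rw [signedSum_zero ht]; exact h (.plus, 0)
  refine eq_top_of_fClosed ht hS (fun l => ?_) (fun l => ?_) (h (.minus, 0))
  · cases l with
    | zero => exact h0 _
    | succ l => simpa [singVec_succ, PM.sign] using h (.plus, l + 1)
  · cases l with
    | zero => exact h0 _
    | succ l => simpa [singVec_succ, PM.sign] using h (.minus, l + 1)

theorem iSup_component [CharZero K] (him : im ^ 2 = -1) (ht : Generic t) :
    ⨆ i, component N im t i = ⊤ := by
  refine eq_top_of_singVec_mem (im := im) ht (fun r hr v hv => ?_) fun i =>
    Submodule.mem_iSup_of_mem i (singVec_mem him ht i)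
  induction hv using Submodule.iSup_induction' with
  | mem i u hu => exact Submodule.mem_iSup_of_mem i (fClosed_component him ht i r hr u hu)
  | zero => rw [map_zero]; exact Submodule.zero_mem _
  | add u v _ _ hu hv => rw [map_add]; exact Submodule.add_mem _ hu hv

theorem component_induction [CharZero K] (him : im ^ 2 = -1) (ht : Generic t)
    {p : Fock2 K N → Prop} (mem : ∀ i, ∀ v ∈ component N im t i, p v)
    (add : ∀ u v, p u → p v → p (u + v)) (v : Fock2 K N) : p v := by
  have hv : v ∈ ⨆ i, component N im t i := by rw [iSup_component him ht]; trivial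
  exact Submodule.iSup_induction _ (motive := p) hv mem
    (mem (.plus, 0) 0 (Submodule.zero_mem _)) add

theorem isInternal_component [CharZero K] (him : im ^ 2 = -1) (ht : Generic t) :
    DirectSum.IsInternal (component N im t) := by
  rw [DirectSum.isInternal_submodule_iff_iSupIndep_and_iSup_eq_top]
  refine ⟨fun i => ?_, iSup_component him ht⟩
  rw [Submodule.disjoint_def]
  intro u hu hu'
  -- A vector of `component N im t i` that also lies in the sum of the others is orthogonal to every
  -- component: to the i-th by the second membership, to the others by the first.
  refine eq_zero_of_form2 ht (component_induction him ht (fun j v hv => ?_) fun v w h1 h2 => ?_)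
  · rcases eq_or_ne j i with rfl | hj
    · refine Submodule.iSup_induction _ (motive := fun u => form2 t v u = 0) hu' (fun k w hw => ?_)
        (map_zero _) fun a b ha hb => by rw [map_add, ha, hb, add_zero]
      by_cases hk : k = j
      · simp only [hk, ne_eq, not_true_eq_false, iSup_false, Submodule.mem_bot] at hw
        rw [hw, map_zero]
      · simp only [ne_eq, hk, not_false_eq_true, iSup_true] at hw
        exact form2_component him ht (Ne.symm hk) hv hw
    · exact form2_component him ht hj hv hu
  · rw [map_add, LinearMap.add_apply, h1, h2, add_zero]

end Decomposition

end QOsc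

namespace QOsc

/-! ### Transport to the first site: the two parts of e_0 v_l. -/

section Descent

variable {K : Type*} [Field K] {N : ℕ} {im t : K} {S : Submodule K (Fock2 K N)}

attribute [local instance] addCommGroupFock2

/-- The vectors of `V ⊗ V` without particles at the sites `j < i`. -/
noncomputable def emptyBelow (i : Fin (N + 1)) : Submodule K (Fock2 K N) :=
  Submodule.span K {v | ∃ a b : Fin (N + 1) → ℕ, (∀ j < i, a j = 0 ∧ b j = 0) ∧ v = ket2 a b}

theorem eqOn_emptyBelow {i : Fin (N + 1)} {f g : Module.End K (Fock2 K N)}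
    (h : ∀ a b : Fin (N + 1) → ℕ, (∀ j < i, a j = 0 ∧ b j = 0) → f (ket2 a b) = g (ket2 a b))
    {u : Fock2 K N} (hu : u ∈ emptyBelow i) : f u = g u := by
  refine LinearMap.eqOn_span ?_ hu
  rintro _ ⟨a, b, hab, rfl⟩
  exact h a b hab

/-- Both sites involved are empty in u, so the only particle that can move is the one just created,
with coefficient [1] = 1. -/
theorem deltaF_mid_crR (ht : Generic t) {i : Fin (N + 1)} {j : Fin N} (hj : j.succ < i)
    {u : Fock2 K N} (hu : u ∈ emptyBelow i) :
    deltaF N im t 1 1 (.mid j) (crR j.succ u) = crR j.castSucc u := by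
  refine eqOn_emptyBelow (f := deltaF N im t 1 1 (.mid j) * crR j.succ) (fun a b h => ?_) hu
  have h1 := h _ hj
  have h2 := h _ (Fin.castSucc_lt_succ.trans hj)
  rw [Module.End.mul_apply, crR_ket2, deltaF_mid_ket2, crR_ket2, add_right_comm,
    add_tsub_cancel_right]
  simp [h1, h2, site_same, ht.qNum_one]

theorem deltaF_mid_crL (ht : Generic t) {i : Fin (N + 1)} {j : Fin N} (hj : j.succ < i)
    {u : Fock2 K N} (hu : u ∈ emptyBelow i) :
    deltaF N im t 1 1 (.mid j) (crL t j.succ u) = crL t j.castSucc u := by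
  refine eqOn_emptyBelow (f := deltaF N im t 1 1 (.mid j) * crL t j.succ) (fun a b h => ?_) hu
  have h1 := h _ hj
  have h2 := h _ (Fin.castSucc_lt_succ.trans hj)
  rw [Module.End.mul_apply, crL_ket2, map_smul, deltaF_mid_ket2, crL_ket2, add_right_comm,
    add_tsub_cancel_right]
  simp [h1, h2, site_same, ht.qNum_one]

theorem crL_add_crR_castSucc_mem_of_mem (ht : Generic t) (hS : FClosed im t S) {i : Fin (N + 1)}
    {j : Fin N} (hj : j.succ < i) {u v : Fock2 K N} (hu : u ∈ emptyBelow i)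
    (hv : v ∈ emptyBelow i) (h : crL t j.succ u + crR j.succ v ∈ S) :
    crL t j.castSucc u + crR j.castSucc v ∈ S := by
  have := hS (.mid j) (by simp) _ h
  rwa [map_add, deltaF_mid_crL ht hj hu, deltaF_mid_crR ht hj hv] at this

theorem crL_add_crR_zero_mem_of_mem (ht : Generic t) (hS : FClosed im t S) {i k : Fin (N + 1)}
    (hk : k < i) {u v : Fock2 K N} (hu : u ∈ emptyBelow i) (hv : v ∈ emptyBelow i)
    (h : crL t k u + crR k v ∈ S) : crL t 0 u + crR 0 v ∈ S := by
  induction k using Fin.induction with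
  | zero => exact h
  | succ j ih =>
    exact ih (Fin.castSucc_lt_succ.trans hk) (crL_add_crR_castSucc_mem_of_mem ht hS hk hu hv h)

theorem crL_add_crR_castSucc_mem (ht : Generic t) (hS : FClosed im t S) {i : Fin (N + 1)}
    {j : Fin N} (hj : j.succ < i) {u : Fock2 K N} (hu : u ∈ emptyBelow i) {α β : K}
    (h : α • crL t j.succ u + β • crR j.succ u ∈ S) :
    α • crL t j.castSucc u + β • crR j.castSucc u ∈ S := by
  rw [← map_smul, ← map_smul] at h ⊢
  exact crL_add_crR_castSucc_mem_of_mem ht hS hj (Submodule.smul_mem _ _ hu)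
    (Submodule.smul_mem _ _ hu) h

theorem crL_add_crR_zero_mem (ht : Generic t) (hS : FClosed im t S) {i k : Fin (N + 1)}
    (hk : k < i) {u : Fock2 K N} (hu : u ∈ emptyBelow i) {α β : K}
    (h : α • crL t k u + β • crR k u ∈ S) : α • crL t 0 u + β • crR 0 u ∈ S := by
  rw [← map_smul, ← map_smul] at h ⊢
  exact crL_add_crR_zero_mem_of_mem ht hS hk (Submodule.smul_mem _ _ hu)
    (Submodule.smul_mem _ _ hu) h

theorem signedSum_mem_emptyBelow (ε : K) (l : ℕ) :
    signedSum N t ε l ∈ emptyBelow (Fin.last N) := by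
  refine Submodule.sum_mem _ fun x _ => Submodule.smul_mem _ _ (Submodule.subset_span ?_)
  exact ⟨_, _, fun j hj => ⟨site_ne hj.ne _, site_ne hj.ne _⟩, rfl⟩

theorem vMinusZero_mem_emptyBelow (M : ℕ) :
    vMinusZero t (M + 1) ∈ emptyBelow (Fin.last M).castSucc := by
  rw [vMinusZero_succ]
  have h : ∀ a b c d, (topKet M a b c d : Fock2 K (M + 1)) ∈
      emptyBelow (Fin.last M).castSucc := fun a b c d =>
    Submodule.subset_span ⟨_, _, fun j hj => ⟨topPair_of_lt hj _ _, topPair_of_lt hj _ _⟩, rfl⟩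
  exact Submodule.sub_mem _ (h _ _ _ _) (Submodule.smul_mem _ _ (h _ _ _ _))

/-- The part of `e_0 v_l` in the component of `v_{l+1}`. -/
theorem crL_add_crR_zero_signedSum_mem (ht : Generic t) (hS : FClosed im t S) {ε : K}
    (hε : ε ^ 2 = 1) (l : ℕ) (hv : signedSum N t ε (l + 1) ∈ S) :
    ((t ^ 2) ^ l) • crL t 0 (signedSum N t ε l) + ε • crR 0 (signedSum N t ε l) ∈ S := by
  cases N with
  | zero =>
    rw [signedSum_succ ht] at hv
    convert S.smul_mem ε hv using 1
    change (t ^ 2) ^ l • crL t (Fin.last 0) _ + ε • crR (Fin.last 0) _ = _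
    rw [smul_add, smul_smul, ← mul_assoc, ← sq, hε, one_mul]
    exact add_comm _ _
  | succ M =>
    refine crL_add_crR_zero_mem ht hS (Fin.castSucc_lt_last (Fin.last M))
      (signedSum_mem_emptyBelow ε l) ?_
    have := hS (.mid (Fin.last M)) (by simp) _ hv
    rw [deltaF_mid_signedSum ht, Submodule.smul_mem_iff _ (ht.qNum_ne_zero (by omega))] at this
    convert S.smul_mem ε this using 1
    rw [smul_add, smul_smul, ← mul_assoc, ← sq, hε, one_mul]
    exact add_comm _ _

/-- The part of `e_0 v_l` in the component of `v_{l-1}`, `l ≥ 2`. -/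
theorem crL_sub_crR_zero_signedSum_mem (ht : Generic t) (hS : FClosed im t S) {ε : K}
    (hε : ε ^ 2 = 1) (l : ℕ) (hv : signedSum N t ε (l + 1) ∈ S) :
    crL t 0 (signedSum N t ε (l + 2)) -
      (ε * (t ^ 2) ^ (l + 2)) • crR 0 (signedSum N t ε (l + 2)) ∈ S := by
  cases N with
  | zero =>
    have := S.smul_mem (ε * (t ^ 2) ^ (l + 1)) (hS .last (by simp) _ hv)
    rw [← deltaF_last_signedSum ht im ε hε] at this
    exact this
  | succ M =>
    have := crL_add_crR_zero_mem ht hS (α := 1) (β := -(ε * (t ^ 2) ^ (l + 2)))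
      (Fin.castSucc_lt_last (Fin.last M)) (signedSum_mem_emptyBelow ε (l + 2)) (by
        rw [one_smul, neg_smul, ← sub_eq_add_neg]
        exact crL_sub_crR_signedSum_mem ht hε hS l hv)
    rwa [one_smul, neg_smul, ← sub_eq_add_neg] at this

theorem topKet_zero (M : ℕ) : (topKet M 0 0 0 0 : Fock2 K (M + 1)) = ket2 0 0 := by
  simp [topKet, topPair, site_zero]

/-- The part of `e_0 v_1` in `V_0^+ ⊕ V_0^-`. -/
theorem crL_sub_crR_zero_signedSum_one_mem (ht : Generic t) (hS : FClosed im t S) {ε : K}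
    (hε : ε ^ 2 = 1) (hv : ket2 0 0 ∈ S) (hv' : vMinusZero t N ∈ S) :
    crL t 0 (signedSum N t ε 1) - (ε * t ^ 2) • crR 0 (signedSum N t ε 1) ∈ S := by
  cases N with
  | zero =>
    have := S.smul_mem (ε * (t ^ 2) ^ 0) (hS .last (by simp) _ hv)
    rw [← signedSum_zero ht ε, ← deltaF_last_signedSum ht im ε hε] at this
    simpa using this
  | succ M =>
    have := crL_add_crR_zero_mem ht hS (α := 1) (β := -(ε * t ^ 2))
      (Fin.castSucc_lt_last (Fin.last M)) (signedSum_mem_emptyBelow ε 1) (by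
        rw [one_smul, neg_smul, ← sub_eq_add_neg, crL_sub_crR_signedSum_one ht im hε]
        refine S.add_mem hv' (S.smul_mem _ (hS _ (by simp) _ (hS _ (by simp) _ ?_)))
        rwa [topKet_zero])
    rwa [one_smul, neg_smul, ← sub_eq_add_neg] at this

end Descent

/-! ### The image of v_0^- under e_0. -/

section VMinusZero

variable {K : Type*} [Field K] {M : ℕ} {im t : K}

attribute [local instance] addCommGroupFock2

theorem signedSum_one_eq (ht : Generic t) (ε : K) : signedSum (M + 1) t ε 1 =
    topKet M 0 0 0 1 + ε • topKet M 0 1 0 0 := by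
  simp [signedSum, Finset.Nat.sum_antidiagonal_succ, ht.cf_zero_left, ht.cf_zero_right,
    lastKet_eq_topKet]

theorem signedSum_two_eq (ht : Generic t) {ε : K} (hε : ε ^ 2 = 1) : signedSum (M + 1) t ε 2 =
    topKet M 0 0 0 2 + (ε * (t ^ 2 * qNum (t ^ 2) 2)) • topKet M 0 1 0 1 +
      t ^ 2 • topKet M 0 2 0 0 := by
  have h := ht.cf_succ_left 0 1
  simp only [Nat.cast_zero, zero_add, ht.qNum_one, ht.cf_zero_left, mul_one, pow_one,
    Nat.cast_one] at h
  simp [signedSum, Finset.Nat.sum_antidiagonal_succ, ht.cf_zero_left, ht.cf_zero_right,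
    lastKet_eq_topKet, hε, h, add_assoc]

/-- The right side has the same weight and lies in the module of the degree 1 vector: its first part
by `crL_sub_crR_signedSum_mem`, its second as a word in the f_r. -/
theorem crL_add_crR_vMinusZero_castSucc (ht : Generic t) {ε : K} (hε : ε ^ 2 = 1) :
    crL t (Fin.last M).castSucc (vMinusZero t (M + 1)) +
        ε • crR (Fin.last M).castSucc (vMinusZero t (M + 1)) =
      (ε * (t ^ 2)⁻¹ * (qNum (t ^ 2) 2)⁻¹) • (deltaF (M + 1) im t 1 1 (.mid (Fin.last M))
        (crL t (Fin.last M).castSucc (signedSum (M + 1) t ε 2) -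
          (ε * (t ^ 2) ^ 2) • crR (Fin.last M).castSucc (signedSum (M + 1) t ε 2)) -
        (ε * t ^ 2) • deltaF (M + 1) im t 1 1 (.mid (Fin.last M))
          (deltaF (M + 1) im t 1 1 .last (deltaF (M + 1) im t 1 1 (.mid (Fin.last M))
            (signedSum (M + 1) t ε 1)))) := by
  have h0 := ht.ne_zero
  have h2 := ht.qNum_ne_zero (m := 2) (by norm_num)
  rw [vMinusZero_succ, signedSum_one_eq ht, signedSum_two_eq ht hε]
  simp only [map_add, map_sub, map_smul, crR_topKet, crL_topKet, deltaF_last_topKet,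
    deltaF_mid_topKet]
  simp only [Nat.cast_zero, qNum_zero, mul_zero, zero_smul, zero_add, pow_zero, one_smul,
    Nat.cast_ofNat, pow_one, sub_zero, zpow_zero, one_mul, add_zero, Nat.cast_one, ht.qNum_one,
    Nat.reduceAdd, Nat.reduceSub, mul_one, zero_sub, sub_self]
  match_scalars <;> (try simp only [zpow_neg, zpow_ofNat]) <;> field_simp
  all_goals first
    | ring1
    | linear_combination -hε
    | linear_combination t ^ 4 * hε
    | linear_combination ε * hε


/-- The occupation numbers `a`, `b`, `c` at the sites `n - 2`, `n - 1`, `n`, for `n = M + 3`. -/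
def topTriple (M a b c : ℕ) : Fin (M + 3) → ℕ :=
  site (Fin.last M).castSucc.castSucc a + site (Fin.last (M + 1)).castSucc b +
    site (Fin.last (M + 2)) c

/-- The product of two basis vectors that live on the last three sites. -/
noncomputable def tripleKet (M a b c a' b' c' : ℕ) : Fock2 K (M + 2) :=
  ket2 (topTriple M a b c) (topTriple M a' b' c')

theorem topTriple_add (a b c a' b' c' : ℕ) : topTriple M a b c + topTriple M a' b' c' =
    topTriple M (a + a') (b + b') (c + c') := by
  simp only [topTriple, ← site_add]
  abel

theorem topTriple_apply (a b c : ℕ) (i : Fin (M + 3)) : topTriple M a b c i =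
    if i = (Fin.last M).castSucc.castSucc then a else if i = (Fin.last (M + 1)).castSucc then b
      else if i = Fin.last (M + 2) then c else 0 := by
  have h1 : (Fin.last M).castSucc.castSucc ≠ (Fin.last (M + 1)).castSucc := by
    simp [Fin.ext_iff]
  have h2 : (Fin.last M).castSucc.castSucc ≠ Fin.last (M + 2) := (Fin.castSucc_lt_last _).ne
  have h3 : (Fin.last (M + 1)).castSucc ≠ Fin.last (M + 2) := (Fin.castSucc_lt_last _).ne
  simp only [topTriple, Pi.add_apply, site, Pi.single_apply]
  split_ifs <;> subst_vars <;> simp_all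

theorem topTriple_sub (a b c a' b' c' : ℕ) : topTriple M a b c - topTriple M a' b' c' =
    topTriple M (a - a') (b - b') (c - c') := by
  ext i
  simp only [Pi.sub_apply, topTriple_apply]
  split_ifs <;> rfl

theorem topTriple_fst (a b c : ℕ) : topTriple M a b c (Fin.last M).castSucc.castSucc = a := by
  rw [topTriple_apply, if_pos rfl]

theorem topTriple_snd (a b c : ℕ) : topTriple M a b c (Fin.last (M + 1)).castSucc = b := by
  rw [topTriple_apply, if_neg (by simp [Fin.ext_iff]), if_pos rfl]

theorem topTriple_trd (a b c : ℕ) : topTriple M a b c (Fin.last (M + 2)) = c := by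
  rw [topTriple_apply, if_neg (Fin.castSucc_lt_last _).ne', if_neg (Fin.castSucc_lt_last _).ne',
    if_pos rfl]

theorem site_fst (a : ℕ) : site (Fin.last M).castSucc.castSucc a = topTriple M a 0 0 := by
  simp [topTriple, site_zero]

theorem site_snd (a : ℕ) : site (Fin.last (M + 1)).castSucc a = topTriple M 0 a 0 := by
  simp [topTriple, site_zero]

theorem site_trd (a : ℕ) : site (Fin.last (M + 2)) a = topTriple M 0 0 a := by
  simp [topTriple, site_zero]

theorem topKet_eq_tripleKet (a b a' b' : ℕ) : (topKet (M + 1) a b a' b' : Fock2 K (M + 2)) =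
    tripleKet M 0 a b 0 a' b' := by
  simp only [topKet, topPair, site_snd, site_trd, topTriple_add, tripleKet, zero_add, add_zero]

theorem deltaF_fst_tripleKet (im t : K) (a b c a' b' c' : ℕ) :
    deltaF (M + 2) im t 1 1 (.mid (Fin.last M).castSucc) (tripleKet M a b c a' b' c') =
      qNum (t ^ 2) b • tripleKet M (a + 1) (b - 1) c a' b' c' +
      ((t ^ 2) ^ ((a : ℤ) - b) * qNum (t ^ 2) b') •
        tripleKet M a b c (a' + 1) (b' - 1) c' := by
  have h : (Fin.last M).castSucc.succ = (Fin.last (M + 1)).castSucc := rfl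
  simp only [tripleKet, deltaF_mid_ket2, h, topTriple_fst, topTriple_snd, site_fst, site_snd,
    topTriple_add, topTriple_sub, add_zero, Nat.sub_zero]

theorem deltaF_snd_tripleKet (im t : K) (a b c a' b' c' : ℕ) :
    deltaF (M + 2) im t 1 1 (.mid (Fin.last (M + 1))) (tripleKet M a b c a' b' c') =
      qNum (t ^ 2) c • tripleKet M a (b + 1) (c - 1) a' b' c' +
      ((t ^ 2) ^ ((b : ℤ) - c) * qNum (t ^ 2) c') •
        tripleKet M a b c a' (b' + 1) (c' - 1) := by
  have h : (Fin.last (M + 1)).succ = Fin.last (M + 2) := rfl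
  simp only [tripleKet, deltaF_mid_ket2, h, topTriple_snd, topTriple_trd, site_snd, site_trd,
    topTriple_add, topTriple_sub, add_zero, Nat.sub_zero]

theorem deltaF_last_tripleKet (im t : K) (a b c a' b' c' : ℕ) :
    deltaF (M + 2) im t 1 1 .last (tripleKet M a b c a' b' c') =
      tripleKet M a b (c + 2) a' b' c' -
        (t ^ 2) ^ (2 * c + 1) • tripleKet M a b c a' b' (c' + 2) := by
  simp only [tripleKet, deltaF_last_ket2, topTriple_trd, site_trd, topTriple_add, add_zero]

theorem crR_fst_tripleKet (a b c a' b' c' : ℕ) :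
    crR (Fin.last M).castSucc.castSucc (tripleKet M a b c a' b' c' : Fock2 K (M + 2)) =
      tripleKet M a b c (a' + 1) b' c' := by
  simp [tripleKet, site_fst, topTriple_add]

theorem crR_snd_tripleKet (a b c a' b' c' : ℕ) :
    crR (Fin.last (M + 1)).castSucc (tripleKet M a b c a' b' c' : Fock2 K (M + 2)) =
      tripleKet M a b c a' (b' + 1) c' := by
  simp [tripleKet, site_snd, topTriple_add]

theorem crL_fst_tripleKet (t : K) (a b c a' b' c' : ℕ) :
    crL t (Fin.last M).castSucc.castSucc (tripleKet M a b c a' b' c' : Fock2 K (M + 2)) =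
      (t ^ 2) ^ a' • tripleKet M (a + 1) b c a' b' c' := by
  simp [tripleKet, site_fst, topTriple_add, topTriple_fst]

theorem crL_snd_tripleKet (t : K) (a b c a' b' c' : ℕ) :
    crL t (Fin.last (M + 1)).castSucc (tripleKet M a b c a' b' c' : Fock2 K (M + 2)) =
      (t ^ 2) ^ b' • tripleKet M a (b + 1) c a' b' c' := by
  simp [tripleKet, site_snd, topTriple_add, topTriple_snd]

/-- Since v_0^- occupies site n - 1, f_{n-2} does more than move the created particle from there to
site n - 2. The last two terms correct this; from site n - 2 downwards the plain descent applies. -/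
theorem crL_add_crR_vMinusZero_fst (ht : Generic t) {ε : K} (hε : ε ^ 2 = 1) :
    qNum (t ^ 2) 3 • (crL t (Fin.last M).castSucc.castSucc (vMinusZero t (M + 2)) +
        ε • crR (Fin.last M).castSucc.castSucc (vMinusZero t (M + 2))) =
      qNum (t ^ 2) 2 • deltaF (M + 2) im t 1 1 (.mid (Fin.last M).castSucc)
        (crL t (Fin.last (M + 1)).castSucc (vMinusZero t (M + 2)) +
          ε • crR (Fin.last (M + 1)).castSucc (vMinusZero t (M + 2))) -
      (ε * (t ^ 2)⁻¹ * (qNum (t ^ 2) 2)⁻¹) • deltaF (M + 2) im t 1 1 (.mid (Fin.last (M + 1)))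
        (crL t (Fin.last M).castSucc.castSucc (signedSum (M + 2) t ε 2) -
          (ε * (t ^ 2) ^ 2) • crR (Fin.last M).castSucc.castSucc (signedSum (M + 2) t ε 2)) +
      (ε * (qNum (t ^ 2) 2)⁻¹) • deltaF (M + 2) im t 1 1 (.mid (Fin.last (M + 1)))
        (deltaF (M + 2) im t 1 1 .last
          (crL t (Fin.last M).castSucc.castSucc (signedSum (M + 2) t ε 0) +
            ε • crR (Fin.last M).castSucc.castSucc (signedSum (M + 2) t ε 0))) := by
  have h0 := ht.ne_zero
  have h2 := ht.qNum_ne_zero (m := 2) (by norm_num)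
  have h4 : qNum (t ^ 2) 2 * t ^ 2 = t ^ 4 + 1 := by
    rw [ht.qNum_two]; field_simp
  have h3 : qNum (t ^ 2) 3 = qNum (t ^ 2) 2 ^ 2 - 1 := by
    have h := qNum_three_mul ht 0
    have h1 : qNum (t ^ 2) (0 - 1) = -1 := by
      have := ht.qNum_one
      rw [qNum, zero_sub, neg_neg, ← neg_sub, neg_div]
      exact congrArg _ this
    rw [h1, zero_add, zero_add, ht.qNum_one] at h
    linear_combination h
  rw [vMinusZero_succ, signedSum_zero ht, signedSum_two_eq ht hε, ← topKet_zero]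
  simp only [topKet_eq_tripleKet, map_add, map_sub, map_smul, crR_fst_tripleKet, crL_fst_tripleKet,
    crR_snd_tripleKet, crL_snd_tripleKet, deltaF_last_tripleKet, deltaF_fst_tripleKet,
    deltaF_snd_tripleKet]
  simp only [Nat.cast_zero, qNum_zero, mul_zero, zero_smul, zero_add, pow_zero, one_smul,
    Nat.cast_ofNat, pow_one, zpow_zero, one_mul, add_zero, Nat.cast_one, ht.qNum_one,
    Nat.reduceAdd, Nat.reduceSub, mul_one, zero_sub, sub_self]
  match_scalars <;> (try simp only [zpow_neg, zpow_ofNat]) <;> field_simp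
  · linear_combination h3 + hε
  · linear_combination -t ^ 4 * h3 - (t ^ 2 * qNum (t ^ 2) 2 + 1) * h4 + hε
  · linear_combination ε * t ^ 2 * h3 + ε * (qNum (t ^ 2) 2 + t ^ 2) * h4 - ε * t ^ 6 * hε
  · linear_combination -ε * h3 - ε * hε
  · linear_combination h4 - (t ^ 4 + 1) * hε
  · linear_combination -ε * h4
  · ring
  · ring

/-- The vector `e_0 v_0^-` lies in the sum of the components of `v_1^+ ± v_1^-`. -/
theorem crL_add_crR_zero_vMinusZero_mem {N : ℕ} {S : Submodule K (Fock2 K N)} (ht : Generic t)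
    (hS : FClosed im t S) {ε : K} (hε : ε ^ 2 = 1) (hv : signedSum N t ε 1 ∈ S) :
    crL t 0 (vMinusZero t N) + ε • crR 0 (vMinusZero t N) ∈ S := by
  cases N with
  | zero =>
    rw [vMinusZero, map_zero, map_zero, smul_zero, add_zero]
    exact S.zero_mem
  | succ M =>
    have h2 := crL_sub_crR_signedSum_mem ht hε hS 0 hv
    have h1 : crL t (Fin.last M).castSucc (vMinusZero t (M + 1)) +
        ε • crR (Fin.last M).castSucc (vMinusZero t (M + 1)) ∈ S := by
      rw [crL_add_crR_vMinusZero_castSucc (im := im) ht hε]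
      exact S.smul_mem _ (S.sub_mem (hS _ (by simp) _ h2) (S.smul_mem _ (hS _ (by simp) _
        (hS _ (by simp) _ (hS _ (by simp) _ hv)))))
    cases M with
    | zero => exact h1
    | succ M =>
      have h3 : crL t (Fin.last M).castSucc.castSucc (signedSum (M + 2) t ε 2) -
          (ε * (t ^ 2) ^ 2) • crR (Fin.last M).castSucc.castSucc (signedSum (M + 2) t ε 2) ∈ S := by
        have := crL_add_crR_castSucc_mem ht hS (j := (Fin.last M).castSucc) (α := 1)
          (β := -(ε * (t ^ 2) ^ 2)) (Fin.castSucc_lt_last (Fin.last (M + 1)))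
          (signedSum_mem_emptyBelow ε 2) (by
            rw [one_smul, neg_smul, ← sub_eq_add_neg]
            exact h2)
        rwa [one_smul, neg_smul, ← sub_eq_add_neg] at this
      have h4 : crL t (Fin.last M).castSucc.castSucc (signedSum (M + 2) t ε 0) +
          ε • crR (Fin.last M).castSucc.castSucc (signedSum (M + 2) t ε 0) ∈ S := by
        have h5 : crL t (Fin.last (M + 1)).castSucc (signedSum (M + 2) t ε 0) +
            ε • crR (Fin.last (M + 1)).castSucc (signedSum (M + 2) t ε 0) ∈ S := by
          have := hS (.mid (Fin.last (M + 1))) (by simp) _ hv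
          rw [deltaF_mid_signedSum ht, Submodule.smul_mem_iff _ (ht.qNum_ne_zero (by omega)),
            pow_zero, mul_one] at this
          convert S.smul_mem ε this using 1
          rw [smul_add, smul_smul, ← sq, hε, one_smul]
          exact add_comm _ _
        have := crL_add_crR_castSucc_mem ht hS (j := (Fin.last M).castSucc) (α := 1)
          (β := ε) (Fin.castSucc_lt_last (Fin.last (M + 1)))
          (signedSum_mem_emptyBelow ε 0) (by
            rw [one_smul]
            exact h5)
        rwa [one_smul] at this
      have h6 : crL t (Fin.last M).castSucc.castSucc (vMinusZero t (M + 2)) +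
          ε • crR (Fin.last M).castSucc.castSucc (vMinusZero t (M + 2)) ∈ S := by
        rw [← Submodule.smul_mem_iff _ (ht.qNum_ne_zero (m := 3) (by norm_num)),
          crL_add_crR_vMinusZero_fst (im := im) ht hε]
        exact S.add_mem (S.sub_mem (S.smul_mem _ (hS _ (by simp) _ h1))
          (S.smul_mem _ (hS _ (by simp) _ h3)))
          (S.smul_mem _ (hS _ (by simp) _ (hS _ (by simp) _ h4)))
      have := crL_add_crR_zero_mem ht hS (α := 1) (β := ε)
        (k := (Fin.last M).castSucc.castSucc) (i := (Fin.last (M + 1)).castSucc)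
        (by simp [Fin.lt_def]) (vMinusZero_mem_emptyBelow (M + 1)) (by rwa [one_smul])
      rwa [one_smul] at this

end VMinusZero

end QOsc

namespace QOsc

/-! ### Projectors and operators that are scalar on each summand. -/

section Projectors

variable {K M ι : Type*} [Field K] [AddCommGroup M] [Module K M] [DecidableEq ι]
  {W : ι → Submodule K M}

theorem projector_apply_self (h : DirectSum.IsInternal W) {i : ι} {v : M} (hv : v ∈ W i) :
    projector W i v = v := by
  have h' : Function.Bijective (DirectSum.coeLinearMap W) := h
  have hs : (LinearEquiv.ofBijective (DirectSum.coeLinearMap W) h').symm v =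
      DirectSum.lof K ι (fun j => W j) i ⟨v, hv⟩ := by
    rw [LinearEquiv.symm_apply_eq, LinearEquiv.ofBijective_apply, DirectSum.coeLinearMap_lof]
  rw [projector, dif_pos h', LinearMap.comp_apply, LinearMap.comp_apply, LinearEquiv.coe_coe, hs,
    DirectSum.component.lof_self]
  rfl

theorem projector_apply_of_ne (h : DirectSum.IsInternal W) {i j : ι} (hij : j ≠ i) {v : M}
    (hv : v ∈ W j) : projector W i v = 0 := by
  have h' : Function.Bijective (DirectSum.coeLinearMap W) := h
  have hs : (LinearEquiv.ofBijective (DirectSum.coeLinearMap W) h').symm v =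
      DirectSum.lof K ι (fun j => W j) j ⟨v, hv⟩ := by
    rw [LinearEquiv.symm_apply_eq, LinearEquiv.ofBijective_apply, DirectSum.coeLinearMap_lof]
  rw [projector, dif_pos h', LinearMap.comp_apply, LinearMap.comp_apply, LinearEquiv.coe_coe, hs,
    DirectSum.component.of, dif_neg hij, map_zero]

theorem exists_end_eq_smul (h : DirectSum.IsInternal W) (c : ι → K) :
    ∃ T : Module.End K M, ∀ i, ∀ v ∈ W i, T v = c i • v := by
  have h' : Function.Bijective (DirectSum.coeLinearMap W) := h
  refine ⟨DirectSum.toModule K ι M (fun i => c i • (W i).subtype) ∘ₗ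
    (LinearEquiv.ofBijective (DirectSum.coeLinearMap W) h').symm.toLinearMap, fun i v hv => ?_⟩
  have hs : (LinearEquiv.ofBijective (DirectSum.coeLinearMap W) h').symm v =
      DirectSum.lof K ι (fun j => W j) i ⟨v, hv⟩ := by
    rw [LinearEquiv.symm_apply_eq, LinearEquiv.ofBijective_apply, DirectSum.coeLinearMap_lof]
  rw [LinearMap.comp_apply, LinearEquiv.coe_coe, hs, DirectSum.toModule_lof]
  rfl

end Projectors

/-! ### The scalar recursions for the eigenvalues. -/

section Eigenvalues

variable {K : Type*} [Field K] {im t x y z : K}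

/-- The eigenvalue of `P R(z)` on a component. -/
noncomputable def rho (im t z : K) (i : PM × ℕ) : K :=
  ∏ j ∈ Finset.Icc 1 i.2, (z - i.1.sign K * (im * qHalf t j)) /
    (1 - i.1.sign K * (im * qHalf t j * z))

/-- The denominators of `R(z)` do not vanish. -/
def Regular (im t z : K) : Prop :=
  ∀ (σ : PM) (j : ℕ), 1 - σ.sign K * (im * qHalf t (j + 1) * z) ≠ 0

theorem qHalf_succ (t : K) (l : ℕ) : qHalf t (l + 1) = t * (t ^ 2) ^ l := by
  rw [qHalf, ← pow_mul, ← pow_succ', ← zpow_natCast]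
  congr 1
  push_cast
  ring

theorem rho_zero (σ : PM) : rho im t z (σ, 0) = 1 := by simp [rho]

theorem Regular.add_ne_zero (hz : Regular im t z) (hy : y ≠ 0) (hx : x = z * y)
    (σ : PM) (l : ℕ) : y + σ.sign K * (-im * t) * (t ^ 2) ^ l * x ≠ 0 := by
  have := mul_ne_zero hy (hz σ l)
  rw [qHalf_succ t] at this
  rw [hx]
  convert this using 1
  ring

/-- The last factor of the product with denominators cleared; this is what e_0 requires between
degrees l and l + 1. -/
theorem rho_succ_mul (hz : Regular im t z) (hx : x = z * y)
    (σ : PM) (l : ℕ) : rho im t z (σ, l + 1) * (y + σ.sign K * (-im * t) * (t ^ 2) ^ l * x) =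
      rho im t z (σ, l) * (x + σ.sign K * (-im * t) * (t ^ 2) ^ l * y) := by
  have h := hz σ l
  rw [rho, rho, Finset.prod_Icc_succ_top (by omega)]
  rw [qHalf_succ t] at h ⊢
  simp only
  generalize ∏ j ∈ Finset.Icc 1 l, (z - σ.sign K * (im * qHalf t j)) /
    (1 - σ.sign K * (im * qHalf t j * z)) = P
  have h1 : y + σ.sign K * (-im * t) * (t ^ 2) ^ l * x =
      y * (1 - σ.sign K * (im * (t * (t ^ 2) ^ l) * z)) := by rw [hx]; ring
  rw [h1]
  generalize 1 - σ.sign K * (im * (t * (t ^ 2) ^ l) * z) = D at *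
  field_simp
  rw [hx]
  ring

/-- What e_0 requires in the downward direction. It follows from `rho_succ_mul` by cross
multiplication, and im² = -1 is what makes the two conditions agree. -/
theorem rho_mul_down (hz : Regular im t z) (him : im ^ 2 = -1) (hy : y ≠ 0)
    (hx : x = z * y) (σ : PM) (l : ℕ) :
    rho im t z (σ, l) * (x * (-im * t) - σ.sign K * (t ^ 2) ^ (l + 1) * y) =
      rho im t z (σ, l + 1) * (y * (-im * t) - σ.sign K * (t ^ 2) ^ (l + 1) * x) := by
  have h1 := rho_succ_mul hz hx σ l
  have h2 := σ.sign_sq (K := K)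
  refine mul_right_cancel₀ (hz.add_ne_zero hy hx σ l) ?_
  rw [mul_right_comm (rho im t z (σ, l + 1)), h1]
  have h3 : ∀ s u : K, s ^ 2 = 1 → (x * (-im * t) - s * (t ^ 2 * u) * y) *
      (y + s * (-im * t) * u * x) = (x + s * (-im * t) * u * y) *
      (y * (-im * t) - s * (t ^ 2 * u) * x) := by
    intro s u hs
    linear_combination (s * u * x ^ 2 * t ^ 2 - s * u * y ^ 2 * t ^ 2) * him
  have := h3 (σ.sign K) ((t ^ 2) ^ l) h2
  rw [pow_succ' (t ^ 2) l]
  linear_combination rho im t z (σ, l) * this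

end Eigenvalues

/-! ### The operator with eigenvalues `rho` intertwines all generators. -/

section Intertwiner

variable {K : Type*} [Field K] {N : ℕ} {im t x y z : K} {T : Module.End K (Fock2 K N)}

attribute [local instance] addCommGroupFock2

/-- The operator `T` acts on every component of `V ⊗ V` as `P R(z)`. -/
def ActsByRho (im t z : K) (T : Module.End K (Fock2 K N)) : Prop :=
  ∀ i, ∀ v ∈ component N im t i, T v = rho im t z i • v

theorem ActsByRho.apply_ket2_zero (hT : ActsByRho im t z T) (him : im ^ 2 = -1) (ht : Generic t) :
    T (ket2 0 0) = ket2 0 0 := by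
  have := hT (.plus, 0) _ (singVec_mem him ht _)
  rwa [rho_zero, one_smul] at this

variable [CharZero K]

theorem ActsByRho.comm_of_mapsTo (hT : ActsByRho im t z T) (him : im ^ 2 = -1) (ht : Generic t)
    {g : Module.End K (Fock2 K N)}
    (hg : ∀ i, ∀ v ∈ component N im t i, g v ∈ component N im t i) : g * T = T * g := by
  refine LinearMap.ext (component_induction him ht (fun i v hv => ?_) fun u v hu hv => ?_)
  · rw [Module.End.mul_apply, Module.End.mul_apply, hT i v hv, hT i _ (hg i v hv), map_smul]
  · rw [map_add, map_add, hu, hv]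

theorem ActsByRho.comm_deltaK (hT : ActsByRho im t z T) (him : im ^ 2 = -1) (ht : Generic t)
    (r : Vertex N) : deltaK N im t r * T = T * deltaK N im t r :=
  hT.comm_of_mapsTo him ht fun i _ hv => deltaK_component_mem him ht i r hv

theorem ActsByRho.comm_deltaKInv (hT : ActsByRho im t z T) (him : im ^ 2 = -1) (ht : Generic t)
    (r : Vertex N) : deltaKInv N im t r * T = T * deltaKInv N im t r := by
  refine hT.comm_of_mapsTo him ht fun i v hv => ?_
  rw [component_eq_fSpan him ht] at hv ⊢
  exact fSpan_le_comap_inv (isSingular_singVec ht i) him ht r hv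

theorem ActsByRho.comm_deltaF_of_ne (hT : ActsByRho im t z T) (him : im ^ 2 = -1) (ht : Generic t)
    {r : Vertex N} (hr : r ≠ .zero) : deltaF N im t 1 1 r * T = T * deltaF N im t 1 1 r :=
  hT.comm_of_mapsTo him ht fun i v hv => fClosed_component him ht i r hr v hv

theorem ActsByRho.comm_deltaE_of_ne (hT : ActsByRho im t z T) (him : im ^ 2 = -1) (ht : Generic t)
    {r : Vertex N} (hr : r ≠ .zero) : deltaE N im t 1 1 r * T = T * deltaE N im t 1 1 r :=
  hT.comm_of_mapsTo him ht fun i v hv => (isInvariantC_component him ht i r hr v hv).1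

/-- Up to sign, the determinant of the change from A v, B v to the two vectors that lie in
components. -/
theorem one_add_sq_pow_ne_zero (ht : Generic t) (l : ℕ) : 1 + ((t ^ 2) ^ l) ^ 2 ≠ 0 := by
  intro h
  rcases Nat.eq_zero_or_pos l with rfl | hl
  · norm_num at h
  · apply ht.pow_ne_one (8 * l) (by omega)
    have : t ^ (8 * l) = (((t ^ 2) ^ l) ^ 2) ^ 2 := by
      rw [← pow_mul, ← pow_mul, ← pow_mul]; congr 1; ring
    rw [this]
    linear_combination (((t ^ 2) ^ l) ^ 2 - 1) * h

theorem ActsByRho.deltaE_zero_apply_of_signedSum (hT : ActsByRho im t z T) (hz : Regular im t z)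
    (him : im ^ 2 = -1) (ht : Generic t) (hy : y ≠ 0) (hx : x = z * y) (σ : PM) (l : ℕ) :
    deltaE N im t y x .zero (T (signedSum N t (σ.sign K) (l + 1))) =
      T (deltaE N im t x y .zero (signedSum N t (σ.sign K) (l + 1))) := by
  have hs := σ.sign_sq (K := K)
  have hm : ∀ k, signedSum N t (σ.sign K) (k + 1) ∈ component N im t (σ, k + 1) := fun k => by
    rw [← singVec_succ]; exact singVec_mem him ht _
  have e0 := hT (σ, l + 1) _ (hm l)
  have e1 := hT (σ, l + 2) _ (crL_add_crR_zero_signedSum_mem ht (fClosed_component him ht _) hs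
    (l + 1) (hm (l + 1)))
  have e2 : T (crL t 0 (signedSum N t (σ.sign K) (l + 1)) -
      (σ.sign K * (t ^ 2) ^ (l + 1)) • crR 0 (signedSum N t (σ.sign K) (l + 1))) =
      rho im t z (σ, l) • (crL t 0 (signedSum N t (σ.sign K) (l + 1)) -
      (σ.sign K * (t ^ 2) ^ (l + 1)) • crR 0 (signedSum N t (σ.sign K) (l + 1))) := by
    cases l with
    | zero =>
      -- In degree 1 the lower part is spread over V_0^+ and V_0^-; this is harmless as both
      -- eigenvalues are 1.
      have : crL t 0 (signedSum N t (σ.sign K) (0 + 1)) -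
          (σ.sign K * (t ^ 2) ^ (0 + 1)) • crR 0 (signedSum N t (σ.sign K) (0 + 1)) ∈
          component N im t (.plus, 0) ⊔ component N im t (.minus, 0) := by
        rw [zero_add, pow_one]
        refine crL_sub_crR_zero_signedSum_one_mem (im := im) ht (fun r hr v hv => ?_) hs
          (Submodule.mem_sup_left (singVec_mem him ht (.plus, 0)))
          (Submodule.mem_sup_right (singVec_mem him ht (.minus, 0)))
        obtain ⟨a, ha, b, hb, rfl⟩ := Submodule.mem_sup.1 hv
        rw [map_add]
        exact Submodule.add_mem_sup (fClosed_component him ht _ r hr a ha)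
          (fClosed_component him ht _ r hr b hb)
      obtain ⟨a, ha, b, hb, hab⟩ := Submodule.mem_sup.1 this
      rw [← hab, map_add, hT _ a ha, hT _ b hb, rho_zero, rho_zero, rho_zero, one_smul, one_smul,
        one_smul]
    | succ l =>
      exact hT (σ, l + 1) _ (crL_sub_crR_zero_signedSum_mem ht (fClosed_component him ht _) hs l
        (hm l))
  have r1 := rho_succ_mul hz hx σ (l + 1)
  have r2 := rho_mul_down hz him hy hx σ l
  have hc := one_add_sq_pow_ne_zero ht (l + 1)
  rw [e0, map_smul, deltaE_zero ht, deltaE_zero ht]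
  simp only [LinearMap.add_apply, LinearMap.smul_apply, map_add, map_sub, map_smul] at e1 e2 ⊢
  generalize crL t 0 (signedSum N t (σ.sign K) (l + 1)) = b at *
  generalize crR 0 (signedSum N t (σ.sign K) (l + 1)) = a at *
  generalize rho im t z (σ, l + 1 + 1) = ρ₁ at *
  generalize rho im t z (σ, l + 1) = ρ at *
  generalize rho im t z (σ, l) = ρ₀ at *
  generalize (t ^ 2) ^ (l + 1) = q at *
  generalize σ.sign K = s at *
  -- With `hB`, expresses T A v and T B v through the two vectors on which T is a scalar; `r1` and
  -- `r2` then match the coefficients.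
  have hA : (1 + q ^ 2) • T a = s • (q • T b + s • T a) - (s * q) • (T b - (s * q) • T a) := by
    match_scalars
    · linear_combination -(1 + q ^ 2) * hs
    · ring
  have hB : (1 + q ^ 2) • T b = q • (q • T b + s • T a) + (T b - (s * q) • T a) := by
    module
  rw [e1, e2] at hA hB
  apply smul_right_injective _ hc
  simp only [smul_add, smul_comm (1 + q ^ 2) _ (T _), hA, hB]
  match_scalars
  · linear_combination -r1 + q * s * r2 + (-q ^ 2 * ρ * x - y * ρ₁) * hs
  · linear_combination -(q * s) * r1 - r2 +
      (q ^ 2 * (-im * t) * x * ρ₁ - ρ * q ^ 2 * (-im * t) * y) * hs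

/-- A vector `u` on which `e_0` is given by vectors of the components of `v_1^+ ± v_1^-`. -/
theorem ActsByRho.deltaE_zero_apply_of_mem (hT : ActsByRho im t z T) (hz : Regular im t z)
    (ht : Generic t) (hx : x = z * y) {u : Fock2 K N} (hu : T u = u)
    (h : ∀ σ : PM, crL t 0 u + σ.sign K • crR 0 u ∈ component N im t (σ, 1)) :
    deltaE N im t y x .zero (T u) = T (deltaE N im t x y .zero u) := by
  have e1 := hT _ _ (h .plus)
  have e2 := hT _ _ (h .minus)
  have r1 := rho_succ_mul hz hx .plus 0
  have r2 := rho_succ_mul hz hx .minus 0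
  rw [rho_zero] at r1 r2
  rw [hu, deltaE_zero ht, deltaE_zero ht]
  simp only [PM.sign, LinearMap.add_apply, LinearMap.smul_apply, map_add, map_smul, zero_add,
    pow_zero, mul_one, one_mul, one_smul, neg_smul, ← sub_eq_add_neg, map_sub] at e1 e2 r1 r2 ⊢
  generalize crL t 0 u = b at *
  generalize crR 0 u = a at *
  generalize rho im t z (.plus, 1) = ρ₁ at *
  generalize rho im t z (.minus, 1) = ρ₂ at *
  have hA : (2 : K) • T a = (T b + T a) - (T b - T a) := by module
  have hB : (2 : K) • T b = (T b + T a) + (T b - T a) := by module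
  rw [e1, e2] at hA hB
  apply smul_right_injective _ (two_ne_zero : (2 : K) ≠ 0)
  simp only [smul_add, smul_comm (2 : K) _ (T _), hA, hB]
  match_scalars
  · linear_combination -r1 - r2
  · linear_combination -r1 + r2

theorem ActsByRho.deltaE_zero_mul (hT : ActsByRho im t z T) (hz : Regular im t z)
    (him : im ^ 2 = -1) (ht : Generic t) (hy : y ≠ 0) (hx : x = z * y) :
    deltaE N im t y x .zero * T = T * deltaE N im t x y .zero := by
  have key : LinearMap.eqLocus (deltaE N im t y x .zero * T) (T * deltaE N im t x y .zero) = ⊤ := by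
    -- The vectors on which both sides agree are stable under f_r, r ≥ 1, which commutes with T and
    -- with e_0 for either order of the parameters. Hence only singular vectors need checking.
    refine eq_top_of_singVec_mem (im := im) ht (fun r hr v hv => ?_) fun i => ?_
    · have hv' : deltaE N im t y x .zero (T v) = T (deltaE N im t x y .zero v) := hv
      have h1 := LinearMap.congr_fun (hT.comm_deltaF_of_ne him ht hr)
      have h2 := fun x y => LinearMap.congr_fun
        (deltaE_comm_deltaF (N := N) him ht (x := x) (y := y) (x' := 1) (y' := 1) hr.symm)
      simp only [Module.End.mul_apply] at h1 h2
      change deltaE N im t y x .zero (T (deltaF N im t 1 1 r v)) =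
        T (deltaE N im t x y .zero (deltaF N im t 1 1 r v))
      rw [← h1, h2, hv', h2, h1]
    · change deltaE N im t y x .zero (T (singVec N t i)) =
        T (deltaE N im t x y .zero (singVec N t i))
      obtain ⟨σ, l⟩ := i
      have hm : ∀ σ : PM, signedSum N t (σ.sign K) 1 ∈ component N im t (σ, 1) := fun σ => by
        have := singVec_mem (N := N) him ht (σ, 0 + 1)
        rwa [singVec_succ] at this
      cases l with
      | zero =>
        refine hT.deltaE_zero_apply_of_mem hz ht hx ?_ fun τ => ?_
        · rw [hT _ _ (singVec_mem him ht _), rho_zero, one_smul]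
        · cases σ
          · have := crL_add_crR_zero_signedSum_mem ht (fClosed_component him ht (τ, 1))
              τ.sign_sq 0 (hm τ)
            rwa [signedSum_zero ht, pow_zero, one_smul] at this
          · exact crL_add_crR_zero_vMinusZero_mem ht (fClosed_component him ht _) τ.sign_sq (hm τ)
      | succ l =>
        rw [singVec_succ]
        exact hT.deltaE_zero_apply_of_signedSum hz him ht hy hx σ l
  exact LinearMap.ext fun v => (key ▸ Submodule.mem_top : v ∈ LinearMap.eqLocus _ _)

/-- T is a scalar on each of the mutually orthogonal components. -/
theorem ActsByRho.form2_apply (hT : ActsByRho im t z T) (him : im ^ 2 = -1) (ht : Generic t)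
    (u v : Fock2 K N) : form2 t (T u) v = form2 t u (T v) := by
  refine component_induction him ht (p := fun u => form2 t (T u) v = form2 t u (T v))
    (fun i u hu => ?_) (fun u u' h h' => ?_) u
  · refine component_induction him ht (p := fun v => form2 t (T u) v = form2 t u (T v))
      (fun j v hv => ?_) (fun v v' h h' => ?_) v
    · rw [hT i u hu, hT j v hv, map_smul, map_smul, LinearMap.smul_apply]
      rcases eq_or_ne i j with rfl | hij
      · rfl
      · rw [form2_component him ht hij hu hv, smul_zero, smul_zero]
    · rw [map_add, map_add, map_add, h, h']
  · rw [map_add, map_add, LinearMap.add_apply, map_add, LinearMap.add_apply, h, h']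

theorem ActsByRho.deltaF_mul (hT : ActsByRho im t z T) (hz : Regular im t z)
    (him : im ^ 2 = -1) (ht : Generic t) (hx0 : x ≠ 0) (hy : y ≠ 0) (hx : x = z * y)
    (r : Vertex N) : deltaF N im t y x r * T = T * deltaF N im t x y r := by
  by_cases hr : r = .zero
  · subst hr
    -- Adjoints exchange source and target and invert the parameters, so e_0 is used at (y⁻¹, x⁻¹),
    -- which has the same ratio z.
    have h1 := hT.deltaE_zero_mul hz him ht (x := y⁻¹) (y := x⁻¹) (inv_ne_zero hx0) (by
      rw [hx] at hx0 ⊢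
      field_simp
      exact (div_self (left_ne_zero_of_mul hx0)).symm)
    have h2 := hT.comm_deltaKInv him ht .zero
    refine LinearMap.ext fun u => ?_
    rw [← sub_eq_zero]
    refine eq_zero_of_form2 ht fun v => ?_
    rw [form2_symm, map_sub, LinearMap.sub_apply, sub_eq_zero, Module.End.mul_apply,
      Module.End.mul_apply, isAdj_deltaF him ht, hT.form2_apply him ht, hT.form2_apply him ht,
      isAdj_deltaF him ht]
    simp only [LinearMap.smul_apply, map_smul]
    congr 2
    simp only [← Module.End.mul_apply, ← mul_assoc]
    rw [← h2, mul_assoc, mul_assoc, h1]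
  · rw [deltaF_eq_one hr y x, deltaF_eq_one hr x y]
    exact hT.comm_deltaF_of_ne him ht hr

theorem ActsByRho.deltaE_mul (hT : ActsByRho im t z T) (hz : Regular im t z)
    (him : im ^ 2 = -1) (ht : Generic t) (hy : y ≠ 0) (hx : x = z * y)
    (r : Vertex N) : deltaE N im t y x r * T = T * deltaE N im t x y r := by
  by_cases hr : r = .zero
  · subst hr
    exact hT.deltaE_zero_mul hz him ht hy hx
  · rw [deltaE_eq_one hr y x, deltaE_eq_one hr x y]
    exact hT.comm_deltaE_of_ne him ht hr

end Intertwiner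

end QOsc

namespace QOsc

/-! ### The vacuum generates V_x ⊗ V_y. -/

section Cyclic

variable {K : Type*} [Field K] {N : ℕ} {im t x y z : K} {S : Submodule K (Fock2 K N)}

attribute [local instance] addCommGroupFock2

/-- Stability under all `e_r` and `f_r`, `0 ≤ r ≤ n`. -/
structure DeltaClosed (im t x y : K) (S : Submodule K (Fock2 K N)) : Prop where
  deltaE_mem : ∀ r, ∀ v ∈ S, deltaE N im t x y r v ∈ S
  deltaF_mem : ∀ r, ∀ v ∈ S, deltaF N im t x y r v ∈ S

theorem DeltaClosed.fClosed (hS : DeltaClosed im t x y S) : FClosed im t S := fun r hr v hv => by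
  rw [← deltaF_eq_one hr x y]
  exact hS.deltaF_mem r v hv

theorem DeltaClosed.deltaE_one_mem (hS : DeltaClosed im t x y S) {r : Vertex N} (hr : r ≠ .zero)
    {v : Fock2 K N} (hv : v ∈ S) : deltaE N im t 1 1 r v ∈ S := by
  rw [← deltaE_eq_one hr x y]
  exact hS.deltaE_mem r v hv

theorem DeltaClosed.crL_add_crR_mem (hS : DeltaClosed im t x y S) (ht : Generic t) (hy : y ≠ 0)
    (hx : x = z * y) {v : Fock2 K N} (hv : v ∈ S) :
    (z * (-im * t)) • crL t 0 v + crR 0 v ∈ S := by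
  have := hS.deltaE_mem .zero v hv
  rw [deltaE_zero ht, LinearMap.add_apply, LinearMap.smul_apply, LinearMap.smul_apply] at this
  rw [← Submodule.smul_mem_iff _ hy]
  convert this using 1
  rw [hx]
  module

theorem deltaE_mid_crR (ht : Generic t) {i : Fin (N + 1)} {j : Fin N} (hj : j.castSucc < i)
    {u : Fock2 K N} (hu : u ∈ emptyBelow i) :
    deltaE N im t 1 1 (.mid j) (crR j.castSucc u) = crR j.succ u := by
  refine eqOn_emptyBelow (f := deltaE N im t 1 1 (.mid j) * crR j.castSucc) (fun a b h => ?_) hu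
  have h1 := h _ hj
  rw [Module.End.mul_apply, crR_ket2, deltaE_mid_ket2, crR_ket2, add_tsub_cancel_right]
  simp [h1, site_same, ht.qNum_one]

theorem deltaE_mid_crL (ht : Generic t) {i : Fin (N + 1)} {j : Fin N} (hj : j.castSucc < i)
    {u : Fock2 K N} (hu : u ∈ emptyBelow i) :
    deltaE N im t 1 1 (.mid j) (crL t j.castSucc u) = crL t j.succ u := by
  refine eqOn_emptyBelow (f := deltaE N im t 1 1 (.mid j) * crL t j.castSucc)
    (fun a b h => ?_) hu
  have h1 := h _ hj
  rw [Module.End.mul_apply, crL_ket2, map_smul, deltaE_mid_ket2, crL_ket2, add_tsub_cancel_right]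
  simp [h1, site_same, ht.qNum_one]

/-- The inverse of the descent: e_j carries the created particle from the first site up to site k.
-/
theorem DeltaClosed.crL_add_crR_mem_of_zero (hS : DeltaClosed im t x y S) (ht : Generic t)
    {i k : Fin (N + 1)} (hk : k ≤ i) {u : Fock2 K N} (hu : u ∈ emptyBelow i) {α β : K}
    (h : α • crL t 0 u + β • crR 0 u ∈ S) : α • crL t k u + β • crR k u ∈ S := by
  induction k using Fin.induction with
  | zero => exact h
  | succ j ih =>
    have hj : j.castSucc < i := Fin.castSucc_lt_succ.trans_le hk
    have := hS.deltaE_one_mem (r := .mid j) (by simp) (ih hj.le)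
    rwa [map_add, map_smul, map_smul, deltaE_mid_crL ht hj hu, deltaE_mid_crR ht hj hu] at this

theorem ket2_zero_mem_emptyBelow (i : Fin (N + 1)) : (ket2 0 0 : Fock2 K N) ∈ emptyBelow i :=
  Submodule.subset_span ⟨0, 0, fun _ _ => ⟨rfl, rfl⟩, rfl⟩

theorem lastKet_mem_emptyBelow (k l : ℕ) :
    (lastKet N k l : Fock2 K N) ∈ emptyBelow (Fin.last N) :=
  Submodule.subset_span ⟨_, _, fun _ hj => ⟨site_ne hj.ne _, site_ne hj.ne _⟩, rfl⟩

theorem deltaF_zero_ket2 (a b : Fin (N + 1) → ℕ) : deltaF N im t x y .zero (ket2 a b) =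
    (im * kappa (t ^ 2) * x⁻¹ * qNum (t ^ 2) (a 0)) • ket2 (a - site 0 1) b +
      ((-im * t ^ (2 * (a 0 : ℤ) + 1))⁻¹ * (im * kappa (t ^ 2) * y⁻¹) * qNum (t ^ 2) (b 0)) •
        ket2 a (b - site 0 1) := by
  simp only [deltaF, LinearMap.add_apply, map_ket2, fOp_zero, LinearMap.smul_apply, an_ket,
    Module.End.one_apply, kInvOp_eq, dg_ket, kEig, TensorProduct.tmul_smul,
    ← TensorProduct.smul_tmul', smul_smul]
  simp only [ket2]
  congr 2
  ring

theorem kappa_ne_zero [CharZero K] (ht : Generic t) : kappa (t ^ 2) ≠ 0 := by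
  refine div_ne_zero (fun h => ht.pow_ne_one 4 (by norm_num) ?_)
    (fun h => ht.pow_ne_one 2 (by norm_num) ?_)
  · linear_combination (t ^ 2 - 1) * h
  · linear_combination h

/-- The product of the two denominators of opposite sign. -/
theorem Regular.one_sub_sq_ne_zero (hz : Regular im t z) (l : ℕ) :
    1 - (z * (-im * t)) ^ 2 * ((t ^ 2) ^ l) ^ 2 ≠ 0 := by
  have h1 := hz .plus l
  have h2 := hz .minus l
  rw [qHalf_succ] at h1 h2
  simp only [PM.sign] at h1 h2
  convert mul_ne_zero h1 h2 using 1
  ring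

theorem DeltaClosed.lastKet_sub_mem_castSucc {M : ℕ} {S : Submodule K (Fock2 K (M + 1))}
    (hS : DeltaClosed im t x y S) (ht : Generic t) (h0 : ket2 0 0 ∈ S) :
    topKet M 1 1 0 0 - t ^ 2 • topKet M 0 0 1 1 ∈ S := by
  have := hS.fClosed (.mid (Fin.last M)) (by simp) _ (hS.fClosed .last (by simp) _ h0)
  rw [← topKet_zero, deltaF_last_topKet, map_sub, map_smul, deltaF_mid_topKet,
    deltaF_mid_topKet] at this
  rw [← Submodule.smul_mem_iff _ (ht.qNum_ne_zero (m := 2) (by norm_num))]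
  convert this using 1
  simp [smul_sub, smul_smul, mul_comm]

/-- Two particles are created by f_n and one is destroyed by f_0. The result complements the
one-particle vector that e_0 makes from the vacuum. -/
theorem DeltaClosed.lastKet_add_mem_dual [CharZero K] (hS : DeltaClosed im t x y S)
    (him : im ^ 2 = -1) (ht : Generic t) (hx0 : x ≠ 0) (hy : y ≠ 0) (hx : x = z * y)
    (h0 : ket2 0 0 ∈ S) : lastKet N 1 0 + (z * (-im * t)) • lastKet N 0 1 ∈ S := by
  have hi : im ≠ 0 := by rintro rfl; simp at him
  have ht0 := ht.ne_zero
  have hκ := kappa_ne_zero ht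
  have hz0 : z ≠ 0 := by rintro rfl; exact hx0 (by rw [hx, zero_mul])
  have hne : im * kappa (t ^ 2) * x⁻¹ ≠ 0 := mul_ne_zero (mul_ne_zero hi hκ) (inv_ne_zero hx0)
  cases N with
  | zero =>
    have h1 : lastKet 0 0 0 ∈ S := by simpa [lastKet, site_zero] using h0
    have h2 := hS.deltaF_mem .zero _ (hS.fClosed .last (by simp) _ h1)
    have hlast : Fin.last 0 = 0 := rfl
    rw [deltaF_last_lastKet, map_sub, map_smul, lastKet, lastKet, deltaF_zero_ket2,
      deltaF_zero_ket2] at h2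
    simp only [hlast, site_same, site_sub, site_zero, Nat.cast_zero, qNum_zero,
      mul_zero, zero_smul, zero_add, add_zero, Nat.reduceSub, Nat.cast_ofNat, zpow_one,
      pow_one] at h2
    have hne' := mul_ne_zero hne (ht.qNum_ne_zero (m := 2) (by norm_num))
    rw [← Submodule.smul_mem_iff _ hne']
    convert h2 using 1
    simp only [lastKet, hlast, site_zero]
    rw [hx] at hx0 ⊢
    match_scalars
    · ring
    · field_simp
      linear_combination -qNum (t ^ 2) 2 * him
  | succ M =>
    have h1 := hS.lastKet_sub_mem_castSucc ht h0
    -- The particle at site n - 1 is carried to the first site, where f_0 removes it; the one at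
    -- site n stays.
    have h2 : crL t 0 (topKet M 0 1 0 0) + crR 0 (-t ^ 2 • topKet M 0 0 0 1) ∈ S := by
      rw [← lastKet_eq_topKet, ← lastKet_eq_topKet]
      refine crL_add_crR_zero_mem_of_mem ht hS.fClosed (Fin.castSucc_lt_last (Fin.last M))
        (lastKet_mem_emptyBelow _ _) (Submodule.smul_mem _ _ (lastKet_mem_emptyBelow _ _)) ?_
      rw [lastKet_eq_topKet, lastKet_eq_topKet, map_smul, crR_topKet, crL_topKet]
      simpa [sub_eq_add_neg] using h1
    have h3 := hS.deltaF_mem .zero _ h2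
    have hlast : (0 : Fin (M + 2)) ≠ Fin.last (M + 1) := (Fin.last_pos).ne
    rw [← lastKet_eq_topKet, ← lastKet_eq_topKet, lastKet, lastKet, map_smul, crL_ket2, crR_ket2,
      map_add, map_smul, map_smul, deltaF_zero_ket2, deltaF_zero_ket2] at h3
    simp only [site_zero, Pi.add_apply, site_ne hlast, site_same, zero_add,
      Nat.cast_zero, qNum_zero, mul_zero, zero_smul, add_zero, pow_zero, one_smul, Nat.cast_one,
      ht.qNum_one, mul_one, add_tsub_cancel_right, zpow_one] at h3
    rw [← Submodule.smul_mem_iff _ hne]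
    convert h3 using 1
    simp only [lastKet, site_zero]
    rw [hx] at hx0 ⊢
    match_scalars
    · ring
    · field_simp
      linear_combination -him

/-- Two combinations of the same two kets, with determinant the product of the denominators for j =
1. -/
theorem DeltaClosed.lastKet_one_mem [CharZero K] (hS : DeltaClosed im t x y S)
    (hz : Regular im t z)
    (him : im ^ 2 = -1) (ht : Generic t) (hx0 : x ≠ 0) (hy : y ≠ 0) (hx : x = z * y)
    (h0 : ket2 0 0 ∈ S) : lastKet N 1 0 ∈ S ∧ lastKet N 0 1 ∈ S := by
  have h1 := hS.lastKet_add_mem_dual him ht hx0 hy hx h0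
  have h2 : (z * (-im * t)) • lastKet N 1 0 + lastKet N 0 1 ∈ S := by
    have := hS.crL_add_crR_mem_of_zero ht (le_refl (Fin.last N)) (ket2_zero_mem_emptyBelow _)
      (α := z * (-im * t)) (β := 1) (by
        rw [one_smul]
        exact hS.crL_add_crR_mem ht hy hx h0)
    rw [one_smul, crL_ket2, crR_ket2] at this
    simpa [lastKet, site_zero] using this
  have hc := hz.one_sub_sq_ne_zero 0
  constructor
  · rw [← Submodule.smul_mem_iff _ hc]
    convert S.sub_mem h1 (S.smul_mem (z * (-im * t)) h2) using 1
    match_scalars <;> ring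
  · rw [← Submodule.smul_mem_iff _ hc]
    convert S.sub_mem h2 (S.smul_mem (z * (-im * t)) h1) using 1
    match_scalars <;> ring

/-- For n ≥ 2, the four kets with one particle at each of the sites n - 1 and n satisfy the
relations `hξ`, `p1`, `p2`, `p3`. These are solvable because the denominators for j = 2 do not
vanish. -/
theorem DeltaClosed.vMinusZero_mem [CharZero K] (hS : DeltaClosed im t x y S)
    (hz : Regular im t z)
    (him : im ^ 2 = -1) (ht : Generic t) (hx0 : x ≠ 0) (hy : y ≠ 0) (hx : x = z * y)
    (h0 : ket2 0 0 ∈ S) : vMinusZero t N ∈ S := by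
  cases N with
  | zero => exact S.zero_mem
  | succ M =>
    have ht0 := ht.ne_zero
    obtain ⟨h1, h2⟩ := hS.lastKet_one_mem hz him ht hx0 hy hx h0
    have hξ := hS.lastKet_sub_mem_castSucc ht h0
    have hasc : ∀ {u : Fock2 K (M + 1)}, u ∈ emptyBelow (Fin.last (M + 1)) → u ∈ S →
        (z * (-im * t)) • crL t (Fin.last M).castSucc u + crR (Fin.last M).castSucc u ∈ S := by
      intro u hu hu'
      have := hS.crL_add_crR_mem_of_zero ht (Fin.castSucc_lt_last (Fin.last M)).le hu
        (α := z * (-im * t)) (β := 1) (by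
          rw [one_smul]
          exact hS.crL_add_crR_mem ht hy hx hu')
      rwa [one_smul] at this
    have p1 := hasc (lastKet_mem_emptyBelow _ _) h1
    have p2 := hasc (lastKet_mem_emptyBelow _ _) h2
    rw [lastKet_eq_topKet, crL_topKet, crR_topKet] at p1 p2
    have p3 := hS.fClosed (.mid (Fin.last M)) (by simp) _
      (hS.deltaE_one_mem (r := .mid (Fin.last M)) (by simp) p1)
    simp only [map_add, map_smul, deltaE_mid_topKet, deltaF_mid_topKet] at p3
    simp only [Nat.cast_zero, qNum_zero, mul_zero, zero_smul, zero_add, pow_zero, one_smul,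
      Nat.cast_one, ht.qNum_one, mul_one, Nat.reduceAdd, Nat.reduceSub, Nat.cast_ofNat,
      zero_sub, sub_self, zpow_zero, add_zero, zpow_neg_one, ht.qNum_two] at p1 p2 p3
    have hc := hz.one_sub_sq_ne_zero 1
    have q1 : topKet M 1 1 0 0 ∈ S := by
      rw [← Submodule.smul_mem_iff _ hc]
      convert S.add_mem hξ (S.smul_mem (t ^ 2) (S.sub_mem p2 (S.smul_mem (z * (-im * t))
        (S.sub_mem p3 (S.smul_mem (t ^ 2)⁻¹ p1))))) using 1
      match_scalars <;> field_simp <;> ring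
    have q2 : topKet M 1 0 0 1 ∈ S := by
      convert S.sub_mem (S.sub_mem p3 (S.smul_mem (t ^ 2)⁻¹ p1))
        (S.smul_mem (z * (-im * t) * t ^ 2) q1) using 1
      match_scalars <;> field_simp <;> ring
    have q3 : topKet M 0 1 1 0 ∈ S := by
      convert S.sub_mem p1 (S.smul_mem (z * (-im * t)) q1) using 1
      module
    rw [vMinusZero_succ]
    exact S.sub_mem q2 (S.smul_mem _ q3)

/-- e_0 v is a combination of the lower vector `h'` and the upper one, the coefficient of the latter
being a denominator up to nonzero scalars. The upper vector, carried to the last site, is v_{l+2} by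
`signedSum_succ`. -/
theorem DeltaClosed.signedSum_succ_mem [CharZero K] (hS : DeltaClosed im t x y S)
    (hz : Regular im t z) (ht : Generic t) (hy : y ≠ 0) (hx : x = z * y) (σ : PM) (l : ℕ)
    (h : signedSum N t (σ.sign K) (l + 1) ∈ S)
    (h' : crL t 0 (signedSum N t (σ.sign K) (l + 1)) -
      (σ.sign K * (t ^ 2) ^ (l + 1)) • crR 0 (signedSum N t (σ.sign K) (l + 1)) ∈ S) :
    signedSum N t (σ.sign K) (l + 2) ∈ S := by
  have hs := σ.sign_sq (K := K)
  have h1 := hS.crL_add_crR_mem ht hy hx h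
  have hr : 1 + σ.sign K * (z * (-im * t) * (t ^ 2) ^ (l + 1)) ≠ 0 := by
    have := hz σ (l + 1)
    rw [qHalf_succ] at this
    convert this using 1
    ring
  have h2 : (t ^ 2) ^ (l + 1) • crL t 0 (signedSum N t (σ.sign K) (l + 1)) +
      σ.sign K • crR 0 (signedSum N t (σ.sign K) (l + 1)) ∈ S := by
    rw [← Submodule.smul_mem_iff _ hr]
    convert S.sub_mem (S.smul_mem (σ.sign K * (1 + ((t ^ 2) ^ (l + 1)) ^ 2)) h1)
      (S.smul_mem (σ.sign K * (z * (-im * t)) - (t ^ 2) ^ (l + 1)) h') using 1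
    generalize (t ^ 2) ^ (l + 1) = q
    generalize σ.sign K = s at *
    match_scalars
    · ring
    · ring
  have h3 := hS.crL_add_crR_mem_of_zero ht (le_refl (Fin.last N))
    (signedSum_mem_emptyBelow (σ.sign K) (l + 1)) h2
  rw [signedSum_succ ht]
  convert S.smul_mem (σ.sign K) h3 using 1
  generalize (t ^ 2) ^ (l + 1) = q
  generalize σ.sign K = s at *
  match_scalars
  · linear_combination -hs
  · ring

/-- `V_x ⊗ V_y` is generated by the vacuum. -/
theorem DeltaClosed.eq_top [CharZero K] (hS : DeltaClosed im t x y S)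
    (hz : Regular im t z) (him : im ^ 2 = -1) (ht : Generic t) (hx0 : x ≠ 0) (hy : y ≠ 0)
    (hx : x = z * y) (h0 : ket2 0 0 ∈ S) : S = ⊤ := by
  have hm := hS.vMinusZero_mem hz him ht hx0 hy hx h0
  obtain ⟨h1, h2⟩ := hS.lastKet_one_mem hz him ht hx0 hy hx h0
  have key : ∀ (σ : PM) (l : ℕ), signedSum N t (σ.sign K) (l + 1) ∈ S ∧
      crL t 0 (signedSum N t (σ.sign K) (l + 1)) -
        (σ.sign K * (t ^ 2) ^ (l + 1)) • crR 0 (signedSum N t (σ.sign K) (l + 1)) ∈ S := by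
    intro σ l
    induction l with
    | zero =>
      constructor
      · refine S.sum_mem fun x hx => S.smul_mem _ ?_
        obtain ⟨k, j⟩ := x
        have hl := Finset.HasAntidiagonal.mem_antidiagonal.1 hx
        simp only at hl
        obtain ⟨rfl, rfl⟩ | ⟨rfl, rfl⟩ : k = 1 ∧ j = 0 ∨ k = 0 ∧ j = 1 := by omega
        · exact h1
        · exact h2
      · rw [zero_add, pow_one]
        exact crL_sub_crR_zero_signedSum_one_mem ht hS.fClosed σ.sign_sq h0 hm
    | succ l ih =>
      exact ⟨hS.signedSum_succ_mem hz ht hy hx σ l ih.1 ih.2,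
        crL_sub_crR_zero_signedSum_mem ht hS.fClosed σ.sign_sq l ih.1⟩
  refine eq_top_of_singVec_mem ht hS.fClosed fun i => ?_
  obtain ⟨σ, l⟩ := i
  cases l with
  | zero =>
    cases σ
    · exact h0
    · exact hm
  | succ l =>
    rw [singVec_succ]
    exact (key σ l).1

end Cyclic

end QOsc

namespace QOsc

/-! ### From T to R: existence, uniqueness, spectral formula. -/

section Main

variable {K : Type*} [Field K] {N : ℕ} {im t x y z : K}

attribute [local instance] addCommGroupFock2

/-- The flip of the two factors of `V ⊗ V`. -/
noncomputable def flip : Fock2 K N →ₗ[K] Fock2 K N :=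
  (TensorProduct.comm K (Fock K N) (Fock K N)).toLinearMap

theorem flip_map (f g : Module.End K (Fock K N)) :
    (flip ∘ₗ TensorProduct.map f g : Module.End K (Fock2 K N)) =
      TensorProduct.map g f ∘ₗ flip :=
  TensorProduct.ext' fun _ _ => rfl

/-- The flip also exchanges x and y; this turns the intertwining property of T into that of `flip ∘ₗ
T`. -/
theorem flip_deltaE (x y : K) (r : Vertex N) :
    deltaE' N im t x y r ∘ₗ flip = flip ∘ₗ deltaE N im t y x r := by
  rw [deltaE', deltaE, LinearMap.add_comp, LinearMap.comp_add, flip_map, flip_map]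

theorem flip_deltaF (x y : K) (r : Vertex N) :
    deltaF' N im t x y r ∘ₗ flip = flip ∘ₗ deltaF N im t y x r := by
  rw [deltaF', deltaF, LinearMap.add_comp, LinearMap.comp_add, flip_map, flip_map]

theorem flip_deltaK (r : Vertex N) :
    deltaK N im t r ∘ₗ flip = flip ∘ₗ deltaK N im t r := by
  rw [deltaK, flip_map]

theorem flip_comp_flip : (flip ∘ₗ flip : Fock2 K N →ₗ[K] Fock2 K N) = LinearMap.id :=
  TensorProduct.ext' fun _ _ => rfl

theorem comm_flip (v : Fock2 K N) : TensorProduct.comm K (Fock K N) (Fock K N) (flip v) = v :=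
  LinearMap.congr_fun flip_comp_flip v

theorem exists_actsByRho [CharZero K] (him : im ^ 2 = -1) (ht : Generic t) (z : K) :
    ∃ T : Module.End K (Fock2 K N), ActsByRho im t z T :=
  exists_end_eq_smul (isInternal_component him ht) (rho im t z)

theorem ActsByRho.isQuantumR [CharZero K] {T : Module.End K (Fock2 K N)}
    (hT : ActsByRho im t z T) (hz : Regular im t z) (him : im ^ 2 = -1) (ht : Generic t)
    (hx0 : x ≠ 0) (hy : y ≠ 0) (hx : x = z * y) : IsQuantumR N im t x y (flip ∘ₗ T) where
  comm_k r := by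
    have h := hT.comm_deltaK him ht r
    calc deltaK N im t r * (flip ∘ₗ T) = flip ∘ₗ (deltaK N im t r * T) := by
          rw [Module.End.mul_eq_comp, ← LinearMap.comp_assoc, flip_deltaK]; rfl
      _ = _ := by rw [h]; rfl
  comm_e r := by
    have h := hT.deltaE_mul hz him ht hy hx r
    calc deltaE' N im t x y r * (flip ∘ₗ T) = flip ∘ₗ (deltaE N im t y x r * T) := by
          rw [Module.End.mul_eq_comp, ← LinearMap.comp_assoc, flip_deltaE]; rfl
      _ = _ := by rw [h]; rfl
  comm_f r := by
    have h := hT.deltaF_mul hz him ht hx0 hy hx r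
    calc deltaF' N im t x y r * (flip ∘ₗ T) = flip ∘ₗ (deltaF N im t y x r * T) := by
          rw [Module.End.mul_eq_comp, ← LinearMap.comp_assoc, flip_deltaF]; rfl
      _ = _ := by rw [h]; rfl
  normalized := by
    have h := hT.apply_ket2_zero him ht
    change flip (T (ket2 0 0)) = ket2 0 0
    rw [h]
    rfl

/-- The vectors where R and R' agree form a subspace stable under all e_r and f_r that contains the
vacuum. -/
theorem IsQuantumR.unique [CharZero K] {R R' : Module.End K (Fock2 K N)}
    (hR : IsQuantumR N im t x y R) (hR' : IsQuantumR N im t x y R') (hz : Regular im t z)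
    (him : im ^ 2 = -1) (ht : Generic t) (hx0 : x ≠ 0) (hy : y ≠ 0) (hx : x = z * y) :
    R = R' := by
  have hS : DeltaClosed im t x y (LinearMap.eqLocus R R') := by
    constructor
    · intro r v hv
      have h := LinearMap.congr_fun (hR.comm_e r) v
      have h' := LinearMap.congr_fun (hR'.comm_e r) v
      have hv' : R v = R' v := hv
      change R (deltaE N im t x y r v) = R' (deltaE N im t x y r v)
      rw [Module.End.mul_apply, Module.End.mul_apply] at h h'
      rw [← h, ← h', hv']
    · intro r v hv
      have h := LinearMap.congr_fun (hR.comm_f r) v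
      have h' := LinearMap.congr_fun (hR'.comm_f r) v
      have hv' : R v = R' v := hv
      change R (deltaF N im t x y r v) = R' (deltaF N im t x y r v)
      rw [Module.End.mul_apply, Module.End.mul_apply] at h h'
      rw [← h, ← h', hv']
  have h0 : (ket2 0 0 : Fock2 K N) ∈ LinearMap.eqLocus R R' :=
    hR.normalized.trans hR'.normalized.symm
  have key := hS.eq_top hz him ht hx0 hy hx h0
  exact LinearMap.ext fun v => (key ▸ Submodule.mem_top : v ∈ LinearMap.eqLocus R R')

/-- Both claims pass to sums of vectors, so v may be taken in one component, where at most one term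
of the sum survives. Finiteness is carried along since `finsum` is additive only under finite
support. -/
theorem ActsByRho.finite_and_apply_eq [CharZero K] {T : Module.End K (Fock2 K N)}
    (hT : ActsByRho im t z T) (him : im ^ 2 = -1) (ht : Generic t) (v : Fock2 K N) :
    {l : ℕ+ | projPlus N im t l v ≠ 0 ∨ projMinus N im t l v ≠ 0}.Finite ∧
      T v = projZero N im t v + ∑ᶠ l : ℕ+, (rho im t z (.plus, l) • projPlus N im t l v +
        rho im t z (.minus, l) • projMinus N im t l v) := by
  have hI := isInternal_component (N := N) him ht
  refine component_induction him ht (p := fun v =>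
    {l : ℕ+ | projPlus N im t l v ≠ 0 ∨ projMinus N im t l v ≠ 0}.Finite ∧
      T v = projZero N im t v + ∑ᶠ l : ℕ+, (rho im t z (.plus, l) • projPlus N im t l v +
        rho im t z (.minus, l) • projMinus N im t l v)) ?_ ?_ v
  · rintro ⟨σ, m⟩ v hv
    have hne : ∀ τ k, (σ, m) ≠ (τ, k) → projector (component N im t) (τ, k) v = 0 :=
      fun τ k h => projector_apply_of_ne hI h hv
    have heq := projector_apply_self hI hv
    have hp : ∀ l : ℕ+, (l : ℕ) ≠ m → projPlus N im t l v = 0 ∧ projMinus N im t l v = 0 :=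
      fun l hl => ⟨hne _ _ fun h => hl (Prod.ext_iff.1 h).2.symm,
        hne _ _ fun h => hl (Prod.ext_iff.1 h).2.symm⟩
    have hfin : {l : ℕ+ | projPlus N im t l v ≠ 0 ∨ projMinus N im t l v ≠ 0}.Finite := by
      refine Set.Finite.subset (s := {l : ℕ+ | (l : ℕ) = m})
        (Set.Subsingleton.finite fun a ha b hb => PNat.coe_injective (ha.trans hb.symm)) ?_
      intro l hl
      by_contra h
      rcases hl with hl | hl
      · exact hl (hp l h).1
      · exact hl (hp l h).2
    refine ⟨hfin, ?_⟩
    rw [hT _ v hv]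
    cases m with
    | zero =>
      rw [finsum_eq_zero_of_forall_eq_zero, rho_zero, one_smul, projZero, LinearMap.add_apply,
        add_zero]
      · cases σ
        · rw [heq, hne _ _ (by simp), add_zero]
        · rw [heq, hne _ _ (by simp), zero_add]
      · intro l
        rw [(hp l l.ne_zero).1, (hp l l.ne_zero).2, smul_zero, smul_zero, add_zero]
    | succ m =>
      rw [finsum_eq_single _ ⟨m + 1, m.succ_pos⟩, projZero, LinearMap.add_apply, hne _ _ (by simp),
        hne _ _ (by simp), add_zero, zero_add, projPlus, projMinus, PNat.mk_coe]
      · cases σ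
        · rw [heq, hne _ _ (by simp), smul_zero, add_zero]
        · rw [heq, hne _ _ (by simp), smul_zero, zero_add]
      · intro l hl
        have hl' : (l : ℕ) ≠ m + 1 := fun h => hl (PNat.coe_injective h)
        rw [(hp l hl').1, (hp l hl').2, smul_zero, smul_zero, add_zero]
  · rintro u v ⟨hu, hu'⟩ ⟨hv, hv'⟩
    have hsupp : ∀ w : Fock2 K N,
        {l : ℕ+ | projPlus N im t l w ≠ 0 ∨ projMinus N im t l w ≠ 0}.Finite →
        (Function.support fun l : ℕ+ => rho im t z (.plus, l) • projPlus N im t l w +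
          rho im t z (.minus, l) • projMinus N im t l w).Finite := fun w hw => by
      refine hw.subset fun l hl => ?_
      by_contra h
      simp only [Set.mem_ofPred_eq, not_or, not_not] at h
      apply hl
      simp only [h.1, h.2, smul_zero, add_zero]
    constructor
    · refine (hu.union hv).subset fun l hl => ?_
      by_contra h
      simp only [Set.mem_union, Set.mem_ofPred_eq, not_or, not_not] at h
      simp only [Set.mem_ofPred_eq, map_add, h, add_zero, ne_eq, not_true_eq_false, or_self] at hl
    · rw [map_add, hu', hv', map_add, add_add_add_comm,
        ← finsum_add_distrib (hsupp u hu) (hsupp v hv)]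
      congr 1
      refine finsum_congr fun l => ?_
      rw [map_add, map_add]
      module

end Main

end QOsc

theorem proposition3p7 {K : Type*} [Field K] [CharZero K] (N : ℕ) (im t x y : K)
    (him : im ^ 2 = -1) (ht0 : t ≠ 0) (ht : ∀ m : ℕ, 0 < m → t ^ m ≠ 1)
    (hx : x ≠ 0) (hy : y ≠ 0)
    (hz : ∀ j : ℕ, 1 ≤ j → 1 - im * QOsc.qHalf t j * (x / y) ≠ 0 ∧
      1 + im * QOsc.qHalf t j * (x / y) ≠ 0) :
    DirectSum.IsInternal (QOsc.component N im t) ∧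
    (∃! R : Module.End K (QOsc.Fock2 K N), QOsc.IsQuantumR N im t x y R) ∧
    ∀ R : Module.End K (QOsc.Fock2 K N), QOsc.IsQuantumR N im t x y R →
      ∀ v : QOsc.Fock2 K N,
        {l : ℕ+ | QOsc.projPlus N im t l v ≠ 0 ∨ QOsc.projMinus N im t l v ≠ 0}.Finite ∧
        TensorProduct.comm K (QOsc.Fock K N) (QOsc.Fock K N) (R v) =
          QOsc.projZero N im t v +
          ∑ᶠ l : ℕ+,
            ((∏ j ∈ Finset.Icc 1 (l : ℕ),
                (x / y - im * QOsc.qHalf t j) / (1 - im * QOsc.qHalf t j * (x / y))) •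
              QOsc.projPlus N im t l v +
             (∏ j ∈ Finset.Icc 1 (l : ℕ),
                (x / y + im * QOsc.qHalf t j) / (1 + im * QOsc.qHalf t j * (x / y))) •
              QOsc.projMinus N im t l v) := by
  have hg : QOsc.Generic t := ⟨ht0, ht⟩
  have hxy : x = x / y * y := (div_mul_cancel₀ x hy).symm
  have hr : QOsc.Regular im t (x / y) := by
    intro σ j
    have h := hz (j + 1) (by omega)
    cases σ
    · simpa [QOsc.PM.sign] using h.1
    · simpa [QOsc.PM.sign] using h.2
  obtain ⟨T, hT⟩ := QOsc.exists_actsByRho (N := N) him hg (x / y)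
  have hR := hT.isQuantumR hr him hg hx hy hxy
  refine ⟨QOsc.isInternal_component him hg,
    ⟨_, hR, fun R' hR' => hR'.unique hR hr him hg hx hy hxy⟩, fun R hR' v => ?_⟩
  obtain ⟨h1, h2⟩ := hT.finite_and_apply_eq him hg v
  refine ⟨h1, ?_⟩
  have h3 : TensorProduct.comm K (QOsc.Fock K N) (QOsc.Fock K N) (R v) = T v := by
    rw [hR'.unique hR hr him hg hx hy hxy]
    exact QOsc.comm_flip (T v)
  refine h3.trans (h2.trans ?_)
  simp only [QOsc.rho, QOsc.PM.sign, one_mul, neg_mul, sub_neg_eq_add]
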